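/- **Setting.** Let $\lambda,\mu:\mathbb R^3\to\mathbb R$ be bounded Borel Lamé parameters (density $1$) with $\mu\ge c$ and $3\lambda+2\mu\ge c$ for some constant $c>0$, continuous off a closed set $\Gamma$ of measure zero (for example piecewise smooth parameters with interfaces $\Gamma$). Put $\widehat\nabla f=\frac12(\nabla f+(\nabla f)^T)$, $Lu=\nabla\cdot(\lambda\,\mathrm{div}(u)\,\mathrm{Id}+2\mu\widehat\nabla u)$ and $c_P=\sqrt{\lambda+2\mu}$; let $d_P(x,y)$ be the infimum of the lengths, in the metric $c_P^{-2}dx^2$, of piecewise smooth paths from $x$ to $y$, and let $\mathrm{diam}_P$ be the corresponding diameter. For $s\in\mathbb R$ let $R_s$ map Cauchy data $(f_0,f_1)\in H^1(\mathbb R^3;\mathbb C^3)\oplus L^2(\mathbb R^3;\mathbb C^3)$ to the Cauchy data $(u,\partial_tu)|_{t=s}$ of the weak solution $u\in C(\mathbb R,H^1)\cap C^1(\mathbb R,L^2)$ of $\partial_t^2u=Lu$ with $(u,\partial_tu)|_{t=0}=(f_0,f_1)$. Let $\Theta$ and $\Upsilon$ be open sets in $\mathbb R^3$, $\Upsilon$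 bounded, $\overline\Theta\subset\Upsilon$, let $0<T<\frac12\mathrm{diam}_P\Theta$, and suppose $d_P(\partial\Upsilon,\overline\Theta)>T$. Let $d^*(x)$ be $d_P(x,\partial\Theta)$ for $x\in\Theta$ and $-d_P(x,\partial\Theta)$ for $x\notin\Theta$, and put $\Theta_t^\star=\{x\in\Upsilon: d^*(x)<t\}$, $\Theta^\star=\Theta^\star_0$. For open $U$ let $H^1_0(U)$ be the closure of $C_c^\infty(U;\mathbb C^3)$ in $H^1(\mathbb R^3;\mathbb C^3)$ and $L^2(U)$ the fields in $L^2(\mathbb R^3;\mathbb C^3)$ that vanish outside $U$; put $\mathbf H=H^1_0(\Theta)\oplus L^2(\Theta)$ and $\mathbf H^\star=H^1_0(\Theta^\star)\oplus L^2(\Theta^\star)$. Let $\pi^\star$ and $\pi^\star_T$ be the orthogonal projections, with respect to the energy inner product $$\langle f,g\rangle=\int_{\mathbb R^3}\big(f_1\cdot\bar g_1+\lambda\,\mathrm{div}f_0\,\mathrm{div}\,\bar g_0+2\mu\,\widehat\nabla f_0:\widehat\nabla\bar g_0\big)\,dx,$$ of $H^1(\mathbb R^3;\mathbb C^3)\oplus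 L^2(\mathbb R^3;\mathbb C^3)$ onto $\mathbf H^\star$ and onto $H^1_0(\Theta_T^\star)\oplus L^2(\Theta_T^\star)$. Put $\bar\pi=I-\pi^\star$, $\bar\pi_T=I-\pi_T^\star$, $\nu(f_0,f_1)=(f_0,-f_1)$ and $R=\nu R_{2T}$. **Claim.** Let $h_0\in\mathbf H$, $K_{\mathrm{tail}}\in\mathbf H^\star$ and $h_\infty=h_0+K_{\mathrm{tail}}$, and let $h_{\mathrm{DT}}=\bar\pi_TR_Th_0$ be the almost direct transmission of $h_0$ at time $T$. If $$R_{-T}\,\bar\pi\,R_{2T}h_\infty=h_{\mathrm{DT}},$$ then $h_\infty$ satisfies the scattering control equation $$(I-\pi^\star R\,\pi^\star R)h_\infty=h_0 .$$ -/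

import Mathlib

open Set Filter Topology MeasureTheory
open scoped ENNReal ContDiff

noncomputable section

namespace ElasticSC

/-- Physical space `ℝ³`. -/
abbrev E3 := EuclideanSpace ℝ (Fin 3)

/-- The space `ℂ³` of values of the displacement and the velocity. -/
abbrev C3 := EuclideanSpace ℂ (Fin 3)

/-- The space `L²(ℝ³; ℂ³)`. -/
abbrev VecL2 := Lp C3 2 (volume : Measure E3)

/-- A vector field together with its three partial derivatives, all in `L²(ℝ³; ℂ³)`;
`p.1` is the field and `p.2 j` is its derivative in the direction of the `j`-th coordinate.
Only those pairs matter that lie in `H10 univ` below. -/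
abbrev Jet := VecL2 × (Fin 3 → VecL2)

/-- Cauchy data: displacement (with its gradient) and velocity. -/
abbrev Data := Jet × VecL2

/-! ### The medium -/

/-- An isotropic elastic medium of density `1` in `ℝ³`: Lamé parameters that are bounded, satisfy
the strong convexity condition uniformly, and are continuous off a closed null set `Γ` (for
piecewise smooth parameters, the union of the interfaces). -/
structure Medium where
  lam : E3 → ℝ
  mu : E3 → ℝ
  lam_meas : Measurable lam
  mu_meas : Measurable mu
  bounded : ∃ M : ℝ, ∀ x, |lam x| ≤ M ∧ |mu x| ≤ M
  convex : ∃ c : ℝ, 0 < c ∧ ∀ x, c ≤ mu x ∧ c ≤ 3 * lam x + 2 * mu x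
  interfaces : ∃ Γ : Set E3, IsClosed Γ ∧ volume Γ = 0 ∧ ContinuousOn lam Γᶜ ∧ ContinuousOn mu Γᶜ

namespace Medium

variable (m : Medium)

/-- The speed of `P`-waves. -/
def cP (x : E3) : ℝ := Real.sqrt (m.lam x + 2 * m.mu x)

end Medium

/-! ### The `P`-distance -/

/-- `γ` is a continuous, piecewise smooth path on `[a, b]`. -/
def IsPiecewiseSmooth (γ : ℝ → E3) (a b : ℝ) : Prop :=
  a ≤ b ∧ ContinuousOn γ (Icc a b) ∧
    ∃ (n : ℕ) (t : ℕ → ℝ), Monotone t ∧ t 0 = a ∧ t n = b ∧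
      ∀ i < n, ContDiffOn ℝ ∞ γ (Icc (t i) (t (i + 1)))

/-- The length of `γ` on `[a, b]` for the metric `c_P⁻² dx²`. -/
def pLength (m : Medium) (γ : ℝ → E3) (a b : ℝ) : ℝ≥0∞ :=
  ∫⁻ s in Icc a b, ENNReal.ofReal (‖deriv γ s‖ / m.cP (γ s))

/-- The `P`-distance of two points: the infimum of the lengths of piecewise smooth paths. -/
def pDist (m : Medium) (x y : E3) : ℝ≥0∞ :=
  ⨅ (γ : ℝ → E3) (a : ℝ) (b : ℝ) (_ : IsPiecewiseSmooth γ a b ∧ γ a = x ∧ γ b = y),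
    pLength m γ a b

/-- The `P`-distance of two sets. -/
def pDistSets (m : Medium) (A B : Set E3) : ℝ≥0∞ := ⨅ x ∈ A, ⨅ y ∈ B, pDist m x y

/-- The `P`-diameter of a set. -/
def pDiam (m : Medium) (A : Set E3) : ℝ≥0∞ := ⨆ x ∈ A, ⨆ y ∈ A, pDist m x y

open Classical in
/-- The signed `P`-depth with respect to `Θ`. -/
def pDepth (m : Medium) (Θ : Set E3) (x : E3) : ℝ :=
  if x ∈ Θ then (pDistSets m {x} (frontier Θ)).toReal
  else -(pDistSets m {x} (frontier Θ)).toReal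

/-- The set `Θ_t^⋆` of the points of `Υ` whose `P`-depth is less than `t`. -/
def outer (m : Medium) (Θ Υ : Set E3) (t : ℝ) : Set E3 := {x ∈ Υ | pDepth m Θ x < t}

/-! ### Function spaces -/

/-- `H¹₀(U; ℂ³)`: the closure in the `H¹`-topology of the smooth fields whose support is a compact
subset of `U`. In particular `H10 univ` is `H¹(ℝ³; ℂ³)`. -/
def H10 (U : Set E3) : Submodule ℂ Jet :=
  (Submodule.span ℂ {p : Jet | ∃ φ : E3 → C3, ContDiff ℝ ∞ φ ∧ HasCompactSupport φ ∧
    tsupport φ ⊆ U ∧ (p.1 =ᵐ[volume] φ) ∧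
    ∀ j, p.2 j =ᵐ[volume] fun x => fderiv ℝ φ x (EuclideanSpace.single j 1)}).topologicalClosure

/-- `L²(U; ℂ³)`, as the space of the fields in `L²(ℝ³; ℂ³)` that vanish outside `U`. -/
def L2On (U : Set E3) : Submodule ℂ VecL2 where
  carrier := {f | ∀ᵐ x, x ∉ U → f x = 0}
  zero_mem' := by
    filter_upwards [Lp.coeFn_zero C3 2 (volume : Measure E3)] with x hx _
    rw [hx, Pi.zero_apply]
  add_mem' := by
    intro f g hf hg
    filter_upwards [hf, hg, Lp.coeFn_add f g] with x h1 h2 h3 hx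
    rw [h3, Pi.add_apply, h1 hx, h2 hx, add_zero]
  smul_mem' := by
    intro c f hf
    filter_upwards [hf, Lp.coeFn_smul c f] with x h1 h3 hx
    rw [h3, Pi.smul_apply, h1 hx, smul_zero]

/-- `H¹₀(U) ⊕ L²(U)`. -/
def cauchy (U : Set E3) : Submodule ℂ Data := (H10 U).prod (L2On U)

/-! ### Energy -/

/-- The divergence of a field. -/
def divergence (p : Jet) (x : E3) : ℂ := ∑ j, p.2 j x j

/-- The components of the symmetric gradient (strain) of a field. -/
def strain (p : Jet) (x : E3) (i j : Fin 3) : ℂ := (p.2 i x j + p.2 j x i) / 2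

/-- The sesquilinear form `∫ λ div p div q̄ + 2 μ ε(p) : ε(q̄)` of the operator `-L`. -/
def elasticForm (m : Medium) (p q : Jet) : ℂ :=
  ∫ x, ((m.lam x : ℂ) * (divergence p x * star (divergence q x)) +
    2 * (m.mu x : ℂ) * ∑ i, ∑ j, strain p x i j * star (strain q x i j))

/-- The elastic energy inner product of Cauchy data. -/
def energyInner (m : Medium) (f g : Data) : ℂ :=
  (∫ x, ∑ i, f.2 x i * star (g.2 x i)) + elasticForm m f.1 g.1

open Classical in
/-- The orthogonal projection onto `H¹₀(U) ⊕ L²(U)` for the energy inner product. (For bounded open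
`U` the defining property determines exactly one element, for all finite energy data `h`.) -/
def proj (m : Medium) (U : Set E3) (h : Data) : Data :=
  if H : ∃ p ∈ cauchy U, ∀ q ∈ cauchy U, energyInner m (h - p) q = 0 then H.choose else 0

/-! ### Elastic waves -/

/-- `u` is (the Cauchy data, as a function of time, of) a finite energy solution of
`∂ₜ² u = L u` on `ℝ × ℝ³`: the displacement is continuous with values in `H¹`, its time derivative
is continuous with values in `L²`, and the equation holds weakly. -/
def IsWave (m : Medium) (u : ℝ → Data) : Prop :=
  (∀ t, (u t).1 ∈ H10 univ) ∧ Continuous u ∧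
  (∀ t, HasDerivAt (fun s => (u s).1.1) (u t).2 t) ∧
  ∀ q ∈ H10 univ, ∀ t,
    HasDerivAt (fun s => ∫ x, ∑ i, (u s).2 x i * star (q.1 x i)) (-elasticForm m (u t).1 q) t

open Classical in
/-- The propagator `R_s`: the Cauchy data at time `s` of the finite energy solution with Cauchy
data `h` at time `0`. (The solution exists and is unique for all `h` in `H¹ ⊕ L²`.) -/
def propagator (m : Medium) (s : ℝ) (h : Data) : Data :=
  if H : ∃ u : ℝ → Data, IsWave m u ∧ u 0 = h then H.choose s else 0

/-- Time reversal `ν`. -/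
def timeReversal (h : Data) : Data := (h.1, -h.2)

/-! ### Scattering control -/

/-- The operator `R = ν ∘ R_{2T}`. -/
def reversedPropagator (m : Medium) (T : ℝ) (h : Data) : Data :=
  timeReversal (propagator m (2 * T) h)

/-- The projection `π^⋆` onto the Cauchy data supported in `Υ` outside `Θ`. -/
def piStar (m : Medium) (Θ Υ : Set E3) (h : Data) : Data := proj m (outer m Θ Υ 0) h

/-- The complementary projection `π̄ = Id - π^⋆`. -/
def piBar (m : Medium) (Θ Υ : Set E3) (h : Data) : Data := h - piStar m Θ Υ h

/-- The almost direct transmission `h_DT = π̄_T R_T h₀` of `h₀` at time `T`; here `Id - π̄_T` is the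
projection onto the Cauchy data supported in `Θ_T^⋆`. -/
def almostDirect (m : Medium) (Θ Υ : Set E3) (T : ℝ) (h₀ : Data) : Data :=
  propagator m T h₀ - proj m (outer m Θ Υ T) (propagator m T h₀)

end ElasticSC

end

/-! Write k = R_{2T}h∞, y = π⋆k, z = k − y, and d = R_{-T}z; the hypothesis says d = h_DT. Time
reversal ν is an energy isometry that preserves H⋆ and turns R_s into R_{-s}, so π⋆Rh∞ = νy and Rνy
= R_{-2T}y = h∞ − R_{-T}d. The claim thus says that the projection of h∞ − R_{-T}d is K_tail, that
is, that h₀ − R_{-T}d is orthogonal to H⋆. The part h₀ is orthogonal because its support is disjoint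
from Θ⋆. By unitarity of the propagator it remains to show ⟨d, R_T g⟩ = 0 for all g in H⋆.

Since z is orthogonal to H⋆, unitarity gives ⟨d, R_{-T}g⟩ = 0 for all such g. Replacing g by νg
yields ⟨d, νR_T g⟩ = 0, which differs from the wanted identity only in the sign of the velocity term
(`energyInner_propagator_eq_zero_of_neg`). That term vanishes by finite speed of propagation: the
velocity of R_T g lives where the depth is less than T, while the velocity of h_DT vanishes on Θ_T⋆
by projection and outside Υ because h₀ cannot travel that far (`inner_snd_almostDirect`).

The analytic input is as follows. Strong convexity and Korn's inequality make the elastic form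
control the gradient. With Poincaré's inequality this makes projections onto bounded sets exist and
be unique. Regular solutions come from the spectral calculus of the resolvent-like operator ι*ι,
where ι embeds H¹ in L²; general solutions are limits of these. Energy conservation and uniqueness
are proved on Steklov time averages, whose velocity lies in H¹ and may be used as a test field.

Finite speed uses energies with weight exp(2ke), where e is a truncated P-distance. Since c_P|∇e| ≤
1 in a mollified, almost everywhere sense (here the continuity of the parameters off a null set
enters), the weighted energy grows at most like exp(2kt). Letting k → ∞ confines the velocity to e <
t. Only velocities are localised, as nothing more is needed. -/

noncomputable section

/-! ### Algebra and continuity of the elastic forms. -/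

namespace ElasticSC

/-! ### Weighted forms -/

/-- Bounded measurable weights. -/
def BddMeas (a : E3 → ℝ) : Prop := Measurable a ∧ ∃ M : ℝ, ∀ x, |a x| ≤ M

theorem BddMeas.mul {a b : E3 → ℝ} (ha : BddMeas a) (hb : BddMeas b) :
    BddMeas (fun x => a x * b x) := by
  obtain ⟨ha, M, hM⟩ := ha
  obtain ⟨hb, N, hN⟩ := hb
  refine ⟨ha.mul hb, M * N, fun x => ?_⟩
  rw [abs_mul]
  exact mul_le_mul (hM x) (hN x) (abs_nonneg _) ((abs_nonneg _).trans (hM x))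

theorem bddMeas_const (c : ℝ) : BddMeas (fun _ => c) := ⟨measurable_const, |c|, fun _ => le_rfl⟩

theorem Medium.bddMeas_lam (m : Medium) : BddMeas m.lam :=
  ⟨m.lam_meas, m.bounded.imp fun _ h x => (h x).1⟩

theorem Medium.bddMeas_mu (m : Medium) : BddMeas m.mu :=
  ⟨m.mu_meas, m.bounded.imp fun _ h x => (h x).2⟩

theorem integrable_norm_mul_norm (f g : VecL2) : Integrable (fun x => ‖f x‖ * ‖g x‖) :=
  (Lp.memLp f).norm.integrable_mul (Lp.memLp g).norm

theorem integral_norm_mul_norm_le (f g : VecL2) : ∫ x, ‖f x‖ * ‖g x‖ ≤ ‖f‖ * ‖g‖ := by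
  have h := integral_mul_le_Lp_mul_Lq_of_nonneg (μ := (volume : Measure E3))
    (p := 2) (q := 2) (by constructor <;> norm_num) (f := fun x => ‖f x‖) (g := fun x => ‖g x‖)
    (Eventually.of_forall fun _ => norm_nonneg _) (Eventually.of_forall fun _ => norm_nonneg _)
    (by simpa using (Lp.memLp f).norm) (by simpa using (Lp.memLp g).norm)
  have key : ∀ u : VecL2, (∫ x, ‖u x‖ ^ (2 : ℝ)) ^ (1 / (2 : ℝ)) = ‖u‖ := by
    intro u
    rw [Lp.norm_def, (Lp.memLp u).eLpNorm_eq_integral_rpow_norm (by norm_num) (by norm_num),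
      ENNReal.toReal_ofReal (by positivity)]
    simp
  rwa [key, key] at h

theorem aesm_coord (f : VecL2) (i : Fin 3) : AEStronglyMeasurable (fun x => f x i) volume :=
  (EuclideanSpace.proj (𝕜 := ℂ) i).continuous.comp_aestronglyMeasurable (Lp.aestronglyMeasurable f)

theorem integrable_coord {a : E3 → ℝ} (ha : BddMeas a) (f g : VecL2) (i j : Fin 3) :
    Integrable (fun x => (a x : ℂ) * (f x i * star (g x j))) := by
  obtain ⟨ham, M, hM⟩ := ha
  refine ((integrable_norm_mul_norm f g).const_mul M).mono' ?_ ?_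
  · exact (Complex.measurable_ofReal.comp ham).aestronglyMeasurable.mul
      ((aesm_coord f i).mul (aesm_coord g j).star)
  · refine Eventually.of_forall fun x => ?_
    rw [norm_mul, norm_mul, norm_star, Complex.norm_real, Real.norm_eq_abs]
    gcongr
    · exact (abs_nonneg _).trans (hM x)
    · exact hM x
    · exact PiLp.norm_apply_le _ _
    · exact PiLp.norm_apply_le _ _

/-- All forms in the proof are finite combinations of these. They are taken over ℝ because they are
conjugate linear in the second argument; real bilinearity and continuity suffice for time
derivatives and limits. -/
theorem exists_coordForm {a : E3 → ℝ} (ha : BddMeas a) (i j : Fin 3) :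
    ∃ B : VecL2 →L[ℝ] VecL2 →L[ℝ] ℂ, ∀ f g,
      B f g = ∫ x, (a x : ℂ) * (f x i * star (g x j)) := by
  obtain ⟨M, hM⟩ := ha.2
  refine ⟨LinearMap.mkContinuous₂ (LinearMap.mk₂ ℝ
    (fun f g : VecL2 => ∫ x, (a x : ℂ) * (f x i * star (g x j))) ?_ ?_ ?_ ?_) M ?_,
    fun f g => rfl⟩
  · intro f f' g
    rw [← integral_add (integrable_coord ha _ _ _ _) (integrable_coord ha _ _ _ _)]
    refine integral_congr_ae ?_
    filter_upwards [Lp.coeFn_add f f'] with x hx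
    rw [hx, Pi.add_apply, PiLp.add_apply]; ring
  · intro c f g
    rw [← integral_smul]
    refine integral_congr_ae ?_
    filter_upwards [Lp.coeFn_smul c f] with x hx
    rw [hx, Pi.smul_apply, PiLp.smul_apply]; simp only [Complex.real_smul]; ring
  · intro f g g'
    rw [← integral_add (integrable_coord ha _ _ _ _) (integrable_coord ha _ _ _ _)]
    refine integral_congr_ae ?_
    filter_upwards [Lp.coeFn_add g g'] with x hx
    rw [hx, Pi.add_apply, PiLp.add_apply, star_add]; ring
  · intro c f g
    rw [← integral_smul]
    refine integral_congr_ae ?_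
    filter_upwards [Lp.coeFn_smul c g] with x hx
    rw [hx, Pi.smul_apply, PiLp.smul_apply]
    simp only [Complex.real_smul, star_mul', Complex.star_def, Complex.conj_ofReal]; ring
  · intro f g
    rw [LinearMap.mk₂_apply]
    calc ‖∫ x, (a x : ℂ) * (f x i * star (g x j))‖
        ≤ ∫ x, M * (‖f x‖ * ‖g x‖) := by
          refine norm_integral_le_of_norm_le ((integrable_norm_mul_norm f g).const_mul M)
            (Eventually.of_forall fun x => ?_)
          rw [norm_mul, norm_mul, norm_star, Complex.norm_real, Real.norm_eq_abs]
          gcongr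
          · exact (abs_nonneg _).trans (hM x)
          · exact hM x
          · exact PiLp.norm_apply_le _ _
          · exact PiLp.norm_apply_le _ _
      _ = M * ∫ x, ‖f x‖ * ‖g x‖ := integral_const_mul _ _
      _ ≤ M * (‖f‖ * ‖g‖) :=
          mul_le_mul_of_nonneg_left (integral_norm_mul_norm_le f g)
            ((abs_nonneg _).trans (hM 0))
      _ = M * ‖f‖ * ‖g‖ := by ring

/-- The pointwise form of isotropic elasticity on displacement gradients. -/
def dens (l μ : ℝ) (A B : Fin 3 → Fin 3 → ℂ) : ℂ :=
  (l : ℂ) * ((∑ j, A j j) * star (∑ j, B j j)) +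
    2 * (μ : ℂ) * ∑ i, ∑ j, ((A i j + A j i) / 2) * star ((B i j + B j i) / 2)

/-- The elastic form with coefficients `l`, `μ` on displacement gradients. -/
def wForm (l μ : E3 → ℝ) (G H : Fin 3 → VecL2) : ℂ :=
  ∫ x, dens (l x) (μ x) (fun i j => G i x j) (fun i j => H i x j)

/-- The `L²` form with weight `w`. -/
def kForm (w : E3 → ℝ) (f g : VecL2) : ℂ := ∫ x, (w x : ℂ) * ∑ i, f x i * star (g x i)

theorem elasticForm_eq (m : Medium) (p q : Jet) :
    elasticForm m p q = wForm m.lam m.mu p.2 q.2 := rfl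

theorem dens_expand (l μ : ℝ) (A B : Fin 3 → Fin 3 → ℂ) :
    dens l μ A B = ∑ i, ∑ j, ((l : ℂ) * (A i i * star (B j j)) +
      ((1 / 2 : ℂ) * ((μ : ℂ) * (A i j * star (B i j))) +
       (1 / 2 : ℂ) * ((μ : ℂ) * (A i j * star (B j i))) +
       (1 / 2 : ℂ) * ((μ : ℂ) * (A j i * star (B i j))) +
       (1 / 2 : ℂ) * ((μ : ℂ) * (A j i * star (B j i))))) := by
  have h2 : (starRingEnd ℂ) 2 = 2 := Complex.conj_ofReal 2
  simp only [dens, Fin.sum_univ_three, star_add, star_div₀, Complex.star_def, h2]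
  ring

theorem integrable_dens {l μ : E3 → ℝ} (hl : BddMeas l) (hμ : BddMeas μ) (G H : Fin 3 → VecL2) :
    Integrable (fun x => dens (l x) (μ x) (fun i j => G i x j) (fun i j => H i x j)) := by
  simp only [dens_expand]
  refine integrable_finsetSum _ fun i _ => integrable_finsetSum _ fun j _ => ?_
  exact (integrable_coord hl _ _ _ _).add
    (((((integrable_coord hμ _ _ _ _).const_mul _).add
      ((integrable_coord hμ _ _ _ _).const_mul _)).add
      ((integrable_coord hμ _ _ _ _).const_mul _)).add ((integrable_coord hμ _ _ _ _).const_mul _))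

theorem exists_kForm {w : E3 → ℝ} (hw : BddMeas w) :
    ∃ B : VecL2 →L[ℝ] VecL2 →L[ℝ] ℂ, ∀ f g, B f g = kForm w f g := by
  choose B hB using fun i : Fin 3 => exists_coordForm hw i i
  refine ⟨∑ i, B i, fun f g => ?_⟩
  simp only [sum_apply, hB, kForm, Finset.mul_sum]
  rw [integral_finsetSum _ fun i _ => integrable_coord hw _ _ _ _]

theorem exists_wForm {l μ : E3 → ℝ} (hl : BddMeas l) (hμ : BddMeas μ) :
    ∃ B : (Fin 3 → VecL2) →L[ℝ] (Fin 3 → VecL2) →L[ℝ] ℂ, ∀ G H, B G H = wForm l μ G H := by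
  choose L hL using fun i j : Fin 3 => exists_coordForm hl i j
  choose N hN using fun i j : Fin 3 => exists_coordForm hμ i j
  let P : Fin 3 → ((Fin 3 → VecL2) →L[ℝ] VecL2) := fun i => ContinuousLinearMap.proj i
  refine ⟨∑ i, ∑ j, ((L i j).bilinearComp (P i) (P j) +
    ((1 / 2 : ℂ) • ((N j j).bilinearComp (P i) (P i)) +
     (1 / 2 : ℂ) • ((N j i).bilinearComp (P i) (P j)) +
     (1 / 2 : ℂ) • ((N i j).bilinearComp (P j) (P i)) +
     (1 / 2 : ℂ) • ((N i i).bilinearComp (P j) (P j)))), fun G H => ?_⟩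
  simp only [sum_apply, add_apply,
    smul_apply, ContinuousLinearMap.bilinearComp_apply, hL, hN, wForm,
    dens_expand, P, ContinuousLinearMap.proj_apply, smul_eq_mul]
  have I1 := fun i j i' j' => integrable_coord hl (G i) (H i') j j'
  have I2 := fun i j i' j' => (integrable_coord hμ (G i) (H i') j j').const_mul (1 / 2 : ℂ)
  symm
  -- Integrability of one summand of `dens_expand`, with the indices of its five products left to
  -- unification.
  have J := fun i j i' j' i1 j1 i1' j1' i2 j2 i2' j2' i3 j3 i3' j3' i4 j4 i4' j4' =>
    (I1 i j i' j').add ((((I2 i1 j1 i1' j1').add (I2 i2 j2 i2' j2')).add (I2 i3 j3 i3' j3')).add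
      (I2 i4 j4 i4' j4'))
  refine (integral_finsetSum _ fun i _ => integrable_finsetSum _ fun j _ =>
    J _ _ _ _ _ _ _ _ _ _ _ _ _ _ _ _ _ _ _ _).trans (Finset.sum_congr rfl fun i _ =>
    (integral_finsetSum _ fun j _ =>
      J _ _ _ _ _ _ _ _ _ _ _ _ _ _ _ _ _ _ _ _).trans (Finset.sum_congr rfl fun j _ => ?_))
  rw [integral_add' (I1 _ _ _ _)
      ((((I2 _ _ _ _).add (I2 _ _ _ _)).add (I2 _ _ _ _)).add (I2 _ _ _ _)),
    integral_add' (((I2 _ _ _ _).add (I2 _ _ _ _)).add (I2 _ _ _ _)) (I2 _ _ _ _),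
    integral_add' ((I2 _ _ _ _).add (I2 _ _ _ _)) (I2 _ _ _ _),
    integral_add' (I2 _ _ _ _) (I2 _ _ _ _)]
  simp only [integral_const_mul]

theorem energyInner_eq (m : Medium) (f g : Data) :
    energyInner m f g = kForm (fun _ => 1) f.2 g.2 + wForm m.lam m.mu f.1.2 g.1.2 := by
  simp [energyInner, elasticForm_eq, kForm]

theorem dens_smul_left (l μ : ℝ) (c : ℂ) (A B : Fin 3 → Fin 3 → ℂ) :
    dens l μ (fun i j => c * A i j) B = c * dens l μ A B := by
  simp only [dens, Fin.sum_univ_three]; ring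

theorem star_dens (l μ : ℝ) (A B : Fin 3 → Fin 3 → ℂ) : star (dens l μ A B) = dens l μ B A := by
  have h2 : (starRingEnd ℂ) 2 = 2 := Complex.conj_ofReal 2
  simp only [dens, Fin.sum_univ_three, star_add, star_mul', star_div₀, Complex.star_def, h2,
    Complex.conj_ofReal, Complex.conj_conj]
  ring

theorem wForm_smul_left (l μ : E3 → ℝ) (c : ℂ) (G H : Fin 3 → VecL2) :
    wForm l μ (c • G) H = c * wForm l μ G H := by
  rw [wForm, wForm, ← integral_const_mul]
  refine integral_congr_ae ?_
  have : ∀ᵐ x : E3, ∀ i, (c • G) i x = c • G i x :=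
    ae_all_iff.2 fun i => Lp.coeFn_smul c (G i)
  filter_upwards [this] with x hx
  rw [← dens_smul_left]
  simp only [hx, PiLp.smul_apply, smul_eq_mul]

theorem star_wForm (l μ : E3 → ℝ) (G H : Fin 3 → VecL2) : star (wForm l μ G H) = wForm l μ H G := by
  rw [wForm, wForm, Complex.star_def, ← integral_conj]
  simp only [← Complex.star_def, star_dens]

theorem star_kForm (w : E3 → ℝ) (f g : VecL2) : star (kForm w f g) = kForm w g f := by
  rw [kForm, kForm, Complex.star_def, ← integral_conj]
  simp only [← Complex.star_def, star_mul', star_sum, star_star, mul_comm (star _)]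
  simp only [Complex.star_def, Complex.conj_ofReal, mul_comm]

theorem kForm_one (f g : VecL2) : kForm (fun _ => 1) f g = inner ℂ g f := by
  rw [L2.inner_def, kForm]
  simp [PiLp.inner_apply]

/-! ### Pointwise inequalities -/

theorem dens_self (l μ : ℝ) (A : Fin 3 → Fin 3 → ℂ) :
    dens l μ A A = ((l * ‖∑ j, A j j‖ ^ 2 + 2 * μ * ∑ i, ∑ j, ‖(A i j + A j i) / 2‖ ^ 2 : ℝ) : ℂ) := by
  have h : ∀ z : ℂ, z * star z = ((‖z‖ ^ 2 : ℝ) : ℂ) := fun z => by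
    rw [Complex.star_def, Complex.mul_conj, Complex.normSq_eq_norm_sq]
  simp only [dens, h]
  push_cast
  rfl

/-- Cauchy–Schwarz for the three diagonal entries, which A shares with its symmetric part. -/
theorem norm_sq_trace_le (A : Fin 3 → Fin 3 → ℂ) :
    ‖∑ j, A j j‖ ^ 2 ≤ 3 * ∑ i, ∑ j, ‖(A i j + A j i) / 2‖ ^ 2 := by
  have h1 : ‖∑ j, A j j‖ ≤ ‖A 0 0‖ + ‖A 1 1‖ + ‖A 2 2‖ := by
    rw [Fin.sum_univ_three]; exact norm_add₃_le
  have h2 : ∀ i, (A i i + A i i) / 2 = A i i := fun i => by ring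
  simp only [Fin.sum_univ_three, h2] at h1 ⊢
  have := sq_nonneg (‖A 0 0‖ - ‖A 1 1‖)
  have := sq_nonneg (‖A 0 0‖ - ‖A 2 2‖)
  have := sq_nonneg (‖A 1 1‖ - ‖A 2 2‖)
  nlinarith [norm_nonneg (A 0 0 + A 1 1 + A 2 2), sq_nonneg ‖(A 0 1 + A 1 0) / 2‖,
    sq_nonneg ‖(A 0 2 + A 2 0) / 2‖, sq_nonneg ‖(A 1 0 + A 0 1) / 2‖,
    sq_nonneg ‖(A 1 2 + A 2 1) / 2‖, sq_nonneg ‖(A 2 0 + A 0 2) / 2‖,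
    sq_nonneg ‖(A 2 1 + A 1 2) / 2‖]

/-- Uniform strong convexity of the elastic energy density. -/
theorem le_dens_self {l μ c : ℝ} (h1 : c ≤ μ) (h2 : c ≤ 3 * l + 2 * μ) (hc : 0 ≤ c)
    (A : Fin 3 → Fin 3 → ℂ) :
    c * ∑ i, ∑ j, ‖(A i j + A j i) / 2‖ ^ 2 ≤ (dens l μ A A).re := by
  rw [dens_self, Complex.ofReal_re]
  have h := norm_sq_trace_le A
  have h0 : 0 ≤ ‖∑ j, A j j‖ ^ 2 := by positivity
  set S := ∑ i, ∑ j, ‖(A i j + A j i) / 2‖ ^ 2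
  set t := ‖∑ j, A j j‖ ^ 2
  -- Three times the difference of the two sides is (2μ − c)(3S − t) + (3λ + 2μ − c)t; here 3S − t
  -- is three times the squared norm of the trace-free strain.
  nlinarith [mul_nonneg (by linarith : 0 ≤ 2 * μ - c) (by linarith : 0 ≤ 3 * S - t),
    mul_nonneg (by linarith : 0 ≤ 3 * l + 2 * μ - c) h0]

theorem dens_self_nonneg {l μ c : ℝ} (h1 : c ≤ μ) (h2 : c ≤ 3 * l + 2 * μ) (hc : 0 ≤ c)
    (A : Fin 3 → Fin 3 → ℂ) : 0 ≤ (dens l μ A A).re :=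
  (by positivity : (0 : ℝ) ≤ c * ∑ i, ∑ j, ‖(A i j + A j i) / 2‖ ^ 2).trans
    (le_dens_self h1 h2 hc A)

/-- On n ⊗ a the density is (λ + μ)|n·a|² + μ|n|²|a|², and |n·a| ≤ |n||a|. This is where the P-wave
modulus λ + 2μ appears. The sign λ + μ ≥ 0 follows from both convexity bounds. -/
theorem dens_rankOne_le {l μ c : ℝ} (h1 : c ≤ μ) (h2 : c ≤ 3 * l + 2 * μ) (hc : 0 ≤ c)
    (n : E3) (a : C3) :
    (dens l μ (fun i j => (n i : ℂ) * a j) (fun i j => (n i : ℂ) * a j)).re ≤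
      (l + 2 * μ) * (‖n‖ ^ 2 * ‖a‖ ^ 2) := by
  have hn : ‖n‖ ^ 2 = n 0 ^ 2 + n 1 ^ 2 + n 2 ^ 2 := by
    rw [EuclideanSpace.norm_sq_eq, Fin.sum_univ_three]; simp
  have ha : ‖a‖ ^ 2 = ((a 0).re ^ 2 + (a 0).im ^ 2) + ((a 1).re ^ 2 + (a 1).im ^ 2) +
      ((a 2).re ^ 2 + (a 2).im ^ 2) := by
    rw [EuclideanSpace.norm_sq_eq, Fin.sum_univ_three]
    simp only [Complex.sq_norm, Complex.normSq_apply]; ring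
  have key : (dens l μ (fun i j => (n i : ℂ) * a j) (fun i j => (n i : ℂ) * a j)).re =
      (l + μ) * ((n 0 * (a 0).re + n 1 * (a 1).re + n 2 * (a 2).re) ^ 2 +
        (n 0 * (a 0).im + n 1 * (a 1).im + n 2 * (a 2).im) ^ 2) + μ * (‖n‖ ^ 2 * ‖a‖ ^ 2) := by
    rw [dens_self, Complex.ofReal_re, hn, ha]
    simp only [Fin.sum_univ_three, Complex.sq_norm, Complex.normSq_apply]
    simp
    ring
  have cs : ∀ b : Fin 3 → ℝ, (n 0 * b 0 + n 1 * b 1 + n 2 * b 2) ^ 2 ≤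
      (n 0 ^ 2 + n 1 ^ 2 + n 2 ^ 2) * (b 0 ^ 2 + b 1 ^ 2 + b 2 ^ 2) := fun b => by
    nlinarith [sq_nonneg (n 0 * b 1 - n 1 * b 0), sq_nonneg (n 0 * b 2 - n 2 * b 0),
      sq_nonneg (n 1 * b 2 - n 2 * b 1)]
  have c1 := cs fun i => (a i).re
  have c2 := cs fun i => (a i).im
  rw [key]
  have hl : 0 ≤ l + μ := by linarith
  have : (n 0 * (a 0).re + n 1 * (a 1).re + n 2 * (a 2).re) ^ 2 +
        (n 0 * (a 0).im + n 1 * (a 1).im + n 2 * (a 2).im) ^ 2 ≤ ‖n‖ ^ 2 * ‖a‖ ^ 2 := by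
    rw [hn, ha]; simp only at c1 c2; linarith
  nlinarith [mul_le_mul_of_nonneg_left this hl]

theorem dens_combination (l μ : ℝ) (s : ℝ) (A B : Fin 3 → Fin 3 → ℂ) :
    (dens l μ (fun i j => (s : ℂ) * A i j + B i j) (fun i j => (s : ℂ) * A i j + B i j)).re =
      s ^ 2 * (dens l μ A A).re + 2 * s * (dens l μ A B).re + (dens l μ B B).re := by
  have e : (dens l μ B A).re = (dens l μ A B).re := by
    rw [← star_dens, Complex.star_def, Complex.conj_re]
  have : dens l μ (fun i j => (s : ℂ) * A i j + B i j) (fun i j => (s : ℂ) * A i j + B i j) =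
      ((s ^ 2 : ℝ) : ℂ) * dens l μ A A + (s : ℂ) * (dens l μ A B + dens l μ B A) + dens l μ B B := by
    have h2 : (starRingEnd ℂ) 2 = 2 := Complex.conj_ofReal 2
    simp only [dens, Fin.sum_univ_three, star_add, star_mul', star_div₀, Complex.star_def, h2,
      Complex.conj_ofReal]
    push_cast
    ring
  rw [this, Complex.add_re, Complex.add_re, Complex.re_ofReal_mul, Complex.re_ofReal_mul,
    Complex.add_re, e]
  ring

/-- The energy flux in the direction `n` is controlled by the energy density at the speed of
`P`-waves. -/
theorem abs_re_dens_rankOne_le {l μ c : ℝ} (h1 : c ≤ μ) (h2 : c ≤ 3 * l + 2 * μ) (hc : 0 < c)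
    (A : Fin 3 → Fin 3 → ℂ) (n : E3) (a : C3) :
    2 * |(dens l μ A (fun i j => (n i : ℂ) * a j)).re| ≤
      Real.sqrt (l + 2 * μ) * ‖n‖ * ((dens l μ A A).re + ‖a‖ ^ 2) := by
  set B : Fin 3 → Fin 3 → ℂ := fun i j => (n i : ℂ) * a j
  set τ := Real.sqrt (l + 2 * μ) * ‖n‖
  have hsq : Real.sqrt (l + 2 * μ) ^ 2 = l + 2 * μ := Real.sq_sqrt (by linarith)
  have hB : (dens l μ B B).re ≤ τ ^ 2 * ‖a‖ ^ 2 := by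
    refine (dens_rankOne_le h1 h2 hc.le n a).trans (le_of_eq ?_)
    simp only [τ, mul_pow, hsq]; ring
  have pos : ∀ s : ℝ, 0 ≤ s ^ 2 * (dens l μ A A).re + 2 * s * (dens l μ A B).re +
      (dens l μ B B).re := fun s => by
    rw [← dens_combination]; exact dens_self_nonneg h1 h2 hc.le _
  rcases (by positivity : 0 ≤ τ).eq_or_lt with h0 | hτ
  · have hn : n = 0 := by
      have : Real.sqrt (l + 2 * μ) ≠ 0 := (Real.sqrt_pos.2 (by linarith)).ne'
      simpa [τ, this] using h0.symm
    have : dens l μ A B = 0 := by simp [dens, B, hn]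
    rw [this, ← h0]; simp
  -- Nonnegativity of the quadratic polynomial at s = ±τ, with the bound on B, gives a multiple of τ
  -- on both sides; divide by τ.
  · have p1 := pos τ
    have p2 := pos (-τ)
    have q : 2 * τ * |(dens l μ A B).re| ≤ τ * (τ * ((dens l μ A A).re + ‖a‖ ^ 2)) := by
      rcases abs_cases (dens l μ A B).re with h | h <;> rw [h.1] <;> nlinarith
    exact le_of_mul_le_mul_left (by linarith) hτ

theorem Medium.speed_pos (m : Medium) : ∃ κ : ℝ, 0 < κ ∧ ∀ x, κ ≤ m.cP x := by
  obtain ⟨c, hc, h⟩ := m.convex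
  refine ⟨Real.sqrt c, Real.sqrt_pos.2 hc, fun x => Real.sqrt_le_sqrt ?_⟩
  linarith [(h x).1, (h x).2]

end ElasticSC

end

/-! ### The spaces H¹₀ and H¹ and their inequalities. -/

noncomputable section

namespace ElasticSC

/-! ### Test fields -/

/-- The coordinate vector fields. -/
abbrev dir (j : Fin 3) : E3 := EuclideanSpace.single j 1

/-- The jets of the test fields supported in `U`. -/
def testJets (U : Set E3) : Set Jet :=
  {p : Jet | ∃ φ : E3 → C3, ContDiff ℝ ∞ φ ∧ HasCompactSupport φ ∧
    tsupport φ ⊆ U ∧ (p.1 =ᵐ[volume] φ) ∧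
    ∀ j, p.2 j =ᵐ[volume] fun x => fderiv ℝ φ x (dir j)}

theorem contDiff_partial {φ : E3 → C3} (hφ : ContDiff ℝ ∞ φ) (v : E3) :
    ContDiff ℝ ∞ (fun x => fderiv ℝ φ x v) :=
  (hφ.fderiv_right (m := ∞) (by norm_cast)).clm_apply contDiff_const

theorem exists_jet {φ : E3 → C3} (hφ : ContDiff ℝ ∞ φ) (hc : HasCompactSupport φ) :
    ∃ p : Jet, p.1 =ᵐ[volume] φ ∧ ∀ j, p.2 j =ᵐ[volume] fun x => fderiv ℝ φ x (dir j) :=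
  have h1 : MemLp φ 2 volume := hφ.continuous.memLp_of_hasCompactSupport hc
  have h2 : ∀ j, MemLp (fun x => fderiv ℝ φ x (dir j)) 2 volume := fun j =>
    (contDiff_partial hφ (dir j)).continuous.memLp_of_hasCompactSupport (hc.fderiv_apply ℝ (dir j))
  ⟨(h1.toLp, fun j => (h2 j).toLp), h1.coeFn_toLp, fun j => (h2 j).coeFn_toLp⟩

/-- The test jets form a subspace. -/
def testSubmodule (U : Set E3) : Submodule ℂ Jet where
  carrier := testJets U
  zero_mem' := ⟨0, contDiff_const, HasCompactSupport.zero, by simp [tsupport],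
    Lp.coeFn_zero _ _ _, fun j => by
      filter_upwards [Lp.coeFn_zero C3 2 (volume : Measure E3)] with x hx
      simp⟩
  add_mem' := by
    rintro p q ⟨φ, h1, h2, h3, h4, h5⟩ ⟨ψ, g1, g2, g3, g4, g5⟩
    refine ⟨φ + ψ, h1.add g1, h2.add g2, (tsupport_add _ _).trans (union_subset h3 g3),
      (Lp.coeFn_add _ _).trans (h4.add g4), fun j => (Lp.coeFn_add _ _).trans ?_⟩
    filter_upwards [h5 j, g5 j] with x hx gx
    rw [Pi.add_apply, hx, gx, fderiv_add (h1.differentiable (by simp) x)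
      (g1.differentiable (by simp) x), add_apply]
  smul_mem' := by
    rintro c p ⟨φ, h1, h2, h3, h4, h5⟩
    refine ⟨c • φ, contDiff_const.smul h1, h2.smul_left (f := fun _ => c),
      (tsupport_smul_subset_right (fun _ => c) φ).trans h3,
      (Lp.coeFn_smul _ _).trans (h4.const_smul c), fun j => (Lp.coeFn_smul _ _).trans ?_⟩
    filter_upwards [h5 j] with x hx
    rw [Pi.smul_apply, hx, fderiv_const_smul (h1.differentiable (by simp) x)]
    rfl

theorem H10_eq (U : Set E3) : H10 U = (testSubmodule U).topologicalClosure := by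
  have : Submodule.span ℂ (testJets U) = testSubmodule U := Submodule.span_eq (testSubmodule U)
  exact congrArg Submodule.topologicalClosure this

/-- The test jets are already a subspace, so the span in `H10` adds nothing: a closed property that
holds for test jets holds on the closure, with no linearity required. -/
theorem H10_induction {U : Set E3} {P : Jet → Prop} (hcl : IsClosed {p | P p})
    (h : ∀ p ∈ testJets U, P p) {p : Jet} (hp : p ∈ H10 U) : P p := by
  rw [H10_eq] at hp
  exact closure_minimal h hcl hp

theorem testJets_subset_H10 (U : Set E3) : testJets U ⊆ H10 U := by
  rw [H10_eq]
  exact (testSubmodule U).le_topologicalClosure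

theorem isClosed_H10 (U : Set E3) : IsClosed (H10 U : Set Jet) :=
  Submodule.isClosed_topologicalClosure _

theorem H10_mono {U U' : Set E3} (h : U ⊆ U') : H10 U ≤ H10 U' := fun _ hp =>
  H10_induction (P := fun p => p ∈ H10 U') (isClosed_H10 U')
    (fun _ ⟨φ, h1, h2, h3, h4⟩ => testJets_subset_H10 U' ⟨φ, h1, h2, h3.trans h, h4⟩) hp

/-- An L²-convergent sequence has an almost everywhere convergent subsequence, so no measurability
of U is needed. -/
theorem isClosed_L2On (U : Set E3) : IsClosed (L2On U : Set VecL2) := by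
  refine IsSeqClosed.isClosed fun f g hf hg => ?_
  obtain ⟨ns, -, hns⟩ := (tendstoInMeasure_of_tendsto_Lp hg).exists_seq_tendsto_ae
  have h : ∀ᵐ x, ∀ n, x ∉ U → f n x = 0 := ae_all_iff.2 hf
  filter_upwards [h, hns] with x hx h2 hxU
  refine tendsto_nhds_unique h2 ?_
  simp only [hx _ hxU]
  exact tendsto_const_nhds

theorem L2On_mono {U U' : Set E3} (h : U ⊆ U') : L2On U ≤ L2On U' := fun f hf => by
  have hf' : ∀ᵐ x, x ∉ U → f x = 0 := hf
  filter_upwards [hf'] with x hx hxU using hx fun h' => hxU (h h')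

theorem H10_le_L2On {U : Set E3} {p : Jet} (hp : p ∈ H10 U) :
    p.1 ∈ L2On U ∧ ∀ j, p.2 j ∈ L2On U := by
  refine H10_induction (P := fun p => p.1 ∈ L2On U ∧ ∀ j, p.2 j ∈ L2On U) ?_ ?_ hp
  · have e : {p : Jet | p.1 ∈ L2On U ∧ ∀ j, p.2 j ∈ L2On U} =
        Prod.fst ⁻¹' (L2On U : Set VecL2) ∩ ⋂ j, (fun p : Jet => p.2 j) ⁻¹' (L2On U : Set VecL2) := by
      ext; simp
    rw [e]
    exact ((isClosed_L2On U).preimage continuous_fst).inter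
      (isClosed_iInter fun j => (isClosed_L2On U).preimage (by fun_prop))
  · rintro p ⟨φ, h1, h2, h3, h4, h5⟩
    refine ⟨?_, fun j => ?_⟩
    · filter_upwards [h4] with x hx hxU
      rw [hx]
      exact image_eq_zero_of_notMem_tsupport fun h => hxU (h3 h)
    · filter_upwards [h5 j] with x hx hxU
      have : fderiv ℝ φ x = 0 :=
        image_eq_zero_of_notMem_tsupport fun h => hxU (h3 (tsupport_fderiv_subset ℝ h))
      rw [hx, this]; rfl

/-! ### Integration by parts -/

/-- The sesquilinear product of two components of vectors. -/
def coordB (a b : Fin 3) : C3 →L[ℝ] C3 →L[ℝ] ℂ :=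
  (ContinuousLinearMap.mul ℝ ℂ).bilinearComp
    ((EuclideanSpace.proj (𝕜 := ℂ) a).restrictScalars ℝ)
    ((Complex.conjCLE : ℂ →L[ℝ] ℂ).comp ((EuclideanSpace.proj (𝕜 := ℂ) b).restrictScalars ℝ))

theorem coordB_apply (a b : Fin 3) (u v : C3) : coordB a b u v = u a * star (v b) := rfl

theorem integral_by_parts {φ ψ : E3 → C3} (hφ : ContDiff ℝ ∞ φ) (hψ : ContDiff ℝ ∞ ψ)
    (hc : HasCompactSupport φ) (a b : Fin 3) (v : E3) :
    ∫ x, φ x a * star (fderiv ℝ ψ x v b) = -∫ x, fderiv ℝ φ x v a * star (ψ x b) := by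
  have key := integral_bilinear_fderiv_right_eq_neg_left_of_integrable
    (μ := (volume : Measure E3)) (f := φ) (g := ψ) (v := v) (B := coordB a b) ?_ ?_ ?_
    (fun x _ => hφ.differentiable (by simp) x) (fun x _ => hψ.differentiable (by simp) x)
  · simpa only [coordB_apply] using key
  all_goals refine Continuous.integrable_of_hasCompactSupport ?_ ?_
  · exact ((coordB a b).continuous.comp (contDiff_partial hφ v).continuous).clm_apply hψ.continuous
  · exact (hc.fderiv_apply ℝ v).mono' fun x hx => subset_closure fun h => hx (by simp [h])
  · exact ((coordB a b).continuous.comp hφ.continuous).clm_apply (contDiff_partial hψ v).continuous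
  · exact hc.mono' fun x hx => subset_closure fun h => hx (by simp [h])
  · exact ((coordB a b).continuous.comp hφ.continuous).clm_apply hψ.continuous
  · exact hc.mono' fun x hx => subset_closure fun h => hx (by simp [h])

theorem partial_comm {φ : E3 → C3} (hφ : ContDiff ℝ ∞ φ) (x v w : E3) :
    fderiv ℝ (fun y => fderiv ℝ φ y v) x w = fderiv ℝ (fun y => fderiv ℝ φ y w) x v := by
  have hd : DifferentiableAt ℝ (fderiv ℝ φ) x :=
    (hφ.fderiv_right (m := 1) (by norm_cast)).differentiable (by simp) x
  have hs : IsSymmSndFDerivAt ℝ φ x := hφ.contDiffAt.isSymmSndFDerivAt (by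
    simp only [minSmoothness_of_isRCLikeNormedField]; norm_cast)
  rw [fderiv_clm_apply hd (differentiableAt_const _), fderiv_clm_apply hd (differentiableAt_const _)]
  simpa using hs w v

/-- Transposed components of the gradient of a test field have the same correlation as the
corresponding diagonal components. -/
theorem integral_partial_swap {φ : E3 → C3} (hφ : ContDiff ℝ ∞ φ) (hc : HasCompactSupport φ)
    (a b : Fin 3) (v w : E3) :
    ∫ x, fderiv ℝ φ x v a * star (fderiv ℝ φ x w b) =
      ∫ x, fderiv ℝ φ x w a * star (fderiv ℝ φ x v b) := by
  -- Both sides equal −∫ ∂_v∂_w φ_a · conj φ_b.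
  rw [integral_by_parts (contDiff_partial hφ v) hφ (hc.fderiv_apply ℝ v),
    integral_by_parts (contDiff_partial hφ w) hφ (hc.fderiv_apply ℝ w)]
  simp only [partial_comm hφ _ v w]

/-! ### Korn's and Poincaré's inequalities -/

theorem norm_sq_eq_kForm (f : VecL2) : ((‖f‖ ^ 2 : ℝ) : ℂ) = kForm (fun _ => 1) f f := by
  rw [kForm_one, inner_self_eq_norm_sq_to_K]; norm_cast

theorem norm_sq_eq_sum (f : VecL2) :
    ((‖f‖ ^ 2 : ℝ) : ℂ) = ∑ i, ∫ x, f x i * star (f x i) := by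
  rw [norm_sq_eq_kForm, kForm]
  simp only [Complex.ofReal_one, one_mul]
  refine integral_finsetSum _ fun i _ => ?_
  simpa using integrable_coord (bddMeas_const 1) f f i i

theorem integrable_coord' (f g : VecL2) (i j : Fin 3) :
    Integrable (fun x => f x i * star (g x j)) := by
  simpa using integrable_coord (bddMeas_const 1) f g i j

/-- With λ = 0 and μ = 1/2 the form is the squared norm of the symmetric gradient. Twice it is the
full gradient norm plus the transposed correlation, whose sign decides Korn's inequality. -/
theorem two_mul_wForm_half (G : Fin 3 → VecL2) :
    2 * wForm (fun _ => 0) (fun _ => 1 / 2) G G =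
      ((∑ i, ‖G i‖ ^ 2 : ℝ) : ℂ) + ∑ i, ∑ j, ∫ x, G i x j * star (G j x i) := by
  have e : ∀ x, dens 0 (1 / 2) (fun i j => G i x j) (fun i j => G i x j) =
      (1 / 2 : ℂ) * ((∑ i, ∑ j, G i x j * star (G i x j)) + ∑ i, ∑ j, G i x j * star (G j x i)) := by
    intro x
    have h2 : (starRingEnd ℂ) 2 = 2 := Complex.conj_ofReal 2
    simp only [dens, Fin.sum_univ_three, star_add, star_div₀, Complex.star_def, h2]
    push_cast
    ring
  have i1 : ∀ i : Fin 3, Integrable (fun x => ∑ j, G i x j * star (G i x j)) := fun i =>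
    integrable_finsetSum _ fun j _ => integrable_coord' _ _ _ _
  have i2 : ∀ i : Fin 3, Integrable (fun x => ∑ j, G i x j * star (G j x i)) := fun i =>
    integrable_finsetSum _ fun j _ => integrable_coord' _ _ _ _
  simp only [wForm, e]
  rw [integral_const_mul, integral_add (integrable_finsetSum _ fun i _ => i1 i)
    (integrable_finsetSum _ fun i _ => i2 i), integral_finsetSum _ fun i _ => i1 i,
    integral_finsetSum _ fun i _ => i2 i]
  push_cast
  have n := fun i => norm_sq_eq_sum (G i)
  push_cast at n
  simp only [n]
  rw [← mul_assoc]
  norm_num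
  congr 1
  · exact Finset.sum_congr rfl fun i _ => integral_finsetSum _ fun j _ => integrable_coord' _ _ _ _
  · exact Finset.sum_congr rfl fun i _ => integral_finsetSum _ fun j _ => integrable_coord' _ _ _ _

/-- Korn's inequality on the whole space. -/
theorem korn {p : Jet} (hp : p ∈ H10 univ) :
    ∑ i, ‖p.2 i‖ ^ 2 ≤ (2 * wForm (fun _ => 0) (fun _ => 1 / 2) p.2 p.2).re := by
  obtain ⟨B, hB⟩ := exists_wForm (bddMeas_const 0) (bddMeas_const (1 / 2))
  refine H10_induction (P := fun p => ∑ i, ‖p.2 i‖ ^ 2 ≤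
    (2 * wForm (fun _ => 0) (fun _ => 1 / 2) p.2 p.2).re) ?_ ?_ hp
  · simp only [← hB]
    refine isClosed_le (by fun_prop) ?_
    have : Continuous fun p : Jet => B p.2 p.2 :=
      (B.continuous.comp continuous_snd).clm_apply continuous_snd
    exact Complex.continuous_re.comp (continuous_const.mul this)
  · rintro p ⟨φ, h1, h2, h3, h4, h5⟩
    have hsw : ∀ i j, ∫ x, p.2 i x j * star (p.2 j x i) = ∫ x, p.2 j x j * star (p.2 i x i) := by
      intro i j
      have := integral_partial_swap h1 h2 j i (dir i) (dir j)
      rw [integral_congr_ae (g := fun x => fderiv ℝ φ x (dir i) j * star (fderiv ℝ φ x (dir j) i)),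
        this]
      · refine integral_congr_ae ?_
        filter_upwards [h5 i, h5 j] with x hi hj
        rw [hi, hj]
      · filter_upwards [h5 i, h5 j] with x hi hj
        rw [hi, hj]
    -- Swapping the derivatives turns the transposed correlation into ∫|div u|², which is
    -- nonnegative.
    have hdiv : ∑ i, ∑ j, ∫ x, p.2 i x j * star (p.2 j x i) =
        ((∫ x, ‖∑ j, p.2 j x j‖ ^ 2 : ℝ) : ℂ) := by
      rw [← integral_complex_ofReal]
      have : ∀ x, (((‖∑ j, p.2 j x j‖ ^ 2 : ℝ)) : ℂ) =
          ∑ i, ∑ j, p.2 j x j * star (p.2 i x i) := fun x => by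
        rw [← Complex.normSq_eq_norm_sq, ← Complex.mul_conj, map_sum, Finset.sum_mul_sum,
          Finset.sum_comm]
        rfl
      simp only [this]
      rw [Finset.sum_congr rfl fun i _ => Finset.sum_congr rfl fun j _ => hsw i j]
      rw [integral_finsetSum Finset.univ (fun i _ => integrable_finsetSum Finset.univ (fun j _ =>
        integrable_coord' (p.2 j) (p.2 i) j i))]
      exact Finset.sum_congr rfl fun i _ =>
        (integral_finsetSum Finset.univ fun j _ => integrable_coord' (p.2 j) (p.2 i) j i).symm
    rw [two_mul_wForm_half, hdiv, ← Complex.ofReal_add, Complex.ofReal_re]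
    have : 0 ≤ ∫ x, ‖∑ j, p.2 j x j‖ ^ 2 := integral_nonneg fun x => by positivity
    linarith

theorem re_dens_half (A : Fin 3 → Fin 3 → ℂ) :
    (dens 0 (1 / 2) A A).re = ∑ i, ∑ j, ‖(A i j + A j i) / 2‖ ^ 2 := by
  rw [dens_self, Complex.ofReal_re]; ring

theorem re_wForm {l μ : E3 → ℝ} (hl : BddMeas l) (hμ : BddMeas μ) (G H : Fin 3 → VecL2) :
    (wForm l μ G H).re = ∫ x, (dens (l x) (μ x) (fun i j => G i x j) (fun i j => H i x j)).re :=
  (integral_re (integrable_dens hl hμ G H)).symm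

theorem elasticForm_nonneg (m : Medium) (p : Jet) : 0 ≤ (elasticForm m p p).re := by
  obtain ⟨c, hc, h⟩ := m.convex
  rw [elasticForm_eq, re_wForm m.bddMeas_lam m.bddMeas_mu]
  exact integral_nonneg fun x => dens_self_nonneg (h x).1 (h x).2 hc.le _

/-- The elastic energy controls the gradient. -/
theorem exists_korn (m : Medium) :
    ∃ c : ℝ, 0 < c ∧ ∀ p ∈ H10 univ, c * ∑ i, ‖p.2 i‖ ^ 2 ≤ (elasticForm m p p).re := by
  obtain ⟨c, hc, h⟩ := m.convex
  refine ⟨c / 2, by positivity, fun p hp => ?_⟩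
  have k := korn hp
  have : c * (wForm (fun _ => 0) (fun _ => 1 / 2) p.2 p.2).re ≤ (elasticForm m p p).re := by
    rw [elasticForm_eq, re_wForm m.bddMeas_lam m.bddMeas_mu,
      re_wForm (bddMeas_const 0) (bddMeas_const _), ← integral_const_mul]
    refine integral_mono ((integrable_dens (bddMeas_const 0) (bddMeas_const _) _ _).re.const_mul c)
      (integrable_dens m.bddMeas_lam m.bddMeas_mu _ _).re fun x => ?_
    simp only [re_dens_half]
    exact le_dens_self (h x).1 (h x).2 hc.le _
  have e : (2 * wForm (fun _ => 0) (fun _ => 1 / 2) p.2 p.2).re =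
      2 * (wForm (fun _ => 0) (fun _ => 1 / 2) p.2 p.2).re := by simp
  rw [e] at k
  nlinarith

theorem hasCompactSupport_smul (w : E3 → ℝ) {φ : E3 → C3} (h : HasCompactSupport φ) :
    HasCompactSupport (fun x => w x • φ x) :=
  h.mono fun x hx h0 => hx (by simp [h0])

/-- Integration by parts after writing φ = ∂₀(x₀φ) − x₀∂₀φ; the coordinate factor is bounded on
bounded sets, which yields Poincaré's inequality. -/
theorem integral_component_sq {φ : E3 → C3} (h1 : ContDiff ℝ ∞ φ) (h2 : HasCompactSupport φ)
    (a : Fin 3) : ∫ x, φ x a * star (φ x a) =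
      -∫ x, ((x 0 • φ x) a * star (fderiv ℝ φ x (dir 0) a) +
          (x 0 • fderiv ℝ φ x (dir 0)) a * star (φ x a)) := by
  have hχ : ContDiff ℝ ∞ (fun x : E3 => x 0) := (EuclideanSpace.proj (𝕜 := ℝ) (0 : Fin 3) : E3 →L[ℝ] ℝ).contDiff
  have hψ : ContDiff ℝ ∞ (fun x => x 0 • φ x) := hχ.smul h1
  have hψc : HasCompactSupport (fun x => x 0 • φ x) :=
    hasCompactSupport_smul _ h2
  have parts := integral_by_parts hψ h1 hψc a a (dir 0)
  have hd : ∀ x, fderiv ℝ (fun x => x 0 • φ x) x (dir 0) = x 0 • fderiv ℝ φ x (dir 0) + φ x := by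
    intro x
    have h0 : HasFDerivAt (fun x : E3 => x 0) (EuclideanSpace.proj (𝕜 := ℝ) 0) x :=
      (EuclideanSpace.proj (𝕜 := ℝ) 0).hasFDerivAt
    rw [fderiv_fun_smul h0.differentiableAt (h1.differentiable (by simp) x), h0.fderiv]
    simp
  have i1 : Integrable (fun x => (x 0 • φ x) a * star (fderiv ℝ φ x (dir 0) a)) := by
    refine Continuous.integrable_of_hasCompactSupport ?_ ?_
    · exact ((coordB a a).continuous.comp hψ.continuous).clm_apply
        (contDiff_partial h1 (dir 0)).continuous
    · exact hψc.mono' fun x hx => subset_closure fun h => hx (by simp only [h]; simp)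
  have i2 : Integrable (fun x => (x 0 • fderiv ℝ φ x (dir 0)) a * star (φ x a)) := by
    refine Continuous.integrable_of_hasCompactSupport ?_ ?_
    · exact ((coordB a a).continuous.comp
        (hχ.continuous.smul (contDiff_partial h1 (dir 0)).continuous)).clm_apply h1.continuous
    · exact h2.mono' fun x hx => subset_closure fun h => hx (by simp [h])
  have i3 : Integrable (fun x => φ x a * star (φ x a)) := by
    refine Continuous.integrable_of_hasCompactSupport ?_ ?_
    · exact ((coordB a a).continuous.comp h1.continuous).clm_apply h1.continuous
    · exact h2.mono' fun x hx => subset_closure fun h => hx (by simp [h])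
  rw [integral_add i1 i2, parts]
  simp only [hd, PiLp.add_apply, add_mul]
  rw [integral_add i2 i3]
  ring

/-- The bound on t is asked only where u ≠ 0, since the coordinate x₀ is controlled only on the
support of the test field. -/
theorem norm_component_le {R t : ℝ} {u v : C3} (a : Fin 3) (hR : 0 ≤ R) (ht : u ≠ 0 → |t| ≤ R) :
    ‖(t • u) a * star (v a) + (t • v) a * star (u a)‖ ≤ 2 * R * (‖u‖ * ‖v‖) := by
  by_cases hu : u = 0
  · simp [hu]
  · have h1 := PiLp.norm_apply_le u a
    have h2 := PiLp.norm_apply_le v a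
    have key : |t| * (‖u a‖ * ‖v a‖) ≤ R * (‖u‖ * ‖v‖) := by
      have := ht hu
      gcongr
    refine (norm_add_le _ _).trans ?_
    simp only [PiLp.smul_apply, norm_mul, norm_smul, norm_star, Real.norm_eq_abs]
    nlinarith

/-- On U one has |x₀| ≤ R. Each of the three components contributes two terms, each at most
R‖u‖‖∂₀u‖, whence the constant 3 · 2R; then one factor ‖u‖ is cancelled. -/
theorem poincare {U : Set E3} (hU : Bornology.IsBounded U) :
    ∃ C : ℝ, 0 ≤ C ∧ ∀ p ∈ H10 U, ‖p.1‖ ≤ C * ‖p.2 0‖ := by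
  obtain ⟨R, hR0, hR⟩ := hU.exists_pos_norm_le
  refine ⟨3 * (2 * R), by positivity, fun p hp => ?_⟩
  refine H10_induction (P := fun p => ‖p.1‖ ≤ 3 * (2 * R) * ‖p.2 0‖)
    (isClosed_le (by fun_prop) (by fun_prop)) ?_ hp
  rintro p ⟨φ, h1, h2, h3, h4, h5⟩
  have bound : ∀ a : Fin 3, ‖∫ x, p.1 x a * star (p.1 x a)‖ ≤ 2 * R * (‖p.1‖ * ‖p.2 0‖) := by
    intro a
    have e : ∫ x, p.1 x a * star (p.1 x a) = ∫ x, φ x a * star (φ x a) := by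
      refine integral_congr_ae ?_
      filter_upwards [h4] with x hx
      rw [hx]
    rw [e, integral_component_sq h1 h2, norm_neg]
    calc _ ≤ ∫ x, 2 * R * (‖p.1 x‖ * ‖p.2 0 x‖) := by
          refine norm_integral_le_of_norm_le ((integrable_norm_mul_norm _ _).const_mul _) ?_
          filter_upwards [h4, h5 0] with x hx hx'
          rw [hx, hx']
          refine norm_component_le a hR0.le fun hφ0 => ?_
          refine (PiLp.norm_apply_le x 0).trans (hR x (h3 (subset_tsupport _ hφ0)))
      _ = 2 * R * ∫ x, ‖p.1 x‖ * ‖p.2 0 x‖ := integral_const_mul _ _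
      _ ≤ _ := by gcongr; exact integral_norm_mul_norm_le _ _
  have total : ‖p.1‖ ^ 2 ≤ 3 * (2 * R * (‖p.1‖ * ‖p.2 0‖)) := by
    have e := congrArg norm (norm_sq_eq_sum p.1)
    rw [Complex.norm_real, Real.norm_of_nonneg (by positivity)] at e
    rw [e]
    refine (norm_sum_le _ _).trans ((Finset.sum_le_sum fun a _ => bound a).trans ?_)
    simp
  rcases (norm_nonneg p.1).eq_or_lt with h0 | h0
  · rw [← h0]; positivity
  · refine le_of_mul_le_mul_left ?_ h0
    nlinarith

/-! ### Multiplication by functions -/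

theorem exists_mulOp {a : E3 → ℝ} (ha : BddMeas a) :
    ∃ A : VecL2 →L[ℂ] VecL2, ∀ f : VecL2, A f =ᵐ[volume] fun x => a x • f x := by
  obtain ⟨ham, M, hM⟩ := ha
  have hmem : ∀ f : VecL2, MemLp (fun x => a x • f x) 2 volume := fun f =>
    MemLp.of_le_mul (c := M) (Lp.memLp f)
      (ham.aestronglyMeasurable.smul (Lp.aestronglyMeasurable f))
      (Eventually.of_forall fun x => by
        rw [norm_smul]
        exact mul_le_mul_of_nonneg_right (hM x) (norm_nonneg _))
  refine ⟨LinearMap.mkContinuous ⟨⟨fun f => (hmem f).toLp, fun f g => ?_⟩, fun c f => ?_⟩ M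
    fun f => ?_, fun f => (hmem f).coeFn_toLp⟩
  · rw [← MemLp.toLp_add]
    refine (MemLp.toLp_eq_toLp_iff _ _).2 ?_
    filter_upwards [Lp.coeFn_add f g] with x hx
    rw [hx, Pi.add_apply, smul_add]; rfl
  · rw [RingHom.id_apply, ← MemLp.toLp_const_smul]
    refine (MemLp.toLp_eq_toLp_iff (hmem (c • f)) ((hmem f).const_smul c)).2 ?_
    filter_upwards [Lp.coeFn_smul c f] with x hx
    rw [hx, Pi.smul_apply, smul_comm]; rfl
  · refine Lp.norm_le_mul_norm_of_ae_le_mul ?_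
    filter_upwards [(hmem f).coeFn_toLp] with x hx
    refine (congrArg norm hx).le.trans ?_
    rw [norm_smul]
    exact mul_le_mul_of_nonneg_right (hM x) (norm_nonneg _)

/-- `H¹` is a module over the smooth functions that are bounded with bounded gradient. -/
theorem exists_smul_mem_H10 {w : E3 → ℝ} (hw : ContDiff ℝ ∞ w) {M N : ℝ} (hM : ∀ x, |w x| ≤ M)
    (hN : ∀ x, ‖fderiv ℝ w x‖ ≤ N) {p : Jet} (hp : p ∈ H10 univ) :
    ∃ q ∈ H10 univ, (q.1 =ᵐ[volume] fun x => w x • p.1 x) ∧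
      ∀ j, q.2 j =ᵐ[volume] fun x => w x • p.2 j x + fderiv ℝ w x (dir j) • p.1 x := by
  have hd : ∀ j, BddMeas (fun x => fderiv ℝ w x (dir j)) := fun j =>
    ⟨((hw.fderiv_right (m := ∞) (by norm_cast)).clm_apply contDiff_const).continuous.measurable, N,
      fun x => by
        refine ((fderiv ℝ w x).le_opNorm _).trans ?_
        simpa using hN x⟩
  obtain ⟨A, hA⟩ := exists_mulOp (a := w) ⟨hw.continuous.measurable, M, hM⟩
  choose D hD using fun j => exists_mulOp (hd j)
  -- The product rule makes sense, and is continuous, on all pairs of a field and would-be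
  -- derivatives, so it need only be checked on test jets.
  let Φ : Jet → Jet := fun p => (A p.1, fun j => A (p.2 j) + D j p.1)
  have hΦ : Continuous Φ := (A.continuous.comp continuous_fst).prodMk (continuous_pi fun j =>
    (A.continuous.comp ((continuous_apply j).comp continuous_snd)).add
      ((D j).continuous.comp continuous_fst))
  refine ⟨Φ p, ?_, hA _, fun j => ?_⟩
  · refine H10_induction (P := fun p => Φ p ∈ H10 univ) ((isClosed_H10 univ).preimage hΦ) ?_ hp
    rintro p ⟨φ, h1, h2, h3, h4, h5⟩
    have hc : HasCompactSupport (fun x => w x • φ x) := hasCompactSupport_smul w h2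
    have e1 : A p.1 =ᵐ[volume] fun x => w x • φ x := by
      filter_upwards [hA p.1, h4] with x hx h4
      rw [hx, h4]
    have e2 : ∀ j, ((A (p.2 j) + D j p.1 : VecL2) : E3 → C3) =ᵐ[volume]
        fun x => fderiv ℝ (fun x => w x • φ x) x (dir j) := by
      intro j
      filter_upwards [hA (p.2 j), hD j p.1, h4, h5 j, Lp.coeFn_add (A (p.2 j)) (D j p.1)]
        with x hx h6 h4 h5 h7
      rw [h7, Pi.add_apply, hx, h6, h4, h5, fderiv_fun_smul (hw.differentiable (by simp) x)
        (h1.differentiable (by simp) x)]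
      simp
    exact testJets_subset_H10 univ ⟨fun x => w x • φ x, hw.smul h1, hc, subset_univ _, e1, e2⟩
  · filter_upwards [hA (p.2 j), hD j p.1, Lp.coeFn_add (A (p.2 j)) (D j p.1)] with x h1 h2 h3
    rw [h3, Pi.add_apply, h1, h2]

/-! ### The embedding of `H¹` into `L²` -/

theorem dense_testFields :
    Dense {f : VecL2 | ∃ g : E3 → C3, f =ᵐ[volume] g ∧ HasCompactSupport g ∧ ContDiff ℝ ∞ g} :=
  Lp.dense_hasCompactSupport_contDiff (by norm_num)

theorem dense_image_fst_H10 : Dense (Prod.fst '' (H10 univ : Set Jet)) := by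
  refine dense_testFields.mono ?_
  rintro f ⟨g, h1, h2, h3⟩
  obtain ⟨p, hp1, hp2⟩ := exists_jet h3 h2
  refine ⟨p, testJets_subset_H10 univ ⟨g, h3, h2, subset_univ _, hp1, hp2⟩, ?_⟩
  exact Lp.ext (hp1.trans h1.symm)

theorem kForm_one_eq_sum (f g : VecL2) :
    kForm (fun _ => 1) f g = ∑ i, ∫ x, f x i * star (g x i) := by
  rw [kForm]
  simp only [Complex.ofReal_one, one_mul]
  exact integral_finsetSum _ fun i _ => integrable_coord' f g i i

/-- A field in `H¹` determines its gradient. -/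
theorem H10_injective {p : Jet} (hp : p ∈ H10 univ) (h0 : p.1 = 0) : p = 0 := by
  -- The second component of an element of H¹ is the distributional gradient of the first: this
  -- identity is closed in p and holds for test jets.
  have key : ∀ (j : Fin 3) (q : Jet), q ∈ testJets univ → ∀ p ∈ H10 univ,
      inner ℂ (p.2 j) q.1 = - inner ℂ p.1 (q.2 j) := by
    rintro j q ⟨ψ, g1, g2, g3, g4, g5⟩ p hp
    refine H10_induction (P := fun p => inner ℂ (p.2 j) q.1 = - inner ℂ p.1 (q.2 j))
      (isClosed_eq (by fun_prop) (by fun_prop)) ?_ hp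
    rintro p ⟨φ, h1, h2, h3, h4, h5⟩
    rw [← kForm_one, ← kForm_one, kForm_one_eq_sum, kForm_one_eq_sum, ← Finset.sum_neg_distrib]
    refine Finset.sum_congr rfl fun i _ => ?_
    have := integral_by_parts g1 h1 g2 i i (dir j)
    rw [integral_congr_ae (g := fun x => ψ x i * star (fderiv ℝ φ x (dir j) i)), this]
    · congr 1
      refine integral_congr_ae ?_
      filter_upwards [h4, g5 j] with x h4 g5
      rw [h4, g5]
    · filter_upwards [h5 j, g4] with x h5 g4
      rw [h5, g4]
  refine Prod.ext h0 (funext fun j => ?_)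
  refine dense_testFields.eq_zero_of_inner_left (𝕜 := ℂ) fun v hv => ?_
  obtain ⟨g, h1, h2, h3⟩ := hv
  obtain ⟨q, hq1, hq2⟩ := exists_jet h3 h2
  have hv : v = q.1 := Lp.ext (h1.trans hq1.symm)
  simp only [hv]
  rw [key j q ⟨g, h3, h2, subset_univ _, hq1, hq2⟩ p hp, h0, inner_zero_left, neg_zero]

end ElasticSC

end

/-! ### Hilbert space construction of regular solutions. -/

noncomputable section

namespace ElasticSC

/-! ### Coercive Hermitian forms -/

universe u

/-- A copy of the vector space `E` that carries no topology. -/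
def Algebraic (E : Type*) : Type _ := E

instance {E : Type*} [AddCommGroup E] : AddCommGroup (Algebraic E) := inferInstanceAs (AddCommGroup E)

instance {E : Type*} [AddCommGroup E] [Module ℂ E] : Module ℂ (Algebraic E) :=
  inferInstanceAs (Module ℂ E)

/-- A Hermitian form, linear in the first argument, that is bounded and coercive. -/
structure IsCoerciveForm {E : Type*} [NormedAddCommGroup E] [NormedSpace ℂ E]
    (b : E → E → ℂ) : Prop where
  add_left : ∀ x y z, b (x + y) z = b x z + b y z
  smul_left : ∀ (c : ℂ) x y, b (c • x) y = c * b x y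
  star_eq : ∀ x y, star (b x y) = b y x
  le : ∃ c : ℝ, 0 < c ∧ ∀ x, c * ‖x‖ ^ 2 ≤ (b x x).re
  ge : ∃ C : ℝ, 0 ≤ C ∧ ∀ x, (b x x).re ≤ C * ‖x‖ ^ 2

/-- Coercivity and boundedness make the norm of the form equivalent to the given one, so
completeness carries over. The arguments are swapped because the inner product is conjugate linear
in its first slot. -/
theorem IsCoerciveForm.exists_hilbert {E : Type u} [NormedAddCommGroup E] [NormedSpace ℂ E]
    [CompleteSpace E] {b : E → E → ℂ} (hb : IsCoerciveForm b) :
    ∃ (F : Type u) (_ : NormedAddCommGroup F) (_ : InnerProductSpace ℂ F)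
      (_ : CompleteSpace F) (e : E ≃L[ℂ] F),
      ∀ x y, inner ℂ (e x) (e y) = b y x := by
  obtain ⟨c, hc, hle⟩ := hb.le
  obtain ⟨C, hC, hge⟩ := hb.ge
  let core : InnerProductSpace.Core ℂ (Algebraic E) :=
    { inner := fun x y => b y x
      conj_inner_symm := fun x y => hb.star_eq x y
      re_inner_nonneg := fun x => (mul_nonneg hc.le (sq_nonneg ‖(show E from x)‖)).trans (hle x)
      add_left := fun x y z => by
        have key : ∀ x y z : E, b z (x + y) = b z x + b z y := fun x y z => by
          rw [← hb.star_eq, hb.add_left, star_add, hb.star_eq, hb.star_eq]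
        exact key x y z
      smul_left := fun x y r => by
        have key : ∀ (x y : E) (r : ℂ), b y (r • x) = star r * b y x := fun x y r => by
          rw [← hb.star_eq, hb.smul_left, star_mul', hb.star_eq]
        exact key x y r
      definite := fun x hx => by
        have h := hle x
        have hx' : b x x = 0 := hx
        rw [hx', Complex.zero_re] at h
        have h0 : ‖(show E from x)‖ ^ 2 = 0 :=
          le_antisymm (nonpos_of_mul_nonpos_right h hc) (sq_nonneg _)
        exact norm_eq_zero.1 (pow_eq_zero_iff (two_ne_zero) |>.1 h0) }
  let i1 : NormedAddCommGroup (Algebraic E) := core.toNormedAddCommGroup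
  let i2 : InnerProductSpace ℂ (Algebraic E) := InnerProductSpace.ofCore core.toCore
  let e0 : E ≃ₗ[ℂ] Algebraic E := LinearEquiv.refl ℂ E
  have hn : ∀ x : E, ‖e0 x‖ ^ 2 = (b x x).re := fun x => by
    rw [← inner_self_eq_norm_sq (𝕜 := ℂ)]; rfl
  have b1 : ∀ x : E, ‖e0 x‖ ≤ Real.sqrt C * ‖x‖ := fun x => by
    refine abs_le_of_sq_le_sq' ?_ (by positivity) |>.2
    rw [hn, mul_pow, Real.sq_sqrt hC]; exact hge x
  have b2 : ∀ x : Algebraic E, ‖e0.symm x‖ ≤ Real.sqrt c⁻¹ * ‖x‖ := fun x => by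
    refine abs_le_of_sq_le_sq' ?_ (by positivity) |>.2
    have h1 := hn (e0.symm x)
    rw [e0.apply_symm_apply] at h1
    rw [mul_pow, Real.sq_sqrt (by positivity), h1, inv_mul_eq_div, le_div_iff₀ hc, mul_comm]
    exact hle _
  let e : E ≃L[ℂ] Algebraic E := e0.toContinuousLinearEquivOfBounds _ _ b1 b2
  exact ⟨Algebraic E, i1, i2, (completeSpace_congr (e := e.toEquiv) e.isUniformEmbedding).1 inferInstance,
    e, fun x y => rfl⟩

theorem IsCoerciveForm.exists_riesz {E : Type*} [NormedAddCommGroup E] [NormedSpace ℂ E]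
    [CompleteSpace E] {b : E → E → ℂ} (hb : IsCoerciveForm b) (l : E →L[ℂ] ℂ) :
    ∃ p, ∀ q, b q p = l q := by
  obtain ⟨F, _, _, _, e, he⟩ := hb.exists_hilbert
  let L : F →L[ℂ] ℂ := l.comp (e.symm : F →L[ℂ] E)
  refine ⟨e.symm ((InnerProductSpace.toDual ℂ F).symm L), fun q => ?_⟩
  rw [← he, e.apply_symm_apply, InnerProductSpace.toDual_symm_apply]
  simp [L]

/-! ### Smooth solutions of an abstract wave equation -/

section Abstract

variable {V H : Type*} [NormedAddCommGroup V] [InnerProductSpace ℂ V] [CompleteSpace V]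
  [NormedAddCommGroup H] [InnerProductSpace ℂ H] [CompleteSpace H]

/-- The flow is exp(tB)x. A linear constraint Zx = 0 persists when Z commutes with B, hence with the
exponential. -/
theorem exists_linear_flow {X : Type*} [NormedAddCommGroup X] [NormedSpace ℂ X] [CompleteSpace X]
    (B : X →L[ℂ] X) (x : X) :
    ∃ y : ℝ → X, y 0 = x ∧ (∀ t, HasDerivAt y (B (y t)) t) ∧
      ∀ Z : X →L[ℂ] X, Commute Z B → Z x = 0 → ∀ t, Z (y t) = 0 := by
  refine ⟨fun t => NormedSpace.exp (t • B) x, by simp, fun t => ?_, fun Z hZ h0 t => ?_⟩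
  · exact ((ContinuousLinearMap.apply ℂ X x).restrictScalars ℝ).hasFDerivAt.comp_hasDerivAt t
      (hasDerivAt_exp_smul_const' (𝕂 := ℝ) B t)
  · have h : Commute Z (NormedSpace.exp (t • B)) := (hZ.smul_right t).exp_right
    calc Z (NormedSpace.exp (t • B) x) = (Z * NormedSpace.exp (t • B)) x := rfl
      _ = (NormedSpace.exp (t • B) * Z) x := by rw [h.eq]
      _ = NormedSpace.exp (t • B) (Z x) := rfl
      _ = 0 := by rw [h0, map_zero]

/-- The equation u″ = −Au has bounded A. The operator D = KA − 1 + K commutes with A and kills the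
initial data, hence u(t); thus KAu = u − Ku, although K need not be invertible. -/
theorem exists_bounded_second_order_solution (K A P : V →L[ℂ] V) (hKA : Commute K A)
    (hP : (K * A - 1 + K) * P = 0) (p q : V) :
    ∃ u v w : ℝ → V, (∀ t, HasDerivAt u (v t) t) ∧ (∀ t, HasDerivAt v (w t) t) ∧
      u 0 = P p ∧ v 0 = P q ∧ ∀ t, K (w t) = -(u t - K (u t)) := by
  let F : V × V →L[ℂ] V := ContinuousLinearMap.fst ℂ V V
  let S : V × V →L[ℂ] V := ContinuousLinearMap.snd ℂ V V
  let B : V × V →L[ℂ] V × V := S.prod (-(A.comp F))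
  let D : V →L[ℂ] V := K * A - 1 + K
  let Z : V × V →L[ℂ] V × V := (D.comp F).prod (D.comp S)
  have hDA : ∀ x, D (A x) = A (D x) := fun x => by
    have h : ∀ x, K (A x) = A (K x) := fun x => DFunLike.congr_fun hKA.eq x
    simp [D, h]
  have hcomm : Commute Z B := by
    ext x <;> simp [Z, B, F, S, hDA]
  have h0 : Z (P p, P q) = 0 := by
    have h1 : ∀ x, D (P x) = 0 := fun x => DFunLike.congr_fun hP x
    simp [Z, F, S, h1]
  obtain ⟨y, hy0, hy, hZ'⟩ := exists_linear_flow B (P p, P q)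
  have hZ := hZ' Z hcomm h0
  have hF := fun t => (F.restrictScalars ℝ).hasFDerivAt.comp_hasDerivAt t (hy t)
  have hS := fun t => (S.restrictScalars ℝ).hasFDerivAt.comp_hasDerivAt t (hy t)
  refine ⟨fun t => (y t).1, fun t => (y t).2, fun t => -A (y t).1, hF, hS, ?_, ?_, fun t => ?_⟩
  · simp [hy0]
  · simp [hy0]
  · have h := congrArg Prod.fst (hZ t)
    have h' : K (A (y t).1) - (y t).1 + K (y t).1 = 0 := by simpa [Z, D, F] using h
    rw [map_neg, neg_inj]
    exact eq_sub_of_add_eq (by rw [sub_add_eq_add_sub, sub_eq_zero] at h'; exact h')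

/-- If x is orthogonal to the range, then 0 = ⟨K(Kx), x⟩ = ‖Kx‖². -/
theorem dense_range_of_selfAdjoint {K : V →L[ℂ] V} (hK : IsSelfAdjoint K)
    (hinj : Function.Injective K) : DenseRange K := by
  have h : (LinearMap.range (K : V →ₗ[ℂ] V)).topologicalClosure = ⊤ := by
    rw [Submodule.topologicalClosure_eq_top_iff, Submodule.eq_bot_iff]
    intro x hx
    apply hinj
    rw [map_zero, ← inner_self_eq_zero (𝕜 := ℂ)]
    have h1 := hx (K (K x)) ⟨K x, rfl⟩
    have h2 : inner ℂ (K (K x)) x = inner ℂ (K x) (K x) := by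
      have := ContinuousLinearMap.adjoint_inner_left K x (K x)
      rw [← ContinuousLinearMap.star_eq_adjoint, hK.star_eq] at this
      exact this
    rw [← h2]; exact h1
  exact Submodule.dense_iff_topologicalClosure_eq_top.2 h

/-- The spectral cutoff at height `δ`. -/
def cutoff (δ g : ℝ) : ℝ := min 1 (max 0 (g / δ - 1))

/-- Here K = ι*ι represents the H-product in V, and the weak equation reads Kw = −(u − Ku), formally
u″ = −(K⁻¹ − 1)u. Cutting off the spectrum of K near 0 makes the generator bounded. The range of K
is dense, and cutting off the low spectrum changes Kp by only O(δ). -/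
theorem exists_smooth_solutions_dense (ι : V →L[ℂ] H) (hι : Function.Injective ι) (f₀ f₁ : V)
    {ε : ℝ} (hε : 0 < ε) :
    ∃ u v w : ℝ → V, (∀ t, HasDerivAt u (v t) t) ∧ (∀ t, HasDerivAt v (w t) t) ∧
      ‖u 0 - f₀‖ < ε ∧ ‖v 0 - f₁‖ < ε ∧
      ∀ t q, inner ℂ (ι q) (ι (w t)) = -(inner ℂ q (u t) - inner ℂ (ι q) (ι (u t))) := by
  let K : V →L[ℂ] V := (ContinuousLinearMap.adjoint ι).comp ι
  have hKpos : K.IsPositive := ContinuousLinearMap.isPositive_adjoint_comp_self ι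
  have hK : IsSelfAdjoint K := hKpos.isSelfAdjoint
  have hin : ∀ q x, inner ℂ q (K x) = inner ℂ (ι q) (ι x) := fun q x =>
    ContinuousLinearMap.adjoint_inner_right ι q (ι x)
  have hKinj : Function.Injective K := by
    rw [injective_iff_map_eq_zero]
    intro x hx
    have := hin x x
    rw [hx, inner_zero_right] at this
    exact (injective_iff_map_eq_zero ι).1 hι x (inner_self_eq_zero.1 this.symm)
  have hsp : ∀ g ∈ spectrum ℝ K, 0 ≤ g :=
    spectrum_nonneg_of_nonneg ((ContinuousLinearMap.nonneg_iff_isPositive K).2 hKpos)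
  have hd := dense_range_of_selfAdjoint hK hKinj
  obtain ⟨p, hp⟩ := hd.exists_dist_lt f₀ (half_pos hε)
  obtain ⟨q, hq⟩ := hd.exists_dist_lt f₁ (half_pos hε)
  obtain ⟨δ, hδ, hδp, hδq⟩ : ∃ δ : ℝ, 0 < δ ∧ 2 * δ * ‖p‖ < ε / 2 ∧ 2 * δ * ‖q‖ < ε / 2 := by
    -- The 1 keeps the denominator positive; each product is then at most ε/4.
    refine ⟨ε / (8 * (‖p‖ + ‖q‖ + 1)), by positivity, ?_, ?_⟩
    all_goals
      rw [mul_div_assoc', div_mul_eq_mul_div, div_lt_iff₀ (by positivity)]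
      nlinarith [norm_nonneg p, norm_nonneg q]
  -- This equals 1/g − 1 for g ≥ δ, while the cutoff vanishes for g ≤ δ; the maximum only keeps the
  -- function continuous on the whole spectrum.
  let h : ℝ → ℝ := fun g => (1 - g) / max g δ
  have hmax : ∀ g, max g δ ≠ 0 := fun g => (lt_max_of_lt_right hδ).ne'
  have hh : Continuous h := by fun_prop (disch := exact hmax)
  have hf : Continuous (cutoff δ) := by unfold cutoff; fun_prop
  let A := cfc h K
  let P := cfc (cutoff δ) K
  have hKA : Commute K A := by
    have : Commute (cfc (fun x : ℝ => x) K) (cfc h K) := cfc_commute_cfc _ _ K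
    rwa [cfc_id' ℝ K] at this
  have hPeq : (K * A - 1 + K) * P = 0 := by
    have e1 : K * A = cfc (fun g => g * h g) K := by
      rw [cfc_mul (fun g : ℝ => g) h K (by fun_prop) (by fun_prop), cfc_id' ℝ K]
    have e2 : K * A - 1 + K = cfc (fun g => g * h g - 1 + g) K := by
      rw [cfc_add (a := K) (fun g => g * h g - 1) (fun g : ℝ => g) (by fun_prop) (by fun_prop),
        cfc_sub (a := K) (fun g => g * h g) (fun _ => (1 : ℝ)) (by fun_prop) (by fun_prop),
        cfc_id' ℝ K, cfc_const_one ℝ K, e1]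
    rw [e2, ← cfc_mul _ _ K (by fun_prop) (by fun_prop)]
    have : cfc (fun g => (g * h g - 1 + g) * cutoff δ g) K = cfc (fun _ : ℝ => (0 : ℝ)) K := by
      refine cfc_congr fun g hg => ?_
      rcases le_total g δ with hgd | hgd
      · have : cutoff δ g = 0 := by
          have : g / δ - 1 ≤ 0 := by rw [sub_nonpos, div_le_one hδ]; exact hgd
          simp [cutoff, this]
        simp [this]
      · have hg0 : g ≠ 0 := (hδ.trans_le hgd).ne'
        have : g * h g - 1 + g = 0 := by
          simp only [h, max_eq_left hgd]; field_simp; ring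
        simp [this]
    rw [this, cfc_const_zero ℝ K]
  -- The cutoff is 1 above 2δ and lies between 0 and 1, so |cutoff(g)g − g| ≤ 2δ on the spectrum,
  -- which is nonnegative.
  have happ : ∀ x, ‖P (K x) - K x‖ ≤ 2 * δ * ‖x‖ := fun x => by
    have e : P * K - K = cfc (fun g => cutoff δ g * g - g) K := by
      rw [cfc_sub (a := K) (fun g => cutoff δ g * g) (fun g : ℝ => g) (by fun_prop) (by fun_prop),
        cfc_mul (cutoff δ) (fun g : ℝ => g) K (by fun_prop) (by fun_prop), cfc_id' ℝ K]
    have n : ‖P * K - K‖ ≤ 2 * δ := by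
      rw [e]
      refine norm_cfc_le (by positivity) fun g hg => ?_
      have hg0 := hsp g hg
      rw [Real.norm_eq_abs]
      have c0 : 0 ≤ cutoff δ g := le_min zero_le_one (le_max_left _ _)
      have c1 : cutoff δ g ≤ 1 := min_le_left _ _
      rcases le_total g (2 * δ) with h2 | h2
      · rw [abs_le]; constructor <;> nlinarith
      · have : 1 ≤ g / δ - 1 := by rw [le_sub_iff_add_le, le_div_iff₀ hδ]; linarith
        have : cutoff δ g = 1 := by
          rw [cutoff, min_eq_left]; exact this.trans (le_max_right _ _)
        rw [this]; simp; positivity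
    exact (le_of_eq_of_le rfl ((P * K - K).le_opNorm x)).trans
      (mul_le_mul_of_nonneg_right n (norm_nonneg _))
  obtain ⟨u, v, w, h1, h2, h3, h4, h5⟩ :=
    exists_bounded_second_order_solution K A P hKA hPeq (K p) (K q)
  refine ⟨u, v, w, h1, h2, ?_, ?_, fun t x => ?_⟩
  · rw [h3]
    have := happ p
    rw [dist_comm, dist_eq_norm] at hp
    calc _ ≤ ‖P (K p) - K p‖ + ‖K p - f₀‖ := norm_sub_le_norm_sub_add_norm_sub _ _ _
      _ < ε := by linarith
  · rw [h4]
    have := happ q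
    rw [dist_comm, dist_eq_norm] at hq
    calc _ ≤ ‖P (K q) - K q‖ + ‖K q - f₁‖ := norm_sub_le_norm_sub_add_norm_sub _ _ _
      _ < ε := by linarith
  · rw [← hin, h5, inner_neg_right, inner_sub_right, hin]

end Abstract

end ElasticSC

end

/-! ### Finite energy waves: conservation, existence, uniqueness, projections. -/

noncomputable section

namespace ElasticSC

section Generic

variable {X Y Z : Type*} [NormedAddCommGroup X] [NormedSpace ℝ X] [NormedAddCommGroup Y]
  [NormedSpace ℝ Y] [NormedAddCommGroup Z] [NormedSpace ℝ Z]

theorem exists_bilin_prod (B : X →L[ℝ] X →L[ℝ] Z) (K : Y →L[ℝ] Y →L[ℝ] Z) :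
    ∃ T : X × Y →L[ℝ] X × Y →L[ℝ] Z, ∀ f g, T f g = K f.2 g.2 + B f.1 g.1 :=
  ⟨K.bilinearComp (ContinuousLinearMap.snd ℝ X Y) (ContinuousLinearMap.snd ℝ X Y) +
    B.bilinearComp (ContinuousLinearMap.fst ℝ X Y) (ContinuousLinearMap.fst ℝ X Y), fun _ _ => rfl⟩

theorem exists_bilin_snd (K : Y →L[ℝ] Y →L[ℝ] Z) :
    ∃ T : X × Y →L[ℝ] X × Y →L[ℝ] Z, ∀ f g, T f g = K f.2 g.2 :=
  ⟨K.bilinearComp (ContinuousLinearMap.snd ℝ X Y) (ContinuousLinearMap.snd ℝ X Y), fun _ _ => rfl⟩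

theorem exists_bilin_bound (B : X →L[ℝ] X →L[ℝ] ℂ) :
    ∃ C : ℝ, 0 ≤ C ∧ ∀ f, (B f f).re ≤ C * ‖f‖ ^ 2 :=
  ⟨‖B‖, norm_nonneg B, fun f => (Complex.re_le_norm _).trans
    ((B.le_opNorm₂ f f).trans (le_of_eq (by ring)))⟩

theorem continuous_bilin (B : X →L[ℝ] Y →L[ℝ] Z) : Continuous fun x : X × Y => B x.1 x.2 :=
  (B.continuous.comp continuous_fst).clm_apply continuous_snd

theorem hasDerivAt_bilin (B : X →L[ℝ] Y →L[ℝ] Z) {f : ℝ → X} {g : ℝ → Y} {f' : X} {g' : Y} {t : ℝ}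
    (hf : HasDerivAt f f' t) (hg : HasDerivAt g g' t) :
    HasDerivAt (fun s => B (f s) (g s)) (B (f t) g' + B f' (g t)) t :=
  B.hasDerivAt_of_bilinear (fun _ => hf) (fun _ => hg)

theorem hasDerivAt_fst {f : ℝ → X × Y} {f' : X × Y} {t : ℝ} (hf : HasDerivAt f f' t) :
    HasDerivAt (fun s => (f s).1) f'.1 t :=
  (ContinuousLinearMap.fst ℝ X Y).hasFDerivAt.comp_hasDerivAt _ hf

theorem hasDerivAt_clm (L : X →L[ℝ] Y) {f : ℝ → X} {f' : X} {t : ℝ} (hf : HasDerivAt f f' t) :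
    HasDerivAt (fun s => L (f s)) (L f') t :=
  L.hasFDerivAt.comp_hasDerivAt _ hf

theorem hasDerivAt_comp_neg {f : ℝ → X} {f' : X} {t : ℝ} (hf : HasDerivAt f f' (-t)) :
    HasDerivAt (fun s => f (-s)) (-f') t := by
  have := hf.scomp t (hasDerivAt_neg t)
  rw [neg_one_smul] at this
  exact this

theorem hasDerivAt_comp_neg' {f : ℝ → X} {f' : X} {t : ℝ} (hf : HasDerivAt f (-f') (-t)) :
    HasDerivAt (fun s => -f (-s)) (-f') t := by
  simpa using (hasDerivAt_comp_neg hf).fun_neg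

/-- Transport to the Hilbert space of the form b and back. The return map costs a factor ‖L‖ in the
norm, so the initial error is first divided by ‖L‖ + 1. -/
theorem IsCoerciveForm.exists_smooth_solutions {E H : Type*} [NormedAddCommGroup E]
    [NormedSpace ℂ E] [CompleteSpace E] [NormedAddCommGroup H] [InnerProductSpace ℂ H]
    [CompleteSpace H] {a b : E → E → ℂ} (hb : IsCoerciveForm b) (ι : E →L[ℂ] H)
    (hι : Function.Injective ι) (hab : ∀ p q, b p q = a p q + inner ℂ (ι q) (ι p)) (f₀ f₁ : E)
    {ε : ℝ} (hε : 0 < ε) :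
    ∃ u v w : ℝ → E, (∀ t, HasDerivAt u (v t) t) ∧ (∀ t, HasDerivAt v (w t) t) ∧
      ‖u 0 - f₀‖ < ε ∧ ‖v 0 - f₁‖ < ε ∧ ∀ t q, inner ℂ (ι q) (ι (w t)) = -a (u t) q := by
  obtain ⟨F, _, _, _, e, he⟩ := hb.exists_hilbert
  let L : F →L[ℂ] E := e.symm
  have hL : ∀ x, L (e x) = x := e.symm_apply_apply
  have hL' : ∀ x, e (L x) = x := e.apply_symm_apply
  have hinj : Function.Injective (ι.comp L) := hι.comp e.symm.injective
  have hN : ∀ x y, ‖L x - y‖ ≤ ‖L‖ * ‖x - e y‖ := fun x y => by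
    have := L.le_opNorm (x - e y)
    rwa [map_sub, hL] at this
  have hN0 : 0 ≤ ‖L‖ := norm_nonneg L
  obtain ⟨u, v, w, hu, hv, hu0, hv0, hw⟩ := exists_smooth_solutions_dense (ι.comp L) hinj
    (e f₀) (e f₁) (by positivity : 0 < ε / (‖L‖ + 1))
  have small : ∀ r, r < ε / (‖L‖ + 1) → 0 ≤ r → ‖L‖ * r < ε := fun r hr h0 => by
    rw [lt_div_iff₀ (by positivity)] at hr
    nlinarith
  refine ⟨fun t => L (u t), fun t => L (v t), fun t => L (w t),
    fun t => hasDerivAt_clm (L.restrictScalars ℝ) (hu t),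
    fun t => hasDerivAt_clm (L.restrictScalars ℝ) (hv t),
    (hN _ _).trans_lt (small _ hu0 (norm_nonneg _)),
    (hN _ _).trans_lt (small _ hv0 (norm_nonneg _)), fun t q => ?_⟩
  have h2 := hw t (e q)
  have h3 := he q (L (u t))
  rw [hL'] at h3
  rw [h3] at h2
  simp only [ContinuousLinearMap.comp_apply, hL] at h2
  rw [h2, hab, add_sub_cancel_right]

end Generic

/-! ### The elastic form and the energy as continuous forms -/

theorem exists_elasticForm (m : Medium) :
    ∃ B : Jet →L[ℝ] Jet →L[ℝ] ℂ, ∀ p q, B p q = elasticForm m p q := by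
  obtain ⟨B, hB⟩ := exists_wForm m.bddMeas_lam m.bddMeas_mu
  obtain ⟨T, hT⟩ := exists_bilin_snd (X := VecL2) B
  exact ⟨T, fun p q => (hT p q).trans (hB _ _)⟩

theorem exists_energyInner (m : Medium) :
    ∃ B : Data →L[ℝ] Data →L[ℝ] ℂ, ∀ f g, B f g = energyInner m f g := by
  obtain ⟨B, hB⟩ := exists_elasticForm m
  obtain ⟨K, hK⟩ := exists_kForm (bddMeas_const 1)
  obtain ⟨T, hT⟩ := exists_bilin_prod B K
  refine ⟨T, fun f g => ?_⟩
  rw [energyInner_eq, ← elasticForm_eq, hT, hB, hK]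

theorem elasticForm_add_left (m : Medium) (p p' q : Jet) :
    elasticForm m (p + p') q = elasticForm m p q + elasticForm m p' q := by
  obtain ⟨B, hB⟩ := exists_elasticForm m
  simp only [← hB, map_add, add_apply]

theorem elasticForm_sub_left (m : Medium) (p p' q : Jet) :
    elasticForm m (p - p') q = elasticForm m p q - elasticForm m p' q := by
  obtain ⟨B, hB⟩ := exists_elasticForm m
  simp only [← hB, map_sub, sub_apply]

theorem elasticForm_smul_left (m : Medium) (c : ℂ) (p q : Jet) :
    elasticForm m (c • p) q = c * elasticForm m p q := wForm_smul_left _ _ _ _ _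

theorem star_elasticForm (m : Medium) (p q : Jet) :
    star (elasticForm m p q) = elasticForm m q p := star_wForm _ _ _ _

theorem energyInner_sub_left (m : Medium) (f f' g : Data) :
    energyInner m (f - f') g = energyInner m f g - energyInner m f' g := by
  obtain ⟨B, hB⟩ := exists_energyInner m
  simp only [← hB, map_sub, sub_apply]

theorem energyInner_eq' (m : Medium) (f g : Data) :
    energyInner m f g = inner ℂ g.2 f.2 + elasticForm m f.1 g.1 := by
  rw [energyInner_eq, kForm_one, elasticForm_eq]

theorem re_energyInner_self (m : Medium) (f : Data) :
    (energyInner m f f).re = ‖f.2‖ ^ 2 + (elasticForm m f.1 f.1).re := by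
  rw [energyInner_eq', Complex.add_re]
  congr 1
  exact inner_self_eq_norm_sq (𝕜 := ℂ) f.2

theorem exists_re_energyInner_le (m : Medium) :
    ∃ C : ℝ, 0 ≤ C ∧ ∀ f, (energyInner m f f).re ≤ C * ‖f‖ ^ 2 := by
  obtain ⟨B, hB⟩ := exists_energyInner m
  simp only [← hB]
  exact exists_bilin_bound B

theorem exists_re_elasticForm_le (m : Medium) :
    ∃ C : ℝ, 0 ≤ C ∧ ∀ f, (elasticForm m f f).re ≤ C * ‖f‖ ^ 2 := by
  obtain ⟨B, hB⟩ := exists_elasticForm m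
  simp only [← hB]
  exact exists_bilin_bound B

theorem norm_sq_jet_le (p : Jet) : ‖p‖ ^ 2 ≤ ‖p.1‖ ^ 2 + ∑ i, ‖p.2 i‖ ^ 2 := by
  have h : ‖p‖ ≤ Real.sqrt (‖p.1‖ ^ 2 + ∑ i, ‖p.2 i‖ ^ 2) := by
    refine norm_prod_le_iff.2 ⟨?_, (pi_norm_le_iff_of_nonneg (Real.sqrt_nonneg _)).2 fun i => ?_⟩
    · exact Real.le_sqrt_of_sq_le (le_add_of_nonneg_right (by positivity))
    · refine Real.le_sqrt_of_sq_le (le_add_of_nonneg_of_le (by positivity) ?_)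
      exact Finset.single_le_sum (f := fun i => ‖p.2 i‖ ^ 2) (fun j _ => sq_nonneg _)
        (Finset.mem_univ i)
  calc ‖p‖ ^ 2 ≤ _ := pow_le_pow_left₀ (norm_nonneg _) h 2
    _ = _ := Real.sq_sqrt (by positivity)

instance (U : Set E3) : CompleteSpace (H10 U) := (isClosed_H10 U).completeSpace_coe

/-! ### Waves -/

variable {m : Medium}

theorem re_inner_self_vecL2 (f : VecL2) : (inner ℂ f f).re = ‖f‖ ^ 2 :=
  inner_self_eq_norm_sq (𝕜 := ℂ) f

/-- On the whole space Korn's inequality bounds only the gradient; the L² term supplies control of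
the field itself. -/
theorem H1_lower_bound (m : Medium) : ∃ c : ℝ, 0 < c ∧ ∀ p ∈ H10 univ,
    c * ‖p‖ ^ 2 ≤ (elasticForm m p p + inner ℂ p.1 p.1).re := by
  obtain ⟨c, hc, h⟩ := exists_korn m
  refine ⟨min c 1, lt_min hc one_pos, fun p hp => ?_⟩
  have h1 := h p hp
  rw [Complex.add_re, re_inner_self_vecL2]
  have hs : 0 ≤ ∑ i, ‖p.2 i‖ ^ 2 := by positivity
  calc min c 1 * ‖p‖ ^ 2 ≤ min c 1 * (‖p.1‖ ^ 2 + ∑ i, ‖p.2 i‖ ^ 2) :=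
        mul_le_mul_of_nonneg_left (norm_sq_jet_le p) (le_min hc.le zero_le_one)
    _ ≤ _ := by
        linarith [mul_le_mul_of_nonneg_right (min_le_left c 1) hs,
          mul_le_mul_of_nonneg_right (min_le_right c 1) (sq_nonneg ‖p.1‖)]

theorem H1_upper_bound (m : Medium) : ∃ C : ℝ, 0 ≤ C ∧ ∀ p : Jet,
    (elasticForm m p p + inner ℂ p.1 p.1).re ≤ C * ‖p‖ ^ 2 := by
  obtain ⟨C, hC, h⟩ := exists_re_elasticForm_le m
  refine ⟨C + 1, by positivity, fun p => ?_⟩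
  have h1 := h p
  have h4 : ‖p.1‖ ≤ ‖p‖ := norm_fst_le p
  rw [Complex.add_re, re_inner_self_vecL2]
  nlinarith [pow_le_pow_left₀ (norm_nonneg _) h4 2]

/-- The `H¹` inner product that is adapted to the elastic form. -/
def H1Form (m : Medium) (p q : Jet) : ℂ := elasticForm m p q + inner ℂ q.1 p.1

theorem isCoerciveForm_H1 (m : Medium) :
    IsCoerciveForm (fun p q : H10 univ => H1Form m p q) := by
  have a1 : ∀ x y z : Jet, H1Form m (x + y) z = H1Form m x z + H1Form m y z := fun x y z => by
    rw [H1Form, elasticForm_add_left, Prod.fst_add, inner_add_right, H1Form, H1Form]; ring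
  have a2 : ∀ (c : ℂ) (x y : Jet), H1Form m (c • x) y = c * H1Form m x y := fun c x y => by
    rw [H1Form, elasticForm_smul_left, Prod.smul_fst, inner_smul_right, H1Form]; ring
  have a3 : ∀ x y : Jet, star (H1Form m x y) = H1Form m y x := fun x y => by
    rw [H1Form, star_add, star_elasticForm, H1Form]
    congr 1
    exact inner_conj_symm _ _
  obtain ⟨c, hc, h⟩ := H1_lower_bound m
  obtain ⟨C, hC, h'⟩ := H1_upper_bound m
  exact ⟨fun x y z => a1 x y z, fun c x y => a2 c x y, fun x y => a3 x y,
    ⟨c, hc, fun x => h x x.2⟩, ⟨C, hC, fun x => h' x⟩⟩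

theorem integral_eq_inner (f g : VecL2) : ∫ x, ∑ i, f x i * star (g x i) = inner ℂ g f := by
  rw [← kForm_one]; simp [kForm]

theorem IsWave.hasDerivAt_inner {u : ℝ → Data} (hu : IsWave m u) {q : Jet} (hq : q ∈ H10 univ)
    (t : ℝ) : HasDerivAt (fun s => (inner ℂ q.1 (u s).2 : ℂ)) (-elasticForm m (u t).1 q) t := by
  have := hu.2.2.2 q hq t
  simpa only [integral_eq_inner] using this

theorem isWave_of_inner {u : ℝ → Data} (h1 : ∀ t, (u t).1 ∈ H10 univ) (h2 : Continuous u)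
    (h3 : ∀ t, HasDerivAt (fun s => (u s).1.1) (u t).2 t)
    (h4 : ∀ q ∈ H10 univ, ∀ t,
      HasDerivAt (fun s => (inner ℂ q.1 (u s).2 : ℂ)) (-elasticForm m (u t).1 q) t) :
    IsWave m u :=
  ⟨h1, h2, h3, fun q hq t => by simpa only [integral_eq_inner] using h4 q hq t⟩

/-- The embedding of `H¹` into `L²`. -/
def embL2 : H10 univ →L[ℂ] VecL2 :=
  (ContinuousLinearMap.fst ℂ VecL2 (Fin 3 → VecL2)).comp (H10 univ).subtypeL

theorem embL2_injective : Function.Injective embL2 := by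
  rw [injective_iff_map_eq_zero]
  exact fun x hx => Subtype.ext (H10_injective x.2 hx)

/-- Smooth solutions are dense, in terms of `H¹`-valued functions. -/
theorem exists_smooth_wave (m : Medium) (f₀ f₁ : H10 univ) {ε : ℝ} (hε : 0 < ε) :
    ∃ u v w : ℝ → H10 univ, (∀ t, HasDerivAt u (v t) t) ∧ (∀ t, HasDerivAt v (w t) t) ∧
      ‖u 0 - f₀‖ < ε ∧ ‖v 0 - f₁‖ < ε ∧
      ∀ t q, inner ℂ (embL2 q) (embL2 (w t)) = -elasticForm m (u t) q :=
  (isCoerciveForm_H1 m).exists_smooth_solutions (a := fun p q : H10 univ => elasticForm m p q)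
    embL2 embL2_injective (fun _ _ => rfl) f₀ f₁ hε

/-- A regular solution needs its initial velocity in H¹, so the given L² velocity is first replaced
by a nearby H¹ field. -/
theorem exists_wave_approx (m : Medium) {h : Data} (hh : h.1 ∈ H10 univ) {ε : ℝ} (hε : 0 < ε) :
    ∃ u, IsWave m u ∧ ‖u 0 - h‖ < ε := by
  obtain ⟨_, ⟨q, hq, rfl⟩, hqd⟩ := dense_image_fst_H10.exists_dist_lt h.2 (half_pos hε)
  obtain ⟨u, v, w, hu, hv, hu0, hv0, hw⟩ := exists_smooth_wave m ⟨h.1, hh⟩ ⟨q, hq⟩ (half_pos hε)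
  have hJ : ∀ t, HasDerivAt (fun s => (u s : Jet)) (v t : Jet) t := fun t =>
    hasDerivAt_clm ((H10 univ).subtypeL.restrictScalars ℝ) (hu t)
  have hV : ∀ t, HasDerivAt (fun s => embL2 (v s)) (embL2 (w t)) t := fun t =>
    hasDerivAt_clm (embL2.restrictScalars ℝ) (hv t)
  have cJ : Continuous (fun s => (u s : Jet)) :=
    continuous_iff_continuousAt.2 fun t => (hJ t).continuousAt
  have cV : Continuous (fun s => embL2 (v s)) :=
    continuous_iff_continuousAt.2 fun t => (hV t).continuousAt
  refine ⟨fun t => (u t, embL2 (v t)), isWave_of_inner (fun t => (u t).2) (cJ.prodMk cV)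
    (fun t => hasDerivAt_fst (hJ t)) fun r hr t => ?_, ?_⟩
  · rw [← hw t ⟨r, hr⟩]
    exact hasDerivAt_clm ((innerSL ℂ r.1).restrictScalars ℝ) (hV t)
  · have a1 : ‖(u 0 : Jet) - h.1‖ < ε := lt_trans hu0 (half_lt_self hε)
    have a2 : ‖(v 0 : Jet) - q‖ < ε / 2 := hv0
    have a3 : ‖(v 0 : Jet).1 - h.2‖ < ε := by
      rw [dist_comm, dist_eq_norm] at hqd
      have := (norm_fst_le ((v 0 : Jet) - q)).trans_lt a2
      rw [Prod.fst_sub] at this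
      calc _ ≤ ‖(v 0 : Jet).1 - q.1‖ + ‖q.1 - h.2‖ := norm_sub_le_norm_sub_add_norm_sub _ _ _
        _ < ε := by linarith
    exact max_lt a1 a3

/-- A wave with displacement `J`, velocity `V` in `H¹` and acceleration `W` in `L²`. -/
structure IsRegularWave (m : Medium) (J V : ℝ → Jet) (W : ℝ → VecL2) : Prop where
  mem : ∀ t, J t ∈ H10 univ
  mem' : ∀ t, V t ∈ H10 univ
  deriv : ∀ t, HasDerivAt J (V t) t
  deriv' : ∀ t, HasDerivAt (fun s => (V s).1) (W t) t
  eqn : ∀ t, ∀ q ∈ H10 univ, inner ℂ q.1 (W t) = -elasticForm m (J t) q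

/-- The Steklov averages of a wave. -/
def steklov (u : ℝ → Data) (ε t : ℝ) : Jet := ε⁻¹ • ∫ s in t..t + ε, (u s).1

/-- The time derivative of the Steklov averages of a wave. -/
def steklovVel (u : ℝ → Data) (ε t : ℝ) : Jet := ε⁻¹ • ((u (t + ε)).1 - (u t).1)

theorem IsWave.continuous_fst {u : ℝ → Data} (hu : IsWave m u) : Continuous fun s => (u s).1 :=
  _root_.continuous_fst.comp hu.2.1

/-- The time derivative of a time average is a difference quotient of displacements, which has
values in H¹. The averaged wave equation follows from the fundamental theorem of calculus. -/
theorem IsWave.isRegularWave_steklov {u : ℝ → Data} (hu : IsWave m u) (ε : ℝ) :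
    IsRegularWave m (steklov u ε) (steklovVel u ε) (fun t => ε⁻¹ • ((u (t + ε)).2 - (u t).2)) := by
  have hc := hu.continuous_fst
  have smem : ∀ p ∈ H10 univ, ε⁻¹ • p ∈ H10 univ := fun p hp => by
    have := (H10 univ).smul_mem (ε⁻¹ : ℂ) hp
    convert this using 1
    rw [← Complex.ofReal_inv]; exact (Complex.coe_smul _ _).symm
  refine ⟨fun t => smem _ ?_, fun t => smem _ ((H10 univ).sub_mem (hu.1 _) (hu.1 _)), fun t => ?_,
    fun t => ?_, fun t q hq => ?_⟩
  -- Integrating the curve inside the complete subspace shows that its integral stays there.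
  · let γ : ℝ → H10 univ := fun s => ⟨(u s).1, hu.1 s⟩
    have hγ : Continuous γ := hc.subtype_mk _
    have := ((H10 univ).subtypeL.restrictScalars ℝ).intervalIntegral_comp_comm
      (hγ.intervalIntegrable (μ := volume) t (t + ε))
    have e : ∫ s in t..t + ε, (u s).1 = (∫ s in t..t + ε, γ s : H10 univ) := this
    rw [e]
    exact Subtype.mem _
  · have h1 : ∀ x, HasDerivAt (fun y => ∫ s in (0 : ℝ)..y, (u s).1) (u x).1 x := fun x =>
      (hc.integral_hasStrictDerivAt 0 x).hasDerivAt
    have h2 : ∀ y, ∫ s in y..y + ε, (u s).1 =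
        (∫ s in (0 : ℝ)..y + ε, (u s).1) - ∫ s in (0 : ℝ)..y, (u s).1 := fun y =>
      (intervalIntegral.integral_interval_sub_left (hc.intervalIntegrable _ _)
        (hc.intervalIntegrable _ _)).symm
    have h3 : HasDerivAt (fun y => ∫ s in (0 : ℝ)..y + ε, (u s).1) (u (t + ε)).1 t :=
      (h1 (t + ε)).comp_add_const t ε
    have h4 := (h3.sub (h1 t)).const_smul ε⁻¹
    refine h4.congr_of_eventuallyEq (Eventually.of_forall fun y => ?_)
    simp only [steklov, h2, Pi.smul_apply, Pi.sub_apply]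
  · have h1 : HasDerivAt (fun s => (u (s + ε)).1.1) (u (t + ε)).2 t :=
      (hu.2.2.1 (t + ε)).comp_add_const t ε
    exact (h1.sub (hu.2.2.1 t)).const_smul ε⁻¹
  · obtain ⟨B, hB⟩ := exists_elasticForm m
    have hw := hu.hasDerivAt_inner hq
    simp only [← hB] at hw
    have hcB : Continuous fun s => B (u s).1 q := (B.flip q).continuous.comp hc
    have ftc := intervalIntegral.integral_eq_sub_of_hasDerivAt (a := t) (b := t + ε)
      (fun s _ => hw s) (hcB.neg.intervalIntegrable _ _)
    have hint : B (∫ s in t..t + ε, (u s).1) q = ∫ s in t..t + ε, B (u s).1 q :=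
      ((B.flip q).intervalIntegral_comp_comm (hc.intervalIntegrable _ _)).symm
    rw [intervalIntegral.integral_neg, ← hint, ← inner_sub_right] at ftc
    have hs : inner ℂ q.1 (ε⁻¹ • ((u (t + ε)).2 - (u t).2)) =
        ε⁻¹ • (inner ℂ q.1 ((u (t + ε)).2 - (u t).2) : ℂ) :=
      map_smul ((innerSL ℂ q.1).restrictScalars ℝ) _ _
    rw [hs, ← ftc, ← hB, steklov, map_smul, smul_apply, smul_neg]

theorem IsWave.tendsto_steklov {u : ℝ → Data} (hu : IsWave m u) (t : ℝ) :
    Tendsto (fun ε => ((steklov u ε t, (steklovVel u ε t).1) : Data)) (𝓝[>] 0) (𝓝 (u t)) := by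
  have hc := hu.continuous_fst
  have h1 : Tendsto (fun ε => steklov u ε t) (𝓝[>] 0) (𝓝 (u t).1) := by
    have h := (hc.integral_hasStrictDerivAt t t).hasDerivAt.tendsto_slope_zero_right
    simpa [steklov] using h
  have h2 : Tendsto (fun ε => (steklovVel u ε t).1) (𝓝[>] 0) (𝓝 (u t).2) :=
    (hu.2.2.1 t).tendsto_slope_zero_right
  exact h1.prodMk_nhds h2

/-- Each velocity is admissible as a test field in the equation of the other wave, and the terms in
the derivative cancel in pairs. -/
theorem IsRegularWave.energyInner_eq {J V J' V' : ℝ → Jet} {W W' : ℝ → VecL2}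
    (h : IsRegularWave m J V W) (h' : IsRegularWave m J' V' W') (s t : ℝ) :
    energyInner m (J s, (V s).1) (J' s, (V' s).1) =
      energyInner m (J t, (V t).1) (J' t, (V' t).1) := by
  obtain ⟨K, hK⟩ := exists_kForm (bddMeas_const 1)
  obtain ⟨B, hB⟩ := exists_elasticForm m
  have e : ∀ r, energyInner m (J r, (V r).1) (J' r, (V' r).1) =
      K (V r).1 (V' r).1 + B (J r) (J' r) := fun r => by
    rw [ElasticSC.energyInner_eq, hK, hB, elasticForm_eq]
  have hd : ∀ r, HasDerivAt (fun r => K (V r).1 (V' r).1 + B (J r) (J' r)) 0 r := fun r => by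
    have d1 := hasDerivAt_bilin K (h.deriv' r) (h'.deriv' r)
    have d2 := hasDerivAt_bilin B (h.deriv r) (h'.deriv r)
    refine (d1.add d2).congr_deriv ?_
    have e1 := h.eqn r (V' r) (h'.mem' r)
    have e2 := h'.eqn r (V r) (h.mem' r)
    rw [← kForm_one] at e1 e2
    have e3 := congrArg star e2
    rw [star_kForm, star_neg, star_elasticForm] at e3
    rw [← hK, ← hB] at e1 e3
    rw [e1, e3]; ring
  simp only [e]
  exact is_const_of_deriv_eq_zero (fun r => (hd r).differentiableAt) (fun r => (hd r).deriv) s t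

/-- Conservation of energy. -/
theorem IsWave.energyInner_eq {u w : ℝ → Data} (hu : IsWave m u) (hw : IsWave m w) (s t : ℝ) :
    energyInner m (u s) (w s) = energyInner m (u t) (w t) := by
  obtain ⟨B, hB⟩ := exists_energyInner m
  have lim : ∀ r, Tendsto (fun ε => energyInner m (steklov u ε r, (steklovVel u ε r).1)
      (steklov w ε r, (steklovVel w ε r).1)) (𝓝[>] 0) (𝓝 (energyInner m (u r) (w r))) := fun r => by
    simp only [← hB]
    exact ((continuous_bilin B).tendsto _).comp ((hu.tendsto_steklov r).prodMk_nhds (hw.tendsto_steklov r))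
  refine tendsto_nhds_unique (lim s) ((lim t).congr fun ε => ?_)
  exact (hu.isRegularWave_steklov ε).energyInner_eq (hw.isRegularWave_steklov ε) t s

/-- Conserved energy bounds velocity and gradient uniformly in time. The L² norm of the displacement
is not part of the energy and is recovered by integrating the velocity, hence the linear growth in
t. -/
theorem exists_wave_bound (m : Medium) : ∃ C : ℝ, 0 ≤ C ∧ ∀ u, IsWave m u →
    ∀ t, ‖u t‖ ≤ C * (1 + |t|) * ‖u 0‖ := by
  obtain ⟨C, hC, hE⟩ := exists_re_energyInner_le m
  obtain ⟨c, hc, hk⟩ := exists_korn m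
  refine ⟨max (Real.sqrt C) (Real.sqrt (C / c)) + 1, by positivity, fun u hu t => ?_⟩
  set D := max (Real.sqrt C) (Real.sqrt (C / c)) with hD
  have hD0 : 0 ≤ D := (Real.sqrt_nonneg C).trans (le_max_left _ _)
  have en : ∀ t, ‖(u t).2‖ ^ 2 + (elasticForm m (u t).1 (u t).1).re ≤ C * ‖u 0‖ ^ 2 := fun t => by
    rw [← re_energyInner_self, hu.energyInner_eq hu t 0]; exact hE _
  have b2 : ∀ t, ‖(u t).2‖ ≤ Real.sqrt C * ‖u 0‖ := fun t => by
    refine abs_le_of_sq_le_sq' ?_ (by positivity) |>.2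
    rw [mul_pow, Real.sq_sqrt hC]
    linarith [en t, elasticForm_nonneg m (u t).1]
  have b1 : ∀ j, ‖(u t).1.2 j‖ ≤ Real.sqrt (C / c) * ‖u 0‖ := fun j => by
    refine abs_le_of_sq_le_sq' ?_ (by positivity) |>.2
    rw [mul_pow, Real.sq_sqrt (by positivity), div_mul_eq_mul_div, le_div_iff₀ hc]
    have h1 := hk _ (hu.1 t)
    have h2 := Finset.single_le_sum (f := fun i => ‖(u t).1.2 i‖ ^ 2) (fun i _ => sq_nonneg _)
      (Finset.mem_univ j)
    have h3 := mul_le_mul_of_nonneg_left h2 hc.le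
    have h4 := sq_nonneg ‖(u t).2‖
    linarith [en t]
  have b0 : ‖(u t).1.1‖ ≤ ‖u 0‖ + Real.sqrt C * ‖u 0‖ * |t| := by
    have h := convex_univ.norm_image_sub_le_of_norm_hasDerivWithin_le (x := 0) (y := t)
      (fun s _ => (hu.2.2.1 s).hasDerivWithinAt) (fun s _ => b2 s) (mem_univ _) (mem_univ _)
    rw [sub_zero, Real.norm_eq_abs] at h
    have h0 : ‖(u 0).1.1‖ ≤ ‖u 0‖ := (norm_fst_le (u 0).1).trans (norm_fst_le (u 0))
    calc ‖(u t).1.1‖ = ‖(u 0).1.1 + ((u t).1.1 - (u 0).1.1)‖ := by rw [add_sub_cancel]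
      _ ≤ _ := (norm_add_le _ _).trans (add_le_add h0 h)
  have n0 := norm_nonneg (u 0)
  have hs1 : Real.sqrt C * ‖u 0‖ ≤ D * ‖u 0‖ := mul_le_mul_of_nonneg_right (le_max_left _ _) n0
  have hs2 : Real.sqrt (C / c) * ‖u 0‖ ≤ D * ‖u 0‖ :=
    mul_le_mul_of_nonneg_right (le_max_right _ _) n0
  have t0 := abs_nonneg t
  have hDn : 0 ≤ D * ‖u 0‖ := by positivity
  have big : D * ‖u 0‖ ≤ (D + 1) * (1 + |t|) * ‖u 0‖ := by
    have : (D + 1) * (1 + |t|) * ‖u 0‖ = D * ‖u 0‖ + ‖u 0‖ + (D * ‖u 0‖) * |t| + ‖u 0‖ * |t| := by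
      ring
    rw [this]
    have := mul_nonneg hDn t0
    have := mul_nonneg n0 t0
    linarith
  refine norm_prod_le_iff.2 ⟨norm_prod_le_iff.2 ⟨?_, ?_⟩, ?_⟩
  · have : (D + 1) * (1 + |t|) * ‖u 0‖ = D * ‖u 0‖ + ‖u 0‖ + (D * ‖u 0‖) * |t| + ‖u 0‖ * |t| := by
      ring
    rw [this]
    have := mul_le_mul_of_nonneg_right hs1 t0
    have := mul_nonneg n0 t0
    linarith
  · exact (pi_norm_le_iff_of_nonneg (by positivity)).2 fun j => (b1 j).trans (hs2.trans big)
  · exact (b2 t).trans (hs1.trans big)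

theorem IsWave.sub {u w : ℝ → Data} (hu : IsWave m u) (hw : IsWave m w) :
    IsWave m (fun t => u t - w t) := by
  refine isWave_of_inner (fun t => (H10 univ).sub_mem (hu.1 t) (hw.1 t)) (hu.2.1.sub hw.2.1)
    (fun t => (hu.2.2.1 t).sub (hw.2.2.1 t)) fun q hq t => ?_
  have h := (hu.hasDerivAt_inner hq t).fun_sub (hw.hasDerivAt_inner hq t)
  simp only [← inner_sub_right] at h
  refine h.congr_deriv ?_
  rw [Prod.fst_sub, elasticForm_sub_left]; ring

theorem IsWave.shift {u : ℝ → Data} (hu : IsWave m u) (r : ℝ) : IsWave m (fun t => u (t + r)) :=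
  ⟨fun _ => hu.1 _, hu.2.1.comp (continuous_add_const r),
    fun t => (hu.2.2.1 (t + r)).comp_add_const t r,
    fun q hq t => (hu.2.2.2 q hq (t + r)).comp_add_const t r⟩

theorem IsWave.reverse {u : ℝ → Data} (hu : IsWave m u) :
    IsWave m (fun t => timeReversal (u (-t))) := by
  have hc : Continuous fun t => u (-t) := hu.2.1.comp continuous_neg
  refine isWave_of_inner (fun t => hu.1 _)
    ((_root_.continuous_fst.comp hc).prodMk (continuous_snd.comp hc).neg)
    (fun t => hasDerivAt_comp_neg (hu.2.2.1 (-t))) fun q hq t => ?_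
  have h := hasDerivAt_comp_neg' (hu.hasDerivAt_inner hq (-t))
  simp only [← inner_neg_right] at h
  exact h

/-- Apply the growth bound to the difference, with the clock restarted at r. -/
theorem IsWave.eq_of_eq {u w : ℝ → Data} (hu : IsWave m u) (hw : IsWave m w) {r : ℝ}
    (h : u r = w r) : u = w := by
  obtain ⟨C, -, hb⟩ := exists_wave_bound m
  refine funext fun t => ?_
  have := hb _ ((hu.sub hw).shift r) (t - r)
  simp only [sub_add_cancel, zero_add, h, sub_self, norm_zero, mul_zero] at this
  exact sub_eq_zero.1 (norm_le_zero_iff.1 this)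

/-- Existence of finite energy solutions. -/
theorem exists_wave (m : Medium) {h : Data} (hh : h.1 ∈ H10 univ) : ∃ u, IsWave m u ∧ u 0 = h := by
  obtain ⟨C, hC, hb⟩ := exists_wave_bound m
  choose U hU hU0 using fun n : ℕ => exists_wave_approx m hh (Nat.one_div_pos_of_nat (α := ℝ) (n := n))
  have hcau : ∀ t, ∀ n k : ℕ, ‖U n t - U k t‖ ≤
      C * (1 + |t|) * (1 / (n + 1) + 1 / (k + 1)) := fun t n k => by
    refine (hb _ ((hU n).sub (hU k)) t).trans (mul_le_mul_of_nonneg_left ?_ (by positivity))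
    calc ‖U n 0 - U k 0‖ ≤ ‖U n 0 - h‖ + ‖h - U k 0‖ := norm_sub_le_norm_sub_add_norm_sub _ _ _
      _ ≤ _ := add_le_add (hU0 n).le (by rw [norm_sub_rev]; exact (hU0 k).le)
  have hlim0 : Tendsto (fun n : ℕ => (1 : ℝ) / (n + 1)) atTop (𝓝 0) :=
    tendsto_one_div_add_atTop_nhds_zero_nat
  have hex : ∀ t, ∃ l, Tendsto (fun n => U n t) atTop (𝓝 l) := fun t => by
    refine cauchySeq_tendsto_of_complete (cauchySeq_of_le_tendsto_0
      (fun N : ℕ => C * (1 + |t|) * (1 / (N + 1) + 1 / (N + 1))) (fun n k N hn hk => ?_) ?_)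
    · rw [dist_eq_norm]
      refine (hcau t n k).trans ?_
      have : (N : ℝ) ≤ n := Nat.cast_le.2 hn
      have : (N : ℝ) ≤ k := Nat.cast_le.2 hk
      gcongr
    · simpa using (hlim0.add hlim0).const_mul (C * (1 + |t|))
  choose u hu using hex
  have hle : ∀ t, ∀ n : ℕ, ‖U n t - u t‖ ≤ C * (1 + |t|) * (1 / (n + 1)) := fun t n => by
    refine le_of_tendsto_of_tendsto' (tendsto_const_nhds.sub (hu t)).norm ?_ (hcau t n)
    simpa using (hlim0.const_add ((1 : ℝ) / (n + 1))).const_mul (C * (1 + |t|))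
  -- The error grows only linearly in time, so convergence is locally uniform; this allows both
  -- differentiated identities to pass to the limit.
  have hunif : TendstoLocallyUniformlyOn U u atTop univ := by
    rw [Metric.tendstoLocallyUniformlyOn_iff]
    intro ε hε x _
    have h1 : Tendsto (fun n : ℕ => C * (1 + (|x| + 1)) * (1 / ((n : ℝ) + 1))) atTop (𝓝 0) := by
      simpa using hlim0.const_mul (C * (1 + (|x| + 1)))
    refine ⟨Metric.ball x 1, mem_nhdsWithin_of_mem_nhds (Metric.ball_mem_nhds x one_pos), ?_⟩
    filter_upwards [h1.eventually_lt_const hε] with n hn y hy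
    rw [dist_comm, dist_eq_norm]
    refine (hle y n).trans_lt (lt_of_le_of_lt ?_ hn)
    have : |y| ≤ |x| + 1 := by
      have h2 : |y - x| < 1 := by simpa [Real.dist_eq] using hy
      have h3 : |y| ≤ |y - x| + |x| := by simpa using abs_add_le (y - x) x
      linarith
    gcongr
  have hcl : ∀ {X : Type} [NormedAddCommGroup X] [NormedSpace ℝ X] (L : Data →L[ℝ] X),
      TendstoLocallyUniformlyOn (fun n t => L (U n t)) (fun t => L (u t)) atTop univ := fun L =>
    L.uniformContinuous.comp_tendstoLocallyUniformlyOn hunif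
  let L2 : Data →L[ℝ] VecL2 := ContinuousLinearMap.snd ℝ Jet VecL2
  let L1 : Data →L[ℝ] Jet := ContinuousLinearMap.fst ℝ Jet VecL2
  refine ⟨u, isWave_of_inner (fun t => ?_) ?_ (fun t => ?_) fun q hq t => ?_, ?_⟩
  · exact (isClosed_H10 univ).mem_of_tendsto ((L1.continuous.tendsto _).comp (hu t))
      (Eventually.of_forall fun n => (hU n).1 t)
  · exact continuousOn_univ.1
      (hunif.continuousOn (Frequently.of_forall fun n => (hU n).2.1.continuousOn))
  · let L0 : Data →L[ℝ] VecL2 := (ContinuousLinearMap.fst ℝ VecL2 _).comp L1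
    exact hasDerivAt_of_tendstoLocallyUniformlyOn isOpen_univ (hcl L2)
      (Eventually.of_forall fun n x _ => (hU n).2.2.1 x)
      (fun x _ => (L0.continuous.tendsto _).comp (hu x)) (mem_univ t)
  · obtain ⟨B, hB⟩ := exists_elasticForm m
    let Lq : Data →L[ℝ] ℂ := ((innerSL ℂ q.1).restrictScalars ℝ).comp L2
    have hw := fun n x => (hU n).hasDerivAt_inner hq x
    simp only [← hB] at hw ⊢
    exact hasDerivAt_of_tendstoLocallyUniformlyOn isOpen_univ (hcl (-((B.flip q).comp L1)))
      (Eventually.of_forall fun n x _ => hw n x)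
      (fun x _ => (Lq.continuous.tendsto _).comp (hu x)) (mem_univ t)
  · refine tendsto_nhds_unique (hu 0) (tendsto_iff_norm_sub_tendsto_zero.2 ?_)
    exact squeeze_zero (fun _ => norm_nonneg _) (fun n => (hU0 n).le) hlim0

/-! ### The propagator -/

theorem IsWave.propagator_eq {u : ℝ → Data} (hu : IsWave m u) (s : ℝ) :
    propagator m s (u 0) = u s := by
  have H : ∃ w : ℝ → Data, IsWave m w ∧ w 0 = u 0 := ⟨u, hu, rfl⟩
  rw [propagator, dif_pos H, H.choose_spec.1.eq_of_eq hu H.choose_spec.2]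

theorem IsWave.propagator_apply {u : ℝ → Data} (hu : IsWave m u) (r s : ℝ) :
    propagator m s (u r) = u (s + r) := by
  simpa using (hu.shift r).propagator_eq s

theorem propagator_mem {h : Data} (hh : h.1 ∈ H10 univ) (s : ℝ) :
    (propagator m s h).1 ∈ H10 univ := by
  obtain ⟨u, hu, rfl⟩ := exists_wave m hh
  rw [hu.propagator_eq]; exact hu.1 s

theorem propagator_propagator {h : Data} (hh : h.1 ∈ H10 univ) (s t : ℝ) :
    propagator m s (propagator m t h) = propagator m (s + t) h := by
  obtain ⟨u, hu, rfl⟩ := exists_wave m hh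
  rw [hu.propagator_eq, hu.propagator_apply, hu.propagator_eq]

theorem propagator_zero {h : Data} (hh : h.1 ∈ H10 univ) : propagator m 0 h = h := by
  obtain ⟨u, hu, rfl⟩ := exists_wave m hh
  rw [hu.propagator_eq]

theorem propagator_sub {f g : Data} (hf : f.1 ∈ H10 univ) (hg : g.1 ∈ H10 univ) (s : ℝ) :
    propagator m s (f - g) = propagator m s f - propagator m s g := by
  obtain ⟨u, hu, rfl⟩ := exists_wave m hf
  obtain ⟨w, hw, rfl⟩ := exists_wave m hg
  rw [hu.propagator_eq, hw.propagator_eq]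
  exact (hu.sub hw).propagator_eq s

theorem propagator_timeReversal {h : Data} (hh : h.1 ∈ H10 univ) (s : ℝ) :
    propagator m s (timeReversal h) = timeReversal (propagator m (-s) h) := by
  obtain ⟨u, hu, rfl⟩ := exists_wave m hh
  rw [hu.propagator_eq]
  simpa using hu.reverse.propagator_eq s

/-- The propagator is unitary for the energy inner product. -/
theorem energyInner_propagator {f g : Data} (hf : f.1 ∈ H10 univ) (hg : g.1 ∈ H10 univ) (s : ℝ) :
    energyInner m (propagator m s f) (propagator m s g) = energyInner m f g := by
  obtain ⟨u, hu, rfl⟩ := exists_wave m hf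
  obtain ⟨w, hw, rfl⟩ := exists_wave m hg
  rw [hu.propagator_eq, hw.propagator_eq]
  exact hu.energyInner_eq hw s 0

/-! ### The projection -/

/-- The energy product decouples. The velocity part is the L² projection. The displacement part is
Riesz representation for the elastic form, coercive on H¹₀(U) by Korn and Poincaré, the latter
needing U bounded. The jet of h need not lie in H¹. -/
theorem exists_proj (m : Medium) {U : Set E3} (hU : Bornology.IsBounded U) (h : Data) :
    ∃ p ∈ cauchy U, ∀ q ∈ cauchy U, energyInner m (h - p) q = 0 := by
  have hco : IsCoerciveForm (fun p q : H10 U => elasticForm m p q) := by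
    refine ⟨fun x y z => elasticForm_add_left m x y z, fun c x y => elasticForm_smul_left m c x y,
      fun x y => star_elasticForm m x y, ?_, ?_⟩
    · obtain ⟨c, hc, hk⟩ := exists_korn m
      obtain ⟨C, hC, hp⟩ := poincare hU
      -- Poincaré bounds the full norm squared by (C² + 1) times the squared gradient norm, and Korn
      -- bounds c times the latter by the form.
      refine ⟨c / (C ^ 2 + 1), by positivity, fun x => ?_⟩
      have h1 := hk x (H10_mono (subset_univ U) x.2)
      have h2 := norm_sq_jet_le x
      have h3 := pow_le_pow_left₀ (norm_nonneg _) (hp x x.2) 2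
      have h4 := Finset.single_le_sum (f := fun i => ‖x.1.2 i‖ ^ 2) (fun i _ => sq_nonneg _)
        (Finset.mem_univ 0)
      rw [mul_pow] at h3
      set S := ∑ i, ‖x.1.2 i‖ ^ 2
      have h5 : ‖x‖ ^ 2 ≤ (C ^ 2 + 1) * S :=
        h2.trans (by nlinarith [mul_le_mul_of_nonneg_left h4 (sq_nonneg C)])
      rw [div_mul_eq_mul_div, div_le_iff₀ (by positivity)]
      nlinarith [mul_le_mul_of_nonneg_left h5 hc.le, mul_le_mul_of_nonneg_left h1
        (by positivity : 0 ≤ C ^ 2 + 1)]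
    · obtain ⟨C, hC, hb⟩ := exists_re_elasticForm_le m
      exact ⟨C, hC, fun x => hb x⟩
  obtain ⟨B, hB⟩ := exists_elasticForm m
  let l : H10 U →L[ℂ] ℂ :=
    { toFun := fun q => elasticForm m q h.1
      map_add' := fun x y => elasticForm_add_left m x y h.1
      map_smul' := fun c x => elasticForm_smul_left m c x h.1
      cont := by
        simp only [← hB]
        exact (B.flip h.1).continuous.comp continuous_subtype_val }
  obtain ⟨p, hp⟩ := hco.exists_riesz l
  have : CompleteSpace (L2On U) := (isClosed_L2On U).completeSpace_coe
  refine ⟨(p, (L2On U).starProjection h.2), ⟨p.2, Submodule.starProjection_apply_mem _ _⟩,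
    fun q hq => ?_⟩
  rw [energyInner_eq', Prod.snd_sub, Prod.fst_sub, elasticForm_sub_left]
  have h1 : elasticForm m q.1 p = elasticForm m q.1 h.1 := hp ⟨q.1, hq.1⟩
  have h2 := congrArg star h1
  rw [star_elasticForm, star_elasticForm] at h2
  have h3 : inner ℂ q.2 (h.2 - (L2On U).starProjection h.2) = 0 :=
    Submodule.sub_starProjection_mem_orthogonal h.2 q.2 hq.2
  simp only [h3, h2, sub_self, add_zero]

theorem eq_zero_of_energy {U : Set E3} (hU : Bornology.IsBounded U) {p : Data} (hp : p ∈ cauchy U)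
    (h : energyInner m p p = 0) : p = 0 := by
  obtain ⟨c, hc, hk⟩ := exists_korn m
  obtain ⟨C, hC, hP⟩ := poincare hU
  have h1 := re_energyInner_self m p
  rw [h, Complex.zero_re] at h1
  have h2 := hk _ (H10_mono (subset_univ U) hp.1)
  have h3 : 0 ≤ c * ∑ i, ‖p.1.2 i‖ ^ 2 := by positivity
  have h4 := sq_nonneg ‖p.2‖
  have h5 : ‖p.2‖ ^ 2 = 0 := by linarith
  have h6 : ∑ i, ‖p.1.2 i‖ ^ 2 = 0 := by
    have : c * ∑ i, ‖p.1.2 i‖ ^ 2 = 0 := by linarith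
    exact (mul_eq_zero.1 this).resolve_left hc.ne'
  have h7 : ∀ i, p.1.2 i = 0 := fun i => by
    have := (Finset.sum_eq_zero_iff_of_nonneg fun i _ => sq_nonneg ‖p.1.2 i‖).1 h6 i
      (Finset.mem_univ i)
    simpa using this
  have h8 : p.1.1 = 0 := by
    have := hP _ hp.1
    rw [h7 0, norm_zero, mul_zero] at this
    exact norm_le_zero_iff.1 this
  exact Prod.ext (Prod.ext h8 (funext h7)) (by simpa using h5)

theorem proj_spec (m : Medium) {U : Set E3} (hU : Bornology.IsBounded U) (h : Data) :
    proj m U h ∈ cauchy U ∧ ∀ q ∈ cauchy U, energyInner m (h - proj m U h) q = 0 := by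
  rw [proj, dif_pos (exists_proj m hU h)]
  exact (exists_proj m hU h).choose_spec

/-- The difference of two candidates is orthogonal to itself, and the energy is definite on data
supported in a bounded set. -/
theorem proj_eq {U : Set E3} (hU : Bornology.IsBounded U) {h p : Data} (hp : p ∈ cauchy U)
    (hpq : ∀ q ∈ cauchy U, energyInner m (h - p) q = 0) : proj m U h = p := by
  obtain ⟨h1, h2⟩ := proj_spec m hU h
  have hmem := (cauchy U).sub_mem h1 hp
  refine sub_eq_zero.1 (eq_zero_of_energy (m := m) hU hmem ?_)
  have e : proj m U h - p = (h - p) - (h - proj m U h) := by abel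
  nth_rewrite 1 [e]
  rw [energyInner_sub_left, hpq _ hmem, h2 _ hmem, sub_zero]

end ElasticSC

end

/-! ### Travel times, eikonal functions and their smoothing. -/

noncomputable section

namespace ElasticSC

/-! ### Piecewise smooth paths -/

theorem pDist_le (m : Medium) {γ : ℝ → E3} {a b : ℝ} (h : IsPiecewiseSmooth γ a b) :
    pDist m (γ a) (γ b) ≤ pLength m γ a b :=
  iInf_le_of_le γ (iInf_le_of_le a (iInf_le_of_le b (iInf_le _ ⟨h, rfl, rfl⟩)))

theorem le_pDist {m : Medium} {x y : E3} {r : ℝ≥0∞}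
    (h : ∀ (γ : ℝ → E3) (a b : ℝ), IsPiecewiseSmooth γ a b → γ a = x → γ b = y →
      r ≤ pLength m γ a b) : r ≤ pDist m x y :=
  le_iInf fun γ => le_iInf fun a => le_iInf fun b => le_iInf fun H => h γ a b H.1 H.2.1 H.2.2

theorem pDist_self (m : Medium) (x : E3) : pDist m x x = 0 := by
  have h : IsPiecewiseSmooth (fun _ => x) 0 0 :=
    ⟨le_rfl, continuousOn_const, 0, fun _ => 0, monotone_const, rfl, rfl, by simp⟩
  have := pDist_le m h
  simpa [pLength] using this

/-- The breakpoints are clamped to [c, d]; pieces outside collapse to points, where smoothness is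
trivial. -/
theorem IsPiecewiseSmooth.restrict {γ : ℝ → E3} {a b c d : ℝ} (h : IsPiecewiseSmooth γ a b)
    (hac : a ≤ c) (hcd : c ≤ d) (hdb : d ≤ b) : IsPiecewiseSmooth γ c d := by
  obtain ⟨-, hc, n, t, ht, h0, hn, hs⟩ := h
  refine ⟨hcd, hc.mono (Icc_subset_Icc hac hdb), n, fun i => max c (min d (t i)),
    fun i j hij => max_le_max le_rfl (min_le_min le_rfl (ht hij)), ?_, ?_, fun i hi => ?_⟩
  · simp [h0, min_eq_right (hac.trans hcd), hac]
  · simp [hn, min_eq_left hdb, hcd]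
  · beta_reduce
    rcases lt_or_ge (t (i + 1)) c with h1 | h1
    · have e1 : max c (min d (t (i + 1))) = c := max_eq_left ((min_le_right _ _).trans h1.le)
      have e2 : max c (min d (t i)) = c :=
        max_eq_left ((min_le_right _ _).trans ((ht (Nat.le_succ i)).trans h1.le))
      rw [e1, e2, Icc_self]
      intro s hs
      rw [mem_singleton_iff.1 hs]
      exact contDiffWithinAt_singleton
    · rcases lt_or_ge d (t i) with h2 | h2
      · have e1 : max c (min d (t i)) = d := by rw [min_eq_left h2.le, max_eq_right hcd]
        have e2 : max c (min d (t (i + 1))) = d := by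
          rw [min_eq_left (h2.le.trans (ht (Nat.le_succ i))), max_eq_right hcd]
        rw [e1, e2, Icc_self]
        intro s hs
        rw [mem_singleton_iff.1 hs]
        exact contDiffWithinAt_singleton
      · refine (hs i hi).mono (Icc_subset_Icc ?_ ?_)
        · rw [min_eq_right h2]; exact le_max_right _ _
        · exact max_le h1 (min_le_right _ _)

theorem pLength_mono (m : Medium) (γ : ℝ → E3) {a b c d : ℝ} (hac : a ≤ c) (hdb : d ≤ b) :
    pLength m γ c d ≤ pLength m γ a b :=
  lintegral_mono_set (Icc_subset_Icc hac hdb)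

/-- Otherwise the interior and the exterior of U would separate the connected image of the path. -/
theorem exists_mem_frontier {γ : ℝ → E3} {a b : ℝ} (hab : a ≤ b) (hc : ContinuousOn γ (Icc a b))
    {U : Set E3} (h : γ a ∈ U ∧ γ b ∉ U ∨ γ a ∉ U ∧ γ b ∈ U) :
    ∃ s ∈ Icc a b, γ s ∈ frontier U := by
  have ha : γ a ∈ γ '' Icc a b := mem_image_of_mem γ (left_mem_Icc.2 hab)
  have hb : γ b ∈ γ '' Icc a b := mem_image_of_mem γ (right_mem_Icc.2 hab)
  have hp : IsPreconnected (γ '' Icc a b) := isPreconnected_Icc.image γ hc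
  have hne : (γ '' Icc a b ∩ frontier U).Nonempty := by
    rw [inter_nonempty_iff_exists_left]
    by_contra! hcon
    have hin : ∀ x ∈ γ '' Icc a b, x ∈ U → x ∈ interior U := fun x hx hU => by
      by_contra hi
      exact hcon x hx ⟨subset_closure hU, hi⟩
    have hout : ∀ x ∈ γ '' Icc a b, x ∉ U → x ∈ (closure U)ᶜ := fun x hx hU hcl =>
      hcon x hx ⟨hcl, fun hi => hU (interior_subset hi)⟩
    have hno := hp _ _ isOpen_interior isClosed_closure.isOpen_compl fun x hx => by
      by_cases hU : x ∈ U
      exacts [Or.inl (hin x hx hU), Or.inr (hout x hx hU)]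
    have hcontra : (γ '' Icc a b ∩ (interior U ∩ (closure U)ᶜ)).Nonempty := by
      rcases h with h | h
      · exact hno ⟨_, ha, hin _ ha h.1⟩ ⟨_, hb, hout _ hb h.2⟩
      · exact hno ⟨_, hb, hin _ hb h.2⟩ ⟨_, ha, hout _ ha h.1⟩
    obtain ⟨x, -, h1, h2⟩ := hcontra
    exact h2 (interior_subset_closure h1)
  obtain ⟨_, ⟨s, hs, rfl⟩, hf⟩ := hne
  exact ⟨s, hs, hf⟩

/-- Paths that leave a set meet its boundary. -/
theorem pDistSets_frontier_le (m : Medium) {U : Set E3} {x y : E3} (hx : x ∈ U) (hy : y ∉ U) :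
    pDistSets m {x} (frontier U) ≤ pDist m x y := by
  refine le_pDist fun γ a b h ha hb => ?_
  obtain ⟨s, hs, hf⟩ := exists_mem_frontier h.1 h.2.1 (U := U) (Or.inl ⟨ha ▸ hx, hb ▸ hy⟩)
  have h1 := pDist_le m (h.restrict le_rfl hs.1 hs.2)
  rw [ha] at h1
  exact (iInf₂_le_of_le x (mem_singleton x) (iInf₂_le_of_le (γ s) hf h1)).trans
    (pLength_mono m γ le_rfl hs.2)

/-- Paths that enter a set meet its boundary. -/
theorem pDistSets_frontier_le' (m : Medium) {U B : Set E3} {x y : E3} (hx : x ∉ U) (hy : y ∈ U)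
    (hyB : y ∈ B) : pDistSets m (frontier U) B ≤ pDist m x y := by
  refine le_pDist fun γ a b h ha hb => ?_
  obtain ⟨s, hs, hf⟩ := exists_mem_frontier h.1 h.2.1 (U := U) (Or.inr ⟨ha ▸ hx, hb ▸ hy⟩)
  have h1 := pDist_le m (h.restrict hs.1 hs.2 le_rfl)
  rw [hb] at h1
  exact (iInf₂_le_of_le (γ s) hf (iInf₂_le_of_le y hyB h1)).trans (pLength_mono m γ hs.1 le_rfl)

/-- The path that runs along the segment from `x` to `γ a` before `γ`. -/
def prepend (γ : ℝ → E3) (a : ℝ) (x : E3) (s : ℝ) : E3 :=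
  if s < a then x + (s - (a - 1)) • (γ a - x) else γ s

theorem prepend_of_le {γ : ℝ → E3} {a s : ℝ} {x : E3} (h : s ≤ a) :
    prepend γ a x s = x + (s - (a - 1)) • (γ a - x) := by
  rcases h.lt_or_eq with h | rfl
  · exact if_pos h
  · simp [prepend]

theorem prepend_of_ge {γ : ℝ → E3} {a s : ℝ} {x : E3} (h : a ≤ s) : prepend γ a x s = γ s :=
  if_neg h.not_gt

theorem contDiff_segment (a : ℝ) (x v : E3) :
    ContDiff ℝ ∞ (fun s : ℝ => x + (s - (a - 1)) • v) := by fun_prop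

theorem IsPiecewiseSmooth.prepend {γ : ℝ → E3} {a b : ℝ} (h : IsPiecewiseSmooth γ a b) (x : E3) :
    IsPiecewiseSmooth (prepend γ a x) (a - 1) b := by
  obtain ⟨hab, hc, n, t, ht, h0, hn, hs⟩ := h
  have c1 : ContDiffOn ℝ ∞ (ElasticSC.prepend γ a x) (Icc (a - 1) a) :=
    (contDiff_segment a x (γ a - x)).contDiffOn.congr fun s hs => prepend_of_le hs.2
  have hun : Icc (a - 1) b = Icc (a - 1) a ∪ Icc a b :=
    (Icc_union_Icc_eq_Icc (by linarith) hab).symm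
  -- The new breakpoint a − 1 comes first and shifts the old ones by one index.
  refine ⟨by linarith, ?_, n + 1, fun i => Nat.casesOn i (a - 1) t, ?_, rfl, hn, fun i hi => ?_⟩
  · rw [hun]
    exact c1.continuousOn.union_of_isClosed
      (hc.congr fun s hs => prepend_of_ge hs.1) isClosed_Icc isClosed_Icc
  · refine monotone_nat_of_le_succ fun i => ?_
    cases i with
    | zero =>
      change a - 1 ≤ t 0
      linarith
    | succ k => exact ht (Nat.le_succ k)
  · cases i with
    | zero =>
      change ContDiffOn ℝ ∞ _ (Icc (a - 1) (t 0))
      rwa [h0]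
    | succ k =>
      refine (hs k (by omega)).congr fun s hs => prepend_of_ge ?_
      rw [← h0]; exact (ht (Nat.zero_le k)).trans hs.1

theorem pLength_prepend_le (m : Medium) {γ : ℝ → E3} {a b κ : ℝ} {x : E3} (hab : a ≤ b)
    (hκ : 0 < κ) (hseg : ∀ p ∈ segment ℝ x (γ a), κ ≤ m.cP p) :
    pLength m (prepend γ a x) (a - 1) b ≤
      ENNReal.ofReal (‖γ a - x‖ / κ) + pLength m γ a b := by
  have hun : Icc (a - 1) b = Icc (a - 1) a ∪ Icc a b :=
    (Icc_union_Icc_eq_Icc (by linarith) hab).symm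
  -- At the junction the path may fail to be differentiable; one instant is negligible.
  have hne : ∀ᵐ s : ℝ, s ≠ a := by simp [ae_iff]
  rw [pLength, hun]
  refine (lintegral_union_le _ _ _).trans (add_le_add ?_ ?_)
  · calc _ ≤ ∫⁻ s in Icc (a - 1) a, ENNReal.ofReal (‖γ a - x‖ / κ) := by
          refine setLIntegral_mono_ae measurable_const.aemeasurable ?_
          filter_upwards [hne] with s hsa hs
          have hlt : s < a := lt_of_le_of_ne hs.2 hsa
          have hd : deriv (prepend γ a x) s = γ a - x := by
            have h1 : HasDerivAt (fun s : ℝ => x + (s - (a - 1)) • (γ a - x)) (γ a - x) s := by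
              simpa using (((hasDerivAt_id s).sub_const (a - 1)).smul_const (γ a - x)).const_add x
            refine (h1.congr_of_eventuallyEq ?_).deriv
            filter_upwards [Iio_mem_nhds hlt] with r hr using prepend_of_le (le_of_lt hr)
          rw [hd, prepend_of_le hs.2]
          refine ENNReal.ofReal_le_ofReal (div_le_div_of_nonneg_left (norm_nonneg _) hκ
            (hseg _ ?_))
          rw [segment_eq_image']
          exact ⟨s - (a - 1), ⟨by linarith [hs.1], by linarith [hs.2]⟩, rfl⟩
      _ = _ := by simp
  · refine setLIntegral_mono_ae' measurableSet_Icc ?_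
    filter_upwards [hne] with s hsa hs
    have hlt : a < s := lt_of_le_of_ne hs.1 (Ne.symm hsa)
    have he : prepend γ a x =ᶠ[𝓝 s] γ := by
      filter_upwards [Ioi_mem_nhds hlt] with r hr using prepend_of_ge (le_of_lt hr)
    rw [he.deriv_eq, he.eq_of_nhds]

/-- A triangle inequality in which the first leg is a straight segment, traversed at speed at least
κ. This suffices for Lipschitz bounds, so general paths are never concatenated. -/
theorem pDist_le_add (m : Medium) {x y : E3} (z : E3) {κ : ℝ} (hκ : 0 < κ)
    (hseg : ∀ p ∈ segment ℝ x y, κ ≤ m.cP p) :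
    pDist m x z ≤ ENNReal.ofReal (‖y - x‖ / κ) + pDist m y z := by
  rw [← tsub_le_iff_left]
  refine le_pDist fun γ a b h ha hb => ?_
  rw [tsub_le_iff_left]
  have h1 := pDist_le m (h.prepend x)
  rw [prepend_of_ge h.1, hb, prepend_of_le (by linarith)] at h1
  simp only [sub_self, zero_smul, add_zero] at h1
  subst ha
  exact h1.trans (pLength_prepend_le m h.1 hκ hseg)

/-! ### Truncated distance functions -/

/-- Functions whose variation over segments is bounded by the travel time of `P`-waves. -/
def IsEikonal (m : Medium) (e : E3 → ℝ) : Prop :=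
  ∀ (x y : E3) (κ : ℝ), 0 < κ → (∀ p ∈ segment ℝ x y, κ ≤ m.cP p) → |e x - e y| ≤ ‖x - y‖ / κ

theorem pDistSets_singleton (m : Medium) (x : E3) (A : Set E3) :
    pDistSets m {x} A = ⨅ y ∈ A, pDist m x y := by
  simp [pDistSets]

theorem pDistSets_le_add (m : Medium) (A : Set E3) {x y : E3} {κ : ℝ} (hκ : 0 < κ)
    (hseg : ∀ p ∈ segment ℝ x y, κ ≤ m.cP p) :
    pDistSets m {x} A ≤ ENNReal.ofReal (‖y - x‖ / κ) + pDistSets m {y} A := by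
  rw [pDistSets_singleton, pDistSets_singleton, ← tsub_le_iff_left]
  refine le_iInf₂ fun z hz => ?_
  rw [tsub_le_iff_left]
  exact (iInf₂_le z hz).trans (pDist_le_add m z hκ hseg)

theorem pDistSets_eq_zero (m : Medium) {A : Set E3} {x : E3} (hx : x ∈ A) :
    pDistSets m {x} A = 0 := by
  rw [pDistSets_singleton]
  exact le_antisymm ((iInf₂_le x hx).trans (pDist_self m x).le) zero_le

/-- The segment to a point of A has finite travel time because c_P is bounded below; hence `toReal`
loses nothing. -/
theorem pDistSets_ne_top (m : Medium) {A : Set E3} (hA : A.Nonempty) (x : E3) :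
    pDistSets m {x} A ≠ ⊤ := by
  obtain ⟨y, hy⟩ := hA
  obtain ⟨κ, hκ, h⟩ := m.speed_pos
  refine ne_top_of_le_ne_top ?_ (pDistSets_le_add m A hκ (x := x) (y := y) fun p _ => h p)
  rw [pDistSets_eq_zero m hy, add_zero]
  exact ENNReal.ofReal_ne_top

/-- The `P`-distance to `A`, truncated at `T`. -/
def truncDist (m : Medium) (A : Set E3) (T : ℝ) (x : E3) : ℝ := min (pDistSets m {x} A).toReal T

/-- Truncation preserves the estimate and makes the function bounded, so that exponential weights
built from it are bounded too. -/
theorem isEikonal_truncDist (m : Medium) {A : Set E3} (hA : A.Nonempty) (T : ℝ) :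
    IsEikonal m (truncDist m A T) := by
  have key : ∀ (x y : E3) (κ : ℝ), 0 < κ → (∀ p ∈ segment ℝ x y, κ ≤ m.cP p) →
      (pDistSets m {x} A).toReal ≤ ‖y - x‖ / κ + (pDistSets m {y} A).toReal := by
    intro x y κ hκ hseg
    have h := pDistSets_le_add m A hκ hseg
    have := ENNReal.toReal_mono
      (ENNReal.add_ne_top.2 ⟨ENNReal.ofReal_ne_top, pDistSets_ne_top m hA y⟩) h
    rwa [ENNReal.toReal_add ENNReal.ofReal_ne_top (pDistSets_ne_top m hA y),
      ENNReal.toReal_ofReal (by positivity)] at this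
  intro x y κ hκ hseg
  have h1 := key x y κ hκ hseg
  have h2 := key y x κ hκ (by rwa [segment_symm])
  rw [norm_sub_rev y x] at h1
  refine (abs_min_sub_min_le_max _ _ _ _).trans ?_
  rw [sub_self, abs_zero]
  refine max_le (abs_le.2 ⟨by linarith, by linarith⟩) (by positivity)

theorem IsEikonal.exists_lipschitz {m : Medium} {e : E3 → ℝ} (he : IsEikonal m e) :
    ∃ C : ℝ, 0 < C ∧ ∀ x y, |e x - e y| ≤ C * ‖x - y‖ := by
  obtain ⟨κ, hκ, h⟩ := m.speed_pos
  refine ⟨κ⁻¹, by positivity, fun x y => (he x y κ hκ fun p _ => h p).trans (le_of_eq ?_)⟩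
  rw [div_eq_inv_mul]

theorem IsEikonal.continuous {m : Medium} {e : E3 → ℝ} (he : IsEikonal m e) : Continuous e := by
  obtain ⟨C, hC, h⟩ := he.exists_lipschitz
  refine (LipschitzWith.of_dist_le_mul (K := ⟨C, hC.le⟩) fun x y => ?_).continuous
  rw [Real.dist_eq, dist_eq_norm]
  exact h x y

/-! ### Mollification -/

/-- The mollification of `e` by a bump function. -/
def mollify (φ : ContDiffBump (0 : E3)) (e : E3 → ℝ) (x : E3) : ℝ :=
  ∫ t, φ.normed volume t * e (x - t)

theorem integrable_mollify (φ : ContDiffBump (0 : E3)) {e : E3 → ℝ} (he : Continuous e) (x : E3) :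
    Integrable (fun t => φ.normed volume t * e (x - t)) := by
  refine Continuous.integrable_of_hasCompactSupport
    (φ.continuous_normed.mul (he.comp (continuous_const.sub continuous_id))) ?_
  exact φ.hasCompactSupport_normed.mul_right

theorem contDiff_mollify (φ : ContDiffBump (0 : E3)) {e : E3 → ℝ} (he : Continuous e) :
    ContDiff ℝ ∞ (mollify φ e) :=
  φ.hasCompactSupport_normed.contDiff_convolution_left (ContinuousLinearMap.lsmul ℝ ℝ)
    φ.contDiff_normed he.locallyIntegrable

/-- Mollification averages against a probability density on a small ball, so pointwise bounds
survive. Comparison with constants gives sup bounds and convergence; comparison of translates gives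
gradient bounds. -/
theorem abs_mollify_sub_le (φ : ContDiffBump (0 : E3)) {e f : E3 → ℝ} (he : Continuous e)
    (hf : Continuous f) {x y : E3} {C : ℝ}
    (h : ∀ t ∈ Metric.ball (0 : E3) φ.rOut, |e (x - t) - f (y - t)| ≤ C) :
    |mollify φ e x - mollify φ f y| ≤ C := by
  rw [mollify, mollify, ← integral_sub (integrable_mollify φ he x) (integrable_mollify φ hf y)]
  calc _ ≤ ∫ t, φ.normed volume t * C := by
        rw [← Real.norm_eq_abs]
        refine norm_integral_le_of_norm_le (φ.integrable_normed.mul_const C)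
          (Eventually.of_forall fun t => ?_)
        rw [← mul_sub, norm_mul, Real.norm_of_nonneg (φ.nonneg_normed t), Real.norm_eq_abs]
        by_cases ht : t ∈ Metric.ball (0 : E3) φ.rOut
        · exact mul_le_mul_of_nonneg_left (h t ht) (φ.nonneg_normed t)
        · rw [← φ.support_normed_eq (μ := volume), Function.notMem_support] at ht
          rw [ht]; simp
    _ = C := by rw [integral_mul_const, φ.integral_normed, one_mul]

theorem mollify_const (φ : ContDiffBump (0 : E3)) (c : ℝ) (x : E3) :
    mollify φ (fun _ => c) x = c := by
  rw [mollify, integral_mul_const, φ.integral_normed, one_mul]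

/-- Smooth approximation of eikonal functions. -/
theorem IsEikonal.exists_smooth_approx {m : Medium} {e : E3 → ℝ} (he : IsEikonal m e) {T : ℝ}
    (hT : ∀ x, |e x| ≤ T) :
    ∃ E : ℕ → E3 → ℝ, (∀ n, ContDiff ℝ ∞ (E n)) ∧ (∀ n x, |E n x| ≤ T) ∧
      (∃ N, ∀ n x, ‖fderiv ℝ (E n) x‖ ≤ N) ∧ (∀ x, Tendsto (fun n => E n x) atTop (𝓝 (e x))) ∧
      ∀ᵐ x, ∀ η > 0, ∀ᶠ n in atTop, m.cP x * ‖fderiv ℝ (E n) x‖ ≤ 1 + η := by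
  have hc := he.continuous
  obtain ⟨C, hC, hlip⟩ := he.exists_lipschitz
  let φ : ℕ → ContDiffBump (0 : E3) := fun n =>
    ⟨1 / (n + 1) / 2, 1 / (n + 1), by positivity, half_lt_self (by positivity)⟩
  have hr : Tendsto (fun n => (φ n).rOut) atTop (𝓝 0) := tendsto_one_div_add_atTop_nhds_zero_nat
  refine ⟨fun n => mollify (φ n) e, fun n => contDiff_mollify _ hc, fun n x => ?_, ⟨C, fun n x => ?_⟩,
    fun x => ?_, ?_⟩
  · have := abs_mollify_sub_le (φ n) hc (continuous_const (y := (0 : ℝ))) (x := x) (y := x)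
      fun t _ => by simpa using hT (x - t)
    rwa [mollify_const, sub_zero] at this
  · refine norm_fderiv_le_of_lip' ℝ hC.le (Eventually.of_forall fun y => ?_)
    rw [Real.norm_eq_abs]
    refine abs_mollify_sub_le (φ n) hc hc fun t _ => ?_
    simpa using hlip (y - t) (x - t)
  · rw [tendsto_iff_norm_sub_tendsto_zero]
    refine squeeze_zero (fun _ => norm_nonneg _) (fun n => ?_)
      (by simpa using hr.const_mul C)
    rw [Real.norm_eq_abs, ← mollify_const (φ n) (e x) x]
    refine abs_mollify_sub_le (φ n) hc continuous_const fun t ht => (hlip _ _).trans ?_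
    refine mul_le_mul_of_nonneg_left ?_ hC.le
    simpa using (mem_ball_zero_iff.1 ht).le
  · obtain ⟨Γ, hΓ, hΓ0, hl, hμ⟩ := m.interfaces
    have hae : ∀ᵐ x, x ∉ Γ := measure_eq_zero_iff_ae_notMem.1 hΓ0
    filter_upwards [hae] with x hx η hη
    have hnx : Γᶜ ∈ 𝓝 x := hΓ.isOpen_compl.mem_nhds hx
    have hcP : ContinuousAt m.cP x :=
      Real.continuous_sqrt.continuousAt.comp
        ((hl.continuousAt hnx).add ((hμ.continuousAt hnx).const_mul 2))
    obtain ⟨κ0, hκ0, hκ0'⟩ := m.speed_pos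
    have hpos : 0 < m.cP x := hκ0.trans_le (hκ0' x)
    -- Slightly below c_P(x), so by continuity at x ∉ Γ it bounds c_P from below on a ball of radius
    -- r. Mollifying at scale below r/2 keeps the shifted segments in that ball, and the gradient is
    -- at most 1/κ.
    set κ := m.cP x / (1 + η)
    have hκ : 0 < κ := by positivity
    have hκlt : κ < m.cP x := div_lt_self hpos (by linarith)
    obtain ⟨r, hr0, hball⟩ := Metric.eventually_nhds_iff_ball.1 (hcP.eventually (lt_mem_nhds hκlt))
    filter_upwards [hr.eventually_lt_const (half_pos hr0)] with n hn
    have hb : ‖fderiv ℝ (mollify (φ n) e) x‖ ≤ κ⁻¹ := by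
      refine norm_fderiv_le_of_lip' ℝ (by positivity) ?_
      filter_upwards [Metric.ball_mem_nhds x (half_pos hr0)] with y hy
      rw [Real.norm_eq_abs]
      refine abs_mollify_sub_le (φ n) hc hc fun t ht => ?_
      have ht' : ‖t‖ < r / 2 := (mem_ball_zero_iff.1 ht).trans hn
      have h1 : y - t ∈ Metric.ball x r := by
        rw [mem_ball_iff_norm] at hy ⊢
        calc ‖y - t - x‖ = ‖(y - x) - t‖ := by congr 1; abel
          _ ≤ ‖y - x‖ + ‖t‖ := norm_sub_le _ _
          _ < r := by linarith
      have h2 : x - t ∈ Metric.ball x r := by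
        rw [mem_ball_iff_norm]
        simp only [sub_sub_cancel_left, norm_neg]
        linarith
      have := he (y - t) (x - t) κ hκ fun p hp =>
        (hball p ((convex_ball x r).segment_subset h1 h2 hp)).le
      simpa [div_eq_inv_mul] using this
    calc m.cP x * ‖fderiv ℝ (mollify (φ n) e) x‖ ≤ m.cP x * κ⁻¹ :=
          mul_le_mul_of_nonneg_left hb hpos.le
      _ = 1 + η := by simp only [κ]; field_simp

end ElasticSC

end

/-! ### Finite speed of propagation by weighted energies. -/

noncomputable section

namespace ElasticSC

/-! ### Weighted energies -/

variable {m : Medium}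

/-- The energy density of Cauchy data. -/
def energyDensity (m : Medium) (h : Data) (x : E3) : ℝ :=
  ‖h.2 x‖ ^ 2 +
    (dens (m.lam x) (m.mu x) (fun i j => h.1.2 i x j) (fun i j => h.1.2 i x j)).re

/-- The energy of Cauchy data with weight `w`. -/
def wEnergy (m : Medium) (w : E3 → ℝ) (h : Data) : ℝ := ∫ x, w x * energyDensity m h x

theorem norm_sq_C3 (a : C3) : ((‖a‖ ^ 2 : ℝ) : ℂ) = ∑ i, a i * star (a i) := by
  rw [EuclideanSpace.norm_sq_eq]
  push_cast
  refine Finset.sum_congr rfl fun i _ => ?_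
  rw [Complex.star_def, Complex.mul_conj, Complex.normSq_eq_norm_sq]
  push_cast
  rfl

theorem norm_sq_le_energyDensity (m : Medium) (h : Data) (x : E3) :
    ‖h.2 x‖ ^ 2 ≤ energyDensity m h x := by
  obtain ⟨c, hc, hm⟩ := m.convex
  exact le_add_of_nonneg_right (dens_self_nonneg (hm x).1 (hm x).2 hc.le _)

theorem energyDensity_nonneg (m : Medium) (h : Data) (x : E3) : 0 ≤ energyDensity m h x :=
  (sq_nonneg _).trans (norm_sq_le_energyDensity m h x)

theorem dens_mul (w l μ : ℝ) (A B : Fin 3 → Fin 3 → ℂ) :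
    dens (w * l) (w * μ) A B = w * dens l μ A B := by
  simp only [dens]; push_cast; ring

theorem integrable_norm_sq (f : VecL2) : Integrable (fun x => ‖f x‖ ^ 2) :=
  (integrable_norm_mul_norm f f).congr (Eventually.of_forall fun _ => (sq _).symm)

theorem integrable_energyDensity (m : Medium) (h : Data) : Integrable (energyDensity m h) :=
  (integrable_norm_sq h.2).add (integrable_dens m.bddMeas_lam m.bddMeas_mu _ _).re

theorem BddMeas.integrable_mul {w f : E3 → ℝ} (hw : BddMeas w) (hf : Integrable f) :
    Integrable (fun x => w x * f x) := by
  obtain ⟨hm, M, hM⟩ := hw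
  exact hf.bdd_mul hm.aestronglyMeasurable (Eventually.of_forall hM)

theorem exists_wEnergy_form (m : Medium) {w : E3 → ℝ} (hw : BddMeas w) :
    ∃ (K : VecL2 →L[ℝ] VecL2 →L[ℝ] ℂ) (B : Jet →L[ℝ] Jet →L[ℝ] ℂ),
      (∀ f g, K f g = kForm w f g) ∧
      (∀ p q, B p q = wForm (fun x => w x * m.lam x) (fun x => w x * m.mu x) p.2 q.2) ∧
      ∀ h : Data, wEnergy m w h = (K h.2 h.2 + B h.1 h.1).re := by
  obtain ⟨K, hK⟩ := exists_kForm hw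
  obtain ⟨B, hB⟩ := exists_wForm (hw.mul m.bddMeas_lam) (hw.mul m.bddMeas_mu)
  obtain ⟨T, hT⟩ := exists_bilin_snd (X := VecL2) B
  refine ⟨K, T, hK, fun p q => (hT p q).trans (hB _ _), fun h => ?_⟩
  have i1 : Integrable (fun x => w x * ‖h.2 x‖ ^ 2) := hw.integrable_mul (integrable_norm_sq _)
  have i2 := hw.integrable_mul
    (integrable_dens m.bddMeas_lam m.bddMeas_mu h.1.2 h.1.2).re
  rw [Complex.add_re, hK, hT, hB, re_wForm (hw.mul m.bddMeas_lam) (hw.mul m.bddMeas_mu), kForm]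
  have e1 : ∀ x, (w x : ℂ) * ∑ i, h.2 x i * star (h.2 x i) = ((w x * ‖h.2 x‖ ^ 2 : ℝ) : ℂ) :=
    fun x => by rw [← norm_sq_C3]; push_cast; rfl
  simp only [e1]
  rw [integral_complex_ofReal, Complex.ofReal_re, ← integral_add i1]
  · refine integral_congr_ae (Eventually.of_forall fun x => ?_)
    simp only [energyDensity, dens_mul, Complex.re_ofReal_mul, mul_add]
  · exact (integrable_dens (hw.mul m.bddMeas_lam) (hw.mul m.bddMeas_mu) _ _).re

theorem continuous_wEnergy (m : Medium) {w : E3 → ℝ} (hw : BddMeas w) :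
    Continuous (wEnergy m w) := by
  obtain ⟨K, B, -, -, h⟩ := exists_wEnergy_form m hw
  have e : wEnergy m w = fun h : Data => (K h.2 h.2 + B h.1 h.1).re := funext h
  rw [e]
  exact Complex.continuous_re.comp
    (((continuous_bilin K).comp (continuous_snd.prodMk continuous_snd)).add
      ((continuous_bilin B).comp (continuous_fst.prodMk continuous_fst)))

theorem tendsto_wEnergy (m : Medium) {w : ℕ → E3 → ℝ} {w' : E3 → ℝ} {M : ℝ}
    (hw : ∀ n, BddMeas (w n)) (hM : ∀ n x, |w n x| ≤ M)
    (hlim : ∀ᵐ x, Tendsto (fun n => w n x) atTop (𝓝 (w' x))) (h : Data) :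
    Tendsto (fun n => wEnergy m (w n) h) atTop (𝓝 (wEnergy m w' h)) := by
  refine tendsto_integral_of_dominated_convergence (fun x => M * energyDensity m h x)
    (fun n => ((hw n).integrable_mul (integrable_energyDensity m h)).aestronglyMeasurable)
    ((integrable_energyDensity m h).const_mul M) (fun n => Eventually.of_forall fun x => ?_) ?_
  · rw [norm_mul, Real.norm_eq_abs, Real.norm_of_nonneg (energyDensity_nonneg m h x)]
    exact mul_le_mul_of_nonneg_right (hM n x) (energyDensity_nonneg m h x)
  · filter_upwards [hlim] with x hx using hx.mul_const _

theorem wEnergy_mono (m : Medium) {w w' : E3 → ℝ} (hw : BddMeas w) (hw' : BddMeas w')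
    (hle : ∀ x, w x ≤ w' x) (h : Data) : wEnergy m w h ≤ wEnergy m w' h :=
  integral_mono (hw.integrable_mul (integrable_energyDensity m h))
    (hw'.integrable_mul (integrable_energyDensity m h))
    fun x => mul_le_mul_of_nonneg_right (hle x) (energyDensity_nonneg m h x)

theorem dens_smul_add_right (l μ w : ℝ) (A B C : Fin 3 → Fin 3 → ℂ) :
    dens l μ A (fun i j => w * B i j + C i j) = w * dens l μ A B + dens l μ A C := by
  have h2 : (starRingEnd ℂ) 2 = 2 := Complex.conj_ofReal 2
  simp only [dens, Fin.sum_univ_three, star_add, star_mul', star_div₀, Complex.star_def, h2,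
    Complex.conj_ofReal]
  ring

/-! ### The local energy inequality -/

/-- Test the equation with w times the velocity. The bulk terms cancel and leave the flux through
∇w, which is at most c_P|∇w| times the energy density. -/
theorem IsRegularWave.exists_deriv_wEnergy_le {J V : ℝ → Jet} {W : ℝ → VecL2}
    (h : IsRegularWave m J V W) {w χ : E3 → ℝ} (hw : ContDiff ℝ ∞ w) {M N : ℝ}
    (hM : ∀ x, |w x| ≤ M) (hN : ∀ x, ‖fderiv ℝ w x‖ ≤ N) (hχ : BddMeas χ)
    (hle : ∀ x, m.cP x * ‖fderiv ℝ w x‖ ≤ χ x) (t : ℝ) :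
    ∃ D, HasDerivAt (fun s => wEnergy m w (J s, (V s).1)) D t ∧
      D ≤ wEnergy m χ (J t, (V t).1) := by
  have hwb : BddMeas w := ⟨hw.continuous.measurable, M, hM⟩
  obtain ⟨K, B, hK, hB, hKB⟩ := exists_wEnergy_form m hwb
  obtain ⟨c, hc, hm⟩ := m.convex
  obtain ⟨q, hq, hq1, hq2⟩ := exists_smul_mem_H10 hw hM hN (h.mem' t)
  set v := (V t).1
  -- The gradient of w as a vector, so that the product-rule term is the rank one matrix n ⊗ v.
  let n : E3 → E3 := fun x => (InnerProductSpace.toDual ℝ E3).symm (fderiv ℝ w x)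
  have hn : ∀ x i, n x i = fderiv ℝ w x (dir i) := fun x i => by
    have : inner ℝ (n x) (dir i) = fderiv ℝ w x (dir i) :=
      InnerProductSpace.toDual_symm_apply
    rw [← this]
    simp [PiLp.inner_apply]
  have hnn : ∀ x, ‖n x‖ = ‖fderiv ℝ w x‖ := fun x => LinearIsometryEquiv.norm_map _ _
  let flux : E3 → ℂ := fun x => dens (m.lam x) (m.mu x) (fun i j => (J t).2 i x j)
    (fun i j => (n x i : ℂ) * v x j)
  have i1 := integrable_dens m.bddMeas_lam m.bddMeas_mu (J t).2 q.2
  have i2 := integrable_dens (hwb.mul m.bddMeas_lam) (hwb.mul m.bddMeas_mu) (J t).2 (V t).2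
  have split : (fun x => dens (m.lam x) (m.mu x) (fun i j => (J t).2 i x j) (fun i j => q.2 i x j))
      =ᵐ[volume] fun x => dens (w x * m.lam x) (w x * m.mu x) (fun i j => (J t).2 i x j)
        (fun i j => (V t).2 i x j) + flux x := by
    filter_upwards [ae_all_iff.2 hq2] with x hx
    rw [dens_mul, ← dens_smul_add_right]
    congr 1
    funext i j
    rw [hx i, hn]
    simp [v]
  have iflux : Integrable flux := by
    refine (i1.sub i2).congr ?_
    filter_upwards [split] with x hx
    rw [Pi.sub_apply, hx]; ring
  have e1 : elasticForm m (J t) q = B (J t) (V t) + ∫ x, flux x := by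
    rw [elasticForm_eq, hB, wForm, wForm, ← integral_add i2 iflux]
    exact integral_congr_ae split
  have e2 : K (W t) v = -elasticForm m (J t) q := by
    rw [← h.eqn t q hq, ← kForm_one, hK]
    refine integral_congr_ae ?_
    filter_upwards [hq1] with x hx
    rw [hx]
    simp only [Complex.ofReal_one, one_mul, Finset.mul_sum, PiLp.smul_apply, Complex.real_smul,
      star_mul', Complex.star_def, Complex.conj_ofReal]
    exact Finset.sum_congr rfl fun i _ => by ring
  have d1 := hasDerivAt_bilin K (h.deriv' t) (h.deriv' t)
  have d2 := hasDerivAt_bilin B (h.deriv t) (h.deriv t)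
  have d3 := hasDerivAt_clm Complex.reCLM (d1.fun_add d2)
  refine ⟨_, d3.congr_of_eventuallyEq (Eventually.of_forall fun s => hKB _), ?_⟩
  have s1 : (K v (W t)).re = (K (W t) v).re := by
    rw [hK, hK, ← star_kForm, Complex.star_def, Complex.conj_re]
  have s2 : (B (V t) (J t)).re = (B (J t) (V t)).re := by
    rw [hB, hB, ← star_wForm, Complex.star_def, Complex.conj_re]
  have tot : Complex.reCLM (K v (W t) + K (W t) v + (B (J t) (V t) + B (V t) (J t))) =
      -(2 * (∫ x, flux x).re) := by
    simp only [Complex.reCLM_apply, Complex.add_re, s1, s2, e2, e1, Complex.neg_re]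
    ring
  refine (le_of_eq tot).trans ?_
  have hre : (∫ x, flux x).re = ∫ x, (flux x).re := (integral_re iflux).symm
  rw [hre, ← integral_const_mul, ← integral_neg]
  refine integral_mono (iflux.re.const_mul 2).neg
    (hχ.integrable_mul (integrable_energyDensity m _)) fun x => ?_
  have b := abs_re_dens_rankOne_le (hm x).1 (hm x).2 hc (fun i j => (J t).2 i x j) (n x) (v x)
  have hE := energyDensity_nonneg m (J t, v) x
  have b2 : 2 * |(flux x).re| ≤ m.cP x * ‖fderiv ℝ w x‖ * energyDensity m (J t, v) x := by
    rw [← hnn, energyDensity, add_comm (‖_‖ ^ 2)]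
    exact b
  calc -(2 * (flux x).re) ≤ 2 * |(flux x).re| := by linarith [neg_abs_le (flux x).re]
    _ ≤ _ := b2.trans (mul_le_mul_of_nonneg_right (hle x) hE)

theorem Medium.bddMeas_cP (m : Medium) : BddMeas m.cP := by
  obtain ⟨M, hM⟩ := m.bounded
  refine ⟨(m.lam_meas.add (m.mu_meas.const_mul 2)).sqrt, Real.sqrt (3 * M), fun x => ?_⟩
  rw [Medium.cP, abs_of_nonneg (Real.sqrt_nonneg _)]
  refine Real.sqrt_le_sqrt ?_
  have h1 := le_abs_self (m.lam x)
  have h2 := le_abs_self (m.mu x)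
  linarith [(hM x).1, (hM x).2]

theorem bddMeas_exp {e : E3 → ℝ} (he : Measurable e) {T : ℝ} (hT : ∀ x, |e x| ≤ T) {k : ℝ}
    (hk : 0 ≤ k) : BddMeas (fun x => Real.exp (2 * k * e x)) := by
  refine ⟨(he.const_mul (2 * k)).exp, Real.exp (2 * k * T), fun x => ?_⟩
  rw [abs_of_pos (Real.exp_pos _)]
  have := (le_abs_self _).trans (hT x)
  gcongr

theorem IsRegularWave.continuous_data {J V : ℝ → Jet} {W : ℝ → VecL2}
    (h : IsRegularWave m J V W) : Continuous fun t => ((J t, (V t).1) : Data) :=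
  (continuous_iff_continuousAt.2 fun t => (h.deriv t).continuousAt).prodMk
    (continuous_iff_continuousAt.2 fun t => (h.deriv' t).continuousAt)

/-- The exponentially weighted energy inequality with a smooth weight. -/
theorem IsRegularWave.exp_wEnergy_le_add {J V : ℝ → Jet} {W : ℝ → VecL2}
    (h : IsRegularWave m J V W) {e ρ : E3 → ℝ} (he : ContDiff ℝ ∞ e) {T N : ℝ}
    (hT : ∀ x, |e x| ≤ T) (hN : ∀ x, ‖fderiv ℝ e x‖ ≤ N) (hρ : BddMeas ρ) (hρ0 : ∀ x, 0 ≤ ρ x)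
    (hle : ∀ x, m.cP x * ‖fderiv ℝ e x‖ ≤ 1 + ρ x) {k : ℝ} (hk : 0 ≤ k) {t : ℝ} (ht : 0 ≤ t) :
    Real.exp (-(2 * k * t)) * wEnergy m (fun x => Real.exp (2 * k * e x)) (J t, (V t).1) ≤
      wEnergy m (fun x => Real.exp (2 * k * e x)) (J 0, (V 0).1) +
      ∫ s in (0 : ℝ)..t,
        2 * k * wEnergy m (fun x => Real.exp (2 * k * e x) * ρ x) (J s, (V s).1) := by
  set w : E3 → ℝ := fun x => Real.exp (2 * k * e x) with hw
  have hws : ContDiff ℝ ∞ w := (contDiff_const.mul he).exp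
  have hwb : BddMeas w := bddMeas_exp he.continuous.measurable hT hk
  obtain ⟨M, hM⟩ := hwb.2
  have hM0 : 0 ≤ M := (abs_nonneg _).trans (hM 0)
  have hfd : ∀ x, ‖fderiv ℝ w x‖ = 2 * k * w x * ‖fderiv ℝ e x‖ := fun x => by
    have hd := ((he.differentiable (by simp) x).hasFDerivAt.const_mul (2 * k)).exp
    rw [hd.fderiv, norm_smul, norm_smul, Real.norm_of_nonneg (Real.exp_pos _).le,
      Real.norm_of_nonneg (by positivity)]
    ring
  have hw0 : ∀ x, 0 ≤ w x := fun x => (Real.exp_pos _).le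
  have hwρ : BddMeas (fun x => w x * ρ x) := hwb.mul hρ
  have hχ : BddMeas (fun x => 2 * k * (w x + w x * ρ x)) := by
    refine (bddMeas_const (2 * k)).mul ⟨hwb.1.add hwρ.1, ?_⟩
    obtain ⟨M', hM'⟩ := hwρ.2
    exact ⟨M + M', fun x => (abs_add_le _ _).trans (add_le_add (hM x) (hM' x))⟩
  have hdom : ∀ x, m.cP x * ‖fderiv ℝ w x‖ ≤ 2 * k * (w x + w x * ρ x) := fun x => by
    rw [hfd]
    have := mul_le_mul_of_nonneg_left (hle x) (mul_nonneg (mul_nonneg zero_le_two hk) (hw0 x))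
    linarith
  have hNw : ∀ x, ‖fderiv ℝ w x‖ ≤ 2 * k * M * N := fun x => by
    rw [hfd]
    have h1 := (le_abs_self _).trans (hM x)
    have h2 := hN x
    gcongr
  choose D hD hDle using fun s => h.exists_deriv_wEnergy_le hws hM hNw hχ hdom s
  set y : ℝ → Data := fun s => (J s, (V s).1)
  have hy : Continuous y := h.continuous_data
  have hsplit : ∀ s, wEnergy m (fun x => 2 * k * (w x + w x * ρ x)) (y s) =
      2 * k * (wEnergy m w (y s) + wEnergy m (fun x => w x * ρ x) (y s)) := fun s => by
    have i := integrable_energyDensity m (y s)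
    simp only [wEnergy]
    rw [← integral_add (hwb.integrable_mul i) (hwρ.integrable_mul i), ← integral_const_mul]
    refine integral_congr_ae (Eventually.of_forall fun x => ?_)
    simp only; ring
  have hG : ∀ s, HasDerivAt (fun s => Real.exp (-(2 * k * s)) * wEnergy m w (y s))
      (Real.exp (-(2 * k * s)) * (-(2 * k)) * wEnergy m w (y s) +
        Real.exp (-(2 * k * s)) * D s) s := fun s => by
    have hx : HasDerivAt (fun s => Real.exp (-(2 * k * s))) (Real.exp (-(2 * k * s)) * (-(2 * k))) s := by
      have := ((hasDerivAt_id s).const_mul (2 * k)).fun_neg.exp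
      simpa using this
    exact hx.fun_mul (hD s)
  have hr : Continuous fun s => 2 * k * wEnergy m (fun x => w x * ρ x) (y s) :=
    continuous_const.mul ((continuous_wEnergy m hwρ).comp hy)
  -- The factor exp(−2kt) absorbs the growth 2k times the weighted energy. Only the excess ρ of
  -- c_P|∇e| over 1 remains, where the exponential is dropped because it is at most 1.
  have key := intervalIntegral.sub_le_integral_of_hasDeriv_right_of_le ht
    (continuous_iff_continuousAt.2 fun s => (hG s).continuousAt).continuousOn
    (fun s _ => (hG s).hasDerivWithinAt) (hr.continuousOn.integrableOn_compact isCompact_Icc)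
    (fun s hs => by
      have h1 := hDle s
      change D s ≤ wEnergy m _ (y s) at h1
      rw [hsplit] at h1
      have hρE : 0 ≤ 2 * k * wEnergy m (fun x => w x * ρ x) (y s) :=
        mul_nonneg (by positivity) (integral_nonneg fun x =>
          mul_nonneg (mul_nonneg (hw0 x) (hρ0 x)) (energyDensity_nonneg m _ x))
      have hexp : Real.exp (-(2 * k * s)) ≤ 1 := by
        rw [Real.exp_le_one_iff, neg_nonpos]
        exact mul_nonneg (by positivity) hs.1.le
      calc _ = Real.exp (-(2 * k * s)) * (D s - 2 * k * wEnergy m w (y s)) := by ring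
        _ ≤ Real.exp (-(2 * k * s)) * (2 * k * wEnergy m (fun x => w x * ρ x) (y s)) :=
            mul_le_mul_of_nonneg_left (by linarith) (Real.exp_pos _).le
        _ ≤ 1 * (2 * k * wEnergy m (fun x => w x * ρ x) (y s)) :=
            mul_le_mul_of_nonneg_right hexp hρE
        _ = _ := one_mul _)
  simp only [mul_zero, neg_zero, Real.exp_zero, one_mul] at key
  linarith

/-- The exponentially weighted energy inequality for eikonal weights. -/
theorem IsRegularWave.exp_wEnergy_le {J V : ℝ → Jet} {W : ℝ → VecL2}
    (h : IsRegularWave m J V W) {e : E3 → ℝ} (he : IsEikonal m e) {T : ℝ}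
    (hT : ∀ x, |e x| ≤ T) {k : ℝ} (hk : 0 ≤ k) {t : ℝ} (ht : 0 ≤ t) :
    Real.exp (-(2 * k * t)) * wEnergy m (fun x => Real.exp (2 * k * e x)) (J t, (V t).1) ≤
      wEnergy m (fun x => Real.exp (2 * k * e x)) (J 0, (V 0).1) := by
  obtain ⟨E, hE, hET, ⟨N, hN⟩, hlim, hgrad⟩ := he.exists_smooth_approx hT
  let g : ℕ → E3 → ℝ := fun n x => m.cP x * ‖fderiv ℝ (E n) x‖
  -- The excess of c_P|∇Eₙ| over 1 is uniformly bounded and tends to 0 almost everywhere, so its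
  -- contribution vanishes by dominated convergence, first in space and then in time.
  let ρ : ℕ → E3 → ℝ := fun n x => max 0 (g n x - 1)
  obtain ⟨C, hC⟩ := m.bddMeas_cP.2
  have hcP0 : ∀ x, 0 ≤ m.cP x := fun x => Real.sqrt_nonneg _
  have hρ0 : ∀ n x, 0 ≤ ρ n x := fun n x => le_max_left _ _
  have hN0 : 0 ≤ N := (norm_nonneg _).trans (hN 0 0)
  have hC0 : 0 ≤ C := (abs_nonneg _).trans (hC 0)
  have hρle : ∀ n x, ρ n x ≤ C * N := fun n x => by
    have h1 : g n x ≤ C * N :=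
      mul_le_mul ((le_abs_self _).trans (hC x)) (hN n x) (norm_nonneg _) hC0
    exact max_le (by positivity) (by linarith)
  have hgm : ∀ n, Measurable (g n) := fun n =>
    m.bddMeas_cP.1.mul (((hE n).continuous_fderiv (by simp)).norm.measurable)
  have hρb : ∀ n, BddMeas (ρ n) := fun n =>
    ⟨measurable_const.max ((hgm n).sub_const 1), C * N, fun x => by
      rw [abs_of_nonneg (hρ0 n x)]; exact hρle n x⟩
  have hρlim : ∀ᵐ x, Tendsto (fun n => ρ n x) atTop (𝓝 0) := by
    filter_upwards [hgrad] with x hx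
    rw [Metric.tendsto_atTop']
    intro ε hε
    obtain ⟨n, hn⟩ := eventually_atTop.1 (hx (ε / 2) (half_pos hε))
    refine ⟨n, fun k hk => ?_⟩
    rw [Real.dist_eq, sub_zero, abs_of_nonneg (hρ0 k x)]
    have := hn k hk.le
    exact max_lt hε (by simp only [g]; linarith)
  have hwb : ∀ n, BddMeas (fun x => Real.exp (2 * k * E n x)) := fun n =>
    bddMeas_exp (hE n).continuous.measurable (hET n) hk
  have hwM : ∀ n x, |Real.exp (2 * k * E n x)| ≤ Real.exp (2 * k * T) := fun n x => by
    rw [abs_of_pos (Real.exp_pos _)]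
    have := (le_abs_self _).trans (hET n x)
    gcongr
  have hwlim : ∀ x, Tendsto (fun n => Real.exp (2 * k * E n x)) atTop
      (𝓝 (Real.exp (2 * k * e x))) := fun x =>
    (Real.continuous_exp.tendsto _).comp ((hlim x).const_mul (2 * k))
  have hwρb : ∀ n, BddMeas (fun x => Real.exp (2 * k * E n x) * ρ n x) := fun n =>
    (hwb n).mul (hρb n)
  have hwρM : ∀ n x, |Real.exp (2 * k * E n x) * ρ n x| ≤ Real.exp (2 * k * T) * (C * N) :=
    fun n x => by
      rw [abs_mul, abs_of_nonneg (hρ0 n x)]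
      exact mul_le_mul (hwM n x) (hρle n x) (hρ0 n x) (Real.exp_pos _).le
  have hwρlim : ∀ s, Tendsto (fun n => wEnergy m (fun x => Real.exp (2 * k * E n x) * ρ n x)
      (J s, (V s).1)) atTop (𝓝 0) := fun s => by
    have := tendsto_wEnergy m (w' := fun _ => 0) hwρb hwρM (by
      filter_upwards [hρlim] with x hx
      simpa using (hwlim x).mul hx) (J s, (V s).1)
    simpa [wEnergy] using this
  have l1 : ∀ s, Tendsto (fun n => wEnergy m (fun x => Real.exp (2 * k * E n x)) (J s, (V s).1))
      atTop (𝓝 (wEnergy m (fun x => Real.exp (2 * k * e x)) (J s, (V s).1))) := fun s =>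
    tendsto_wEnergy m hwb hwM (Eventually.of_forall hwlim) _
  have hy : Continuous fun s => ((J s, (V s).1) : Data) := h.continuous_data
  have l2 : Tendsto (fun n => ∫ s in (0 : ℝ)..t,
      2 * k * wEnergy m (fun x => Real.exp (2 * k * E n x) * ρ n x) (J s, (V s).1)) atTop (𝓝 0) := by
    have := intervalIntegral.tendsto_integral_filter_of_dominated_convergence (μ := volume)
      (a := 0) (b := t) (l := atTop) (f := fun _ => (0 : ℝ))
      (F := fun n s => 2 * k * wEnergy m (fun x => Real.exp (2 * k * E n x) * ρ n x) (J s, (V s).1))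
      (fun s => 2 * k * wEnergy m (fun _ => Real.exp (2 * k * T) * (C * N)) (J s, (V s).1))
      (Eventually.of_forall fun n => (continuous_const.mul
        ((continuous_wEnergy m (hwρb n)).comp hy)).aestronglyMeasurable)
      (Eventually.of_forall fun n => Eventually.of_forall fun s _ => by
        have h0 : 0 ≤ wEnergy m (fun x => Real.exp (2 * k * E n x) * ρ n x) (J s, (V s).1) :=
          integral_nonneg fun x => mul_nonneg (mul_nonneg (Real.exp_pos _).le (hρ0 n x))
            (energyDensity_nonneg m _ x)
        rw [Real.norm_of_nonneg (by positivity)]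
        exact mul_le_mul_of_nonneg_left (wEnergy_mono m (hwρb n) (bddMeas_const _)
          (fun x => (le_abs_self _).trans (hwρM n x)) _) (by positivity))
      ((continuous_const.mul
        ((continuous_wEnergy m (bddMeas_const _)).comp hy)).intervalIntegrable _ _)
      (Eventually.of_forall fun s _ => by simpa using (hwρlim s).const_mul (2 * k))
    simpa using this
  have l3 := (l1 0).add l2
  rw [add_zero] at l3
  refine le_of_tendsto_of_tendsto' ((l1 t).const_mul _) l3 fun n => ?_
  refine h.exp_wEnergy_le_add (hE n) (hET n) (hN n) (hρb n) (hρ0 n) (fun x => ?_) hk ht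
  have := le_max_right 0 (g n x - 1)
  simp only [g, ρ] at this ⊢
  linarith

theorem IsWave.exp_wEnergy_le {u : ℝ → Data} (hu : IsWave m u) {e : E3 → ℝ} (he : IsEikonal m e)
    {T : ℝ} (hT : ∀ x, |e x| ≤ T) {k : ℝ} (hk : 0 ≤ k) {t : ℝ} (ht : 0 ≤ t) :
    Real.exp (-(2 * k * t)) * wEnergy m (fun x => Real.exp (2 * k * e x)) (u t) ≤
      wEnergy m (fun x => Real.exp (2 * k * e x)) (u 0) := by
  have hc := continuous_wEnergy m (bddMeas_exp he.continuous.measurable hT hk)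
  have l : ∀ s, Tendsto (fun ε => wEnergy m (fun x => Real.exp (2 * k * e x))
      (steklov u ε s, (steklovVel u ε s).1)) (𝓝[>] 0)
      (𝓝 (wEnergy m (fun x => Real.exp (2 * k * e x)) (u s))) := fun s =>
    (hc.tendsto _).comp (hu.tendsto_steklov s)
  exact le_of_tendsto_of_tendsto' ((l t).const_mul _) (l 0) fun ε =>
    (hu.isRegularWave_steklov ε).exp_wEnergy_le he hT hk ht

/-! ### Finite speed of propagation -/

theorem energyDensity_eq_zero (m : Medium) {S : Set E3} {h : Data} (hh : h ∈ cauchy S) :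
    ∀ᵐ x, x ∉ S → energyDensity m h x = 0 := by
  have h1 : ∀ᵐ x, ∀ i, x ∉ S → h.1.2 i x = 0 := ae_all_iff.2 (H10_le_L2On hh.1).2
  have h2 : ∀ᵐ x, x ∉ S → h.2 x = 0 := hh.2
  filter_upwards [h1, h2] with x h1 h2 hx
  simp [energyDensity, dens, h1 _ hx, h2 hx]

/-- Since e = 0 on S, the initial weighted energy does not depend on k. On {e ≥ τ} the weight is at
least exp(2kτ), so the velocity there has mass at most exp(−2k(τ − t)) times the initial energy; let
k → ∞. -/
theorem IsWave.velocity_eq_zero {u : ℝ → Data} (hu : IsWave m u) {e : E3 → ℝ}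
    (he : IsEikonal m e) {T : ℝ} (hT : ∀ x, |e x| ≤ T) {S : Set E3} (h0 : u 0 ∈ cauchy S)
    (hS : ∀ x ∈ S, e x = 0) {t τ : ℝ} (ht : 0 ≤ t) (hτ : t < τ) : (u t).2 ∈ L2On {x | e x < τ} := by
  have hem : Measurable e := he.continuous.measurable
  set E0 := wEnergy m (fun _ => 1) (u 0)
  set A : Set E3 := {x | τ ≤ e x}
  have hA : MeasurableSet A := measurableSet_le measurable_const hem
  set I := ∫ x in A, ‖(u t).2 x‖ ^ 2
  have hI0 : 0 ≤ I := integral_nonneg fun x => sq_nonneg _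
  have bound : ∀ k : ℕ, I ≤ Real.exp (-((2 * (τ - t)) * k)) * E0 := fun k => by
    have hk : (0 : ℝ) ≤ k := Nat.cast_nonneg k
    have h1 := hu.exp_wEnergy_le he hT hk ht
    have h2 : wEnergy m (fun x => Real.exp (2 * k * e x)) (u 0) = E0 := by
      refine integral_congr_ae ?_
      filter_upwards [energyDensity_eq_zero m h0] with x hx
      by_cases hxS : x ∈ S
      · simp [hS x hxS]
      · simp [hx hxS]
    have h3 : Real.exp (2 * k * τ) * I ≤ wEnergy m (fun x => Real.exp (2 * k * e x)) (u t) := by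
      rw [← integral_const_mul]
      have i2 := (bddMeas_exp hem hT hk).integrable_mul (integrable_energyDensity m (u t))
      refine le_trans ?_ (setIntegral_le_integral (s := A) i2 (Eventually.of_forall fun x =>
        mul_nonneg (Real.exp_pos _).le (energyDensity_nonneg m _ x)))
      refine setIntegral_mono_on ((integrable_norm_sq _).const_mul _).integrableOn i2.integrableOn
        hA fun x hx => ?_
      have hx' : τ ≤ e x := hx
      have := norm_sq_le_energyDensity m (u t) x
      exact mul_le_mul (Real.exp_le_exp.2 (mul_le_mul_of_nonneg_left hx' (by positivity))) this
        (sq_nonneg _) (Real.exp_pos _).le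
    rw [h2] at h1
    have h4 : Real.exp (-(2 * k * t)) * (Real.exp (2 * k * τ) * I) ≤ E0 :=
      (mul_le_mul_of_nonneg_left h3 (Real.exp_pos _).le).trans h1
    have h5 : Real.exp (-((2 * (τ - t)) * k)) * (Real.exp (-(2 * k * t)) *
        (Real.exp (2 * k * τ) * I)) = I := by
      rw [← mul_assoc, ← mul_assoc, ← Real.exp_add, ← Real.exp_add]
      have : -(2 * (τ - t) * k) + -(2 * k * t) + 2 * k * τ = 0 := by ring
      rw [this, Real.exp_zero, one_mul]
    rw [← h5]
    exact mul_le_mul_of_nonneg_left h4 (Real.exp_pos _).le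
  have lim : Tendsto (fun k : ℕ => Real.exp (-((2 * (τ - t)) * k)) * E0) atTop (𝓝 0) := by
    have h1 : Tendsto (fun k : ℕ => (2 * (τ - t)) * (k : ℝ)) atTop atTop :=
      tendsto_natCast_atTop_atTop.const_mul_atTop (by linarith)
    simpa using (Real.tendsto_exp_neg_atTop_nhds_zero.comp h1).mul_const E0
  have hI : I = 0 := le_antisymm (ge_of_tendsto' lim bound) hI0
  have hz := (setIntegral_eq_zero_iff_of_nonneg_ae (Eventually.of_forall fun x => sq_nonneg _)
    (integrable_norm_sq (u t).2).integrableOn).1 hI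
  have hz' := (ae_restrict_iff' hA).1 hz
  change ∀ᵐ x, x ∉ {x | e x < τ} → (u t).2 x = 0
  filter_upwards [hz'] with x hx hxA
  have := hx (not_lt.1 hxA)
  simpa using this

/-- Finite speed of propagation: after time `T`, data that vanish off `A` have not travelled
further than `P`-distance `T` from `A`. -/
theorem IsWave.finite_speed {u : ℝ → Data} (hu : IsWave m u) {A S : Set E3} (hA : A.Nonempty)
    (hSA : S ⊆ A) (h0 : u 0 ∈ cauchy S) {T : ℝ} (hT : 0 < T) :
    (u T).2 ∈ L2On {x | (pDistSets m {x} A).toReal < T} := by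
  have he := isEikonal_truncDist m hA T
  have hb : ∀ x, |truncDist m A T x| ≤ T := fun x => by
    rw [truncDist, abs_of_nonneg (le_min ENNReal.toReal_nonneg hT.le)]
    exact min_le_right _ _
  have hS : ∀ x ∈ S, truncDist m A T x = 0 := fun x hx => by
    rw [truncDist, pDistSets_eq_zero m (hSA hx), ENNReal.toReal_zero, min_eq_left hT.le]
  have hset : {x | truncDist m A T x < T} = {x | (pDistSets m {x} A).toReal < T} := by
    ext x; simp [truncDist]
  rw [← hset]
  -- The decay needs t strictly below the threshold T, so the endpoint is reached by continuity and
  -- closedness of L².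
  have hcont : Tendsto (fun t => (u t).2) (𝓝[<] T) (𝓝 (u T).2) :=
    ((continuous_snd.comp hu.2.1).tendsto T).mono_left nhdsWithin_le_nhds
  refine (isClosed_L2On _).mem_of_tendsto hcont ?_
  filter_upwards [self_mem_nhdsWithin, mem_nhdsWithin_of_mem_nhds (Ioi_mem_nhds hT)] with t h1 h2
  exact hu.velocity_eq_zero he hb h0 hS (le_of_lt h2) h1

end ElasticSC

end

/-! ### Supports, orthogonality and the scattering control equation. -/

noncomputable section

namespace ElasticSC

theorem timeReversal_timeReversal (h : Data) : timeReversal (timeReversal h) = h := by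
  simp [timeReversal]

theorem timeReversal_sub (f g : Data) :
    timeReversal (f - g) = timeReversal f - timeReversal g := by
  simp only [timeReversal, Prod.fst_sub, Prod.snd_sub, Prod.mk_sub_mk]
  rw [neg_sub_neg, neg_sub]

theorem timeReversal_mem_cauchy {U : Set E3} {h : Data} (hh : h ∈ cauchy U) :
    timeReversal h ∈ cauchy U :=
  ⟨hh.1, (L2On U).neg_mem hh.2⟩

theorem energyInner_timeReversal (m : Medium) (f g : Data) :
    energyInner m (timeReversal f) (timeReversal g) = energyInner m f g := by
  simp [energyInner_eq', timeReversal]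

theorem fst_mem_of_mem_cauchy {U : Set E3} {h : Data} (hh : h ∈ cauchy U) : h.1 ∈ H10 univ :=
  H10_mono (subset_univ U) hh.1

theorem inner_eq_zero_of_mem_L2On {A B : Set E3} {f g : VecL2} (hf : f ∈ L2On A) (hg : g ∈ L2On B)
    (hAB : Disjoint A B) : (inner ℂ f g : ℂ) = 0 := by
  rw [L2.inner_def]
  refine integral_eq_zero_of_ae ?_
  have hf' : ∀ᵐ x, x ∉ A → f x = 0 := hf
  have hg' : ∀ᵐ x, x ∉ B → g x = 0 := hg
  filter_upwards [hf', hg'] with x h1 h2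
  by_cases hx : x ∈ A
  · simp [h2 (disjoint_left.1 hAB hx)]
  · simp [h1 hx]

theorem energyInner_eq_zero_of_disjoint (m : Medium) {A B : Set E3} {f g : Data}
    (hf : f ∈ cauchy A) (hg : g ∈ cauchy B) (hAB : Disjoint A B) : energyInner m f g = 0 := by
  rw [energyInner_eq', inner_eq_zero_of_mem_L2On hg.2 hf.2 hAB.symm, zero_add, elasticForm]
  refine integral_eq_zero_of_ae ?_
  have h1 : ∀ᵐ x, ∀ i, x ∉ A → f.1.2 i x = 0 := ae_all_iff.2 (H10_le_L2On hf.1).2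
  have h2 : ∀ᵐ x, ∀ i, x ∉ B → g.1.2 i x = 0 := ae_all_iff.2 (H10_le_L2On hg.1).2
  filter_upwards [h1, h2] with x h1 h2
  by_cases hx : x ∈ A
  · have hB := disjoint_left.1 hAB hx
    simp [divergence, strain, h2 _ hB]
  · simp [divergence, strain, h1 _ hx]

/-- Test with the restriction of v to U. -/
theorem mem_L2On_compl_of_inner_eq_zero {U : Set E3} (hU : MeasurableSet U) {v : VecL2}
    (h : ∀ f ∈ L2On U, (inner ℂ f v : ℂ) = 0) : v ∈ L2On Uᶜ := by
  have hm : MemLp (U.indicator v) 2 volume := (Lp.memLp v).indicator hU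
  set f : VecL2 := hm.toLp _
  have hf : f =ᵐ[volume] U.indicator v := hm.coeFn_toLp
  have h1 : (inner ℂ f f : ℂ) = inner ℂ f v := by
    rw [L2.inner_def, L2.inner_def]
    refine integral_congr_ae ?_
    filter_upwards [hf] with x hx
    by_cases hxU : x ∈ U <;> simp [hx, hxU]
  have hfU : f ∈ L2On U := by
    change ∀ᵐ x, x ∉ U → f x = 0
    filter_upwards [hf] with x hx hxU
    simp [hx, hxU]
  have h0 : f = 0 := inner_self_eq_zero.1 (h1.trans (h f hfU))
  change ∀ᵐ x, x ∉ Uᶜ → v x = 0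
  filter_upwards [hf, Lp.coeFn_zero C3 2 (volume : Measure E3)] with x hx hz hxU
  rw [notMem_compl_iff] at hxU
  rw [h0, hz, indicator_of_mem hxU] at hx
  exact hx.symm

/-- Testing with pure velocities (0, f) isolates the L² part of the energy product. -/
theorem snd_sub_proj_mem (m : Medium) {U : Set E3} (hU : Bornology.IsBounded U)
    (hUm : MeasurableSet U) (h : Data) : (h - proj m U h).2 ∈ L2On Uᶜ :=
  mem_L2On_compl_of_inner_eq_zero hUm fun f hf => by
    have := (proj_spec m hU h).2 (0, f) ⟨(H10 U).zero_mem, hf⟩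
    rw [energyInner_eq'] at this
    simpa [elasticForm, divergence, strain] using this

theorem measurable_toReal_pDistSets (m : Medium) (A : Set E3) :
    Measurable fun x => (pDistSets m {x} A).toReal := by
  rcases A.eq_empty_or_nonempty with rfl | hA
  · simp [pDistSets]
  · refine measurable_of_Iio fun r => ?_
    -- Truncating at r does not change the sublevel set at r, and the truncated distance is
    -- continuous.
    have : (fun x => (pDistSets m {x} A).toReal) ⁻¹' Iio r = {x | truncDist m A r x < r} := by
      ext x; simp [truncDist]
    rw [this]
    exact measurableSet_lt (isEikonal_truncDist m hA r).continuous.measurable measurable_const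

theorem measurableSet_outer (m : Medium) {Θ Υ : Set E3} (hΘ : MeasurableSet Θ)
    (hΥ : MeasurableSet Υ) (t : ℝ) : MeasurableSet (outer m Θ Υ t) := by
  have hd := measurable_toReal_pDistSets m (frontier Θ)
  exact hΥ.inter (measurableSet_lt (Measurable.ite hΘ hd hd.neg) measurable_const)

theorem notMem_of_mem_outer_zero {m : Medium} {Θ Υ : Set E3} {x : E3}
    (hx : x ∈ outer m Θ Υ 0) : x ∉ Θ := fun h => by
  have := hx.2
  rw [pDepth, if_pos h] at this
  exact this.not_ge ENNReal.toReal_nonneg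

theorem propagator_finite_speed (m : Medium) {A S : Set E3} (hA : A.Nonempty) (hSA : S ⊆ A)
    {h : Data} (hh : h ∈ cauchy S) {T : ℝ} (hT : 0 < T) :
    (propagator m T h).2 ∈ L2On {x | (pDistSets m {x} A).toReal < T} := by
  obtain ⟨u, hu, rfl⟩ := exists_wave m (fst_mem_of_mem_cauchy hh)
  rw [hu.propagator_eq]
  exact hu.finite_speed hA hSA hh hT

/-- A path from outside Υ into the closure of Θ crosses ∂Υ, so its travel time exceeds T. -/
theorem snd_propagator_mem_L2On (m : Medium) {Θ Υ : Set E3} (hne : Θ.Nonempty)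
    (hΘΥ : closure Θ ⊆ Υ) {T : ℝ} (hT : 0 < T)
    (hΥT : ENNReal.ofReal T < pDistSets m (frontier Υ) (closure Θ)) {h : Data}
    (hh : h ∈ cauchy Θ) : (propagator m T h).2 ∈ L2On Υ := by
  refine L2On_mono (fun x hx => ?_)
    (propagator_finite_speed m hne.closure subset_closure hh hT)
  by_contra hxΥ
  have h1 : pDistSets m (frontier Υ) (closure Θ) ≤ pDistSets m {x} (closure Θ) := by
    rw [pDistSets_singleton]
    exact le_iInf₂ fun y hy => pDistSets_frontier_le' m hxΥ (hΘΥ hy) hy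
  have h2 := (ENNReal.ofReal_le_iff_le_toReal (pDistSets_ne_top m hne.closure x)).1
    (hΥT.le.trans h1)
  exact absurd hx h2.not_gt

/-- Finite speed is applied with A = Θᶜ. From a point of Θ, any path to Θᶜ first meets ∂Θ, so the
depth is at most the distance to Θᶜ; outside Θ the depth is at most 0. -/
theorem snd_propagator_mem_L2On_of_outer (m : Medium) {Θ Υ : Set E3} (hne : Θᶜ.Nonempty)
    {T : ℝ} (hT : 0 < T) {g : Data} (hg : g ∈ cauchy (outer m Θ Υ 0)) :
    (propagator m T g).2 ∈ L2On {x | pDepth m Θ x < T} := by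
  refine L2On_mono (fun x hx => ?_)
    (propagator_finite_speed m hne (fun x hx => notMem_of_mem_outer_zero hx) hg hT)
  change pDepth m Θ x < T
  rw [pDepth]
  split_ifs with hxΘ
  · refine lt_of_le_of_lt (ENNReal.toReal_mono (pDistSets_ne_top m hne x) ?_) hx
    rw [pDistSets_singleton m x Θᶜ]
    exact le_iInf₂ fun y hy => pDistSets_frontier_le m hxΘ hy
  · linarith [@ENNReal.toReal_nonneg (pDistSets m {x} (frontier Θ))]

/-- The velocity of R_T g lives at depth below T. That of the almost direct transmission vanishes
outside Υ and on the part of Υ of depth below T, so the supports are disjoint. -/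
theorem inner_snd_almostDirect (m : Medium) {Θ Υ : Set E3} (hΘ : IsOpen Θ) (hΥ : IsOpen Υ)
    (hΥb : Bornology.IsBounded Υ) (hΘΥ : closure Θ ⊆ Υ) (hne : Θ.Nonempty) {T : ℝ} (hT : 0 < T)
    (hΥT : ENNReal.ofReal T < pDistSets m (frontier Υ) (closure Θ)) {h g : Data}
    (hh : h ∈ cauchy Θ) (hg : g ∈ cauchy (outer m Θ Υ 0)) :
    (inner ℂ (propagator m T g).2 (almostDirect m Θ Υ T h).2 : ℂ) = 0 := by
  have hb : Bornology.IsBounded (outer m Θ Υ T) := hΥb.subset fun x hx => hx.1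
  have hc : Θᶜ.Nonempty := by
    rw [nonempty_compl]
    rintro rfl
    exact NormedSpace.unbounded_univ ℝ E3 (hΥb.subset (subset_closure.trans hΘΥ))
  have h1 : (almostDirect m Θ Υ T h).2 ∈ L2On (outer m Θ Υ T)ᶜ :=
    snd_sub_proj_mem m hb (measurableSet_outer m hΘ.measurableSet hΥ.measurableSet T) _
  have h2 : (almostDirect m Θ Υ T h).2 ∈ L2On Υ :=
    (L2On Υ).sub_mem (snd_propagator_mem_L2On m hne hΘΥ hT hΥT hh)
      (L2On_mono (fun x hx => hx.1) (proj_spec m hb _).1.2)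
  have h3 : (almostDirect m Θ Υ T h).2 ∈ L2On (Υ \ outer m Θ Υ T) := by
    have h1' : ∀ᵐ x, x ∉ (outer m Θ Υ T)ᶜ → (almostDirect m Θ Υ T h).2 x = 0 := h1
    have h2' : ∀ᵐ x, x ∉ Υ → (almostDirect m Θ Υ T h).2 x = 0 := h2
    change ∀ᵐ x, _
    filter_upwards [h1', h2'] with x a1 a2 hx
    by_cases hxΥ : x ∈ Υ
    · exact a1 fun hxo => hx ⟨hxΥ, hxo⟩
    · exact a2 hxΥ
  exact inner_eq_zero_of_mem_L2On (snd_propagator_mem_L2On_of_outer m hc hT hg) h3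
    (disjoint_left.2 fun x hx hx' => hx'.2 ⟨hx'.1, hx⟩)

/-- If the velocity of `d` is orthogonal to that of `R_T g` for all `g` supported in `U`, then
orthogonality of `d` to the data `R_{-T} g` entails orthogonality to the data `R_T g`. -/
theorem energyInner_propagator_eq_zero_of_neg (m : Medium) {U : Set E3} {d : Data} {T : ℝ}
    (hv : ∀ g ∈ cauchy U, (inner ℂ (propagator m T g).2 d.2 : ℂ) = 0)
    (hd : ∀ g ∈ cauchy U, energyInner m d (propagator m (-T) g) = 0) {g : Data}
    (hg : g ∈ cauchy U) : energyInner m d (propagator m T g) = 0 := by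
  have h1 := hd _ (timeReversal_mem_cauchy hg)
  rw [propagator_timeReversal (fst_mem_of_mem_cauchy hg), neg_neg, energyInner_eq'] at h1
  simp only [timeReversal, inner_neg_left, hv g hg, neg_zero, zero_add] at h1
  rw [energyInner_eq', hv g hg, zero_add, h1]

end ElasticSC

end

open ElasticSC in
theorem lemmal (m : Medium) (Θ Υ : Set E3)
    (hΘ : IsOpen Θ) (hΥ : IsOpen Υ) (hΥb : Bornology.IsBounded Υ) (hΘΥ : closure Θ ⊆ Υ)
    (T : ℝ) (hT : 0 < T) (hTdiam : ENNReal.ofReal (2 * T) < pDiam m Θ)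
    (hΥT : ENNReal.ofReal T < pDistSets m (frontier Υ) (closure Θ))
    (h₀ Ktail hinf : Data)
    (hh₀ : h₀ ∈ cauchy Θ) (hK : Ktail ∈ cauchy (outer m Θ Υ 0)) (hinf_eq : hinf = h₀ + Ktail)
    (hDT : propagator m (-T) (piBar m Θ Υ (propagator m (2 * T) hinf))
      = almostDirect m Θ Υ T h₀) :
    hinf - piStar m Θ Υ (reversedPropagator m T
      (piStar m Θ Υ (reversedPropagator m T hinf))) = h₀ := by
  -- The empty set has P-diameter 0.
  have hne : Θ.Nonempty := by
    rw [nonempty_iff_ne_empty]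
    rintro rfl
    simp [pDiam] at hTdiam
  have hb : Bornology.IsBounded (outer m Θ Υ 0) := hΥb.subset fun x hx => hx.1
  have hi : hinf.1 ∈ H10 univ := by
    rw [hinf_eq]
    exact (H10 univ).add_mem (fst_mem_of_mem_cauchy hh₀) (fst_mem_of_mem_cauchy hK)
  rw [piBar] at hDT
  simp only [reversedPropagator, piStar] at hDT ⊢
  have hk := propagator_mem (m := m) hi (2 * T)
  have hback : propagator m (-(2 * T)) (propagator m (2 * T) hinf) = hinf := by
    rw [propagator_propagator hi, neg_add_cancel, propagator_zero hi]
  set k := propagator m (2 * T) hinf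
  obtain ⟨hy, hz⟩ := proj_spec m hb k
  set y := proj m (outer m Θ Υ 0) k
  have hy1 := fst_mem_of_mem_cauchy hy
  have hz1 : (k - y).1 ∈ H10 univ := (H10 univ).sub_mem hk hy1
  have hd1 := propagator_mem (m := m) hz1 (-T)
  -- Time reversal is an energy isometry preserving H⋆, so it commutes with the projection.
  have hν : proj m (outer m Θ Υ 0) (timeReversal k) = timeReversal y := by
    refine proj_eq hb (timeReversal_mem_cauchy hy) fun q hq => ?_
    rw [← timeReversal_sub, ← timeReversal_timeReversal q, energyInner_timeReversal]
    exact hz _ (timeReversal_mem_cauchy hq)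
  have hR : timeReversal (propagator m (2 * T) (timeReversal y)) =
      hinf - propagator m (-T) (propagator m (-T) (k - y)) := by
    rw [propagator_timeReversal hy1, timeReversal_timeReversal, propagator_propagator hz1,
      show -T + -T = -(2 * T) by ring, propagator_sub hk hy1, hback, sub_sub_cancel]
  -- Orthogonality of k − y to H⋆ gives the statement with R_{-T}g; the vanishing velocity product
  -- lets the direction of time be flipped.
  have hd : ∀ g ∈ cauchy (outer m Θ Υ 0),
      energyInner m (propagator m (-T) (k - y)) (propagator m T g) = 0 := fun g hg => by
    refine energyInner_propagator_eq_zero_of_neg m (fun g hg => ?_) (fun g hg => ?_) hg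
    · rw [hDT]
      exact inner_snd_almostDirect m hΘ hΥ hΥb hΘΥ hne hT hΥT hh₀ hg
    · rw [energyInner_propagator hz1 (fst_mem_of_mem_cauchy hg)]
      exact hz g hg
  -- By uniqueness of the projection it suffices that h₀ − R_{-T}R_{-T}(k − y) be orthogonal to H⋆.
  rw [hν, hR, proj_eq hb hK, hinf_eq, add_sub_cancel_right]
  intro g hg
  have hg1 := fst_mem_of_mem_cauchy hg
  have h1 : energyInner m h₀ g = 0 := energyInner_eq_zero_of_disjoint m hh₀ hg
    (disjoint_left.2 fun x hx hx' => notMem_of_mem_outer_zero hx' hx)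
  have h2 : propagator m (-T) (propagator m T g) = g := by
    rw [propagator_propagator hg1, neg_add_cancel, propagator_zero hg1]
  have h3 := energyInner_propagator (m := m) hd1 (propagator_mem (m := m) hg1 T) (-T)
  rw [h2, hd g hg] at h3
  rw [hinf_eq, sub_right_comm, add_sub_cancel_right, energyInner_sub_left, h1, h3, sub_zero]
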